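/- Let $\Sigma$ be a smooth $3$-manifold (Hausdorff, second countable), let $I\subset\mathbb R$ be an interval of length $|I|$, and let $\mathcal M_I=I\times\Sigma$ carry a smooth Lorentzian metric of the form $$\mathbf g=-n^2\,dt^2+g_t ,$$ where the lapse $n>0$ and the Riemannian metrics $g=g_t$ on the leaves $\Sigma_t=\{t\}\times\Sigma$ depend smoothly on $(t,x)\in I\times\Sigma$. Assume that $\mathbf g$ satisfies the Einstein vacuum equations $\mathbf R_{\alpha\beta}=0$, and that either $\Sigma$ is compact or every $(\Sigma_t,g_t)$, $t\in I$, is asymptotically flat: outside a compact set $\Sigma$ is a nonempty finite union of pairwise disjoint ends, each carrying smooth coordinates $y$ that identify it with the exterior of a ball in $\mathbb R^3$ (and extend slightly beyond the boundary of the end), in which $\partial^m(g_{ij}-\delta_{ij})=O(|y|^{-\tau-m})$ as $|y|\to\infty$ for $m=0,1,2$ and some $\tau>0$. Let $\mathbf T=n^{-1}\partial_t$ be the future unit normal of the leaves, ${}^{(\mathbf T)}\pi=\mathcal L_{\mathbf T}\mathbf g$ its deformation tensor and $\mathbf R$ the Riemann curvature tensor of $\mathbf g$. Pointwise norms of spacetime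 tensors are taken with respect to the Riemannian metric $n^2dt^2+g_t$. Put $\|\pi(t)\|_{L^\infty}=\sup_{\Sigma_t}|{}^{(\mathbf T)}\pi|$ and $\|\mathbf R(t)\|_{L^2}=\big(\int_{\Sigma_t}|\mathbf R|^2\,dv_{g_t}\big)^{1/2}\in[0,\infty]$. For all $N_0,\mathcal K_0>0$ there is a constant $C=C(N_0,\mathcal K_0)>0$, depending on nothing else, such that, whenever in the above situation $$N_0^{-1}\le n\le N_0 \ \text{ on } \mathcal M_I \qquad\text{and}\qquad |I|\cdot\sup_{t\in I}\|\pi(t)\|_{L^\infty}\le\mathcal K_0$$ (with the convention $\infty\cdot 0=0\cdot\infty=0$), then $$\|\mathbf R(t)\|_{L^2}\le C\,\|\mathbf R(t_0)\|_{L^2}\qquad\text{for all } t_0,t\in I .$$ In particular, if the initial slice $\Sigma_{t_0}$ satisfies $\|\mathbf R(t_0)\|_{L^2}=\mathcal R_0<\infty$, then $\|\mathbf R(t)\|_{L^2}\le C\mathcal R_0$ for every $t\in I$. -/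

import Mathlib

open scoped Manifold ContDiff Matrix ENNReal Topology
open MeasureTheory

noncomputable section

namespace VacuumFoliation

/-- The model space of the leaves. -/
abbrev E3 : Type := EuclideanSpace ℝ (Fin 3)

/-- The range of spacetime coordinates `(t, x¹, x², x³)`. -/
abbrev Coord : Type := ℝ × E3

/-- Spacetime indices: one time index and three space indices. -/
abbrev Idx : Type := Unit ⊕ Fin 3

/-! ### Tensor calculus in spacetime coordinates -/

/-- The coordinate vectors of `ℝ × ℝ³`. -/
def coordBasis : Idx → Coord :=
  Sum.elim (fun _ => (1, 0)) (fun i => (0, EuclideanSpace.single i 1))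

/-- The partial derivative `∂_μ f`. -/
def pd (μ : Idx) (f : Coord → ℝ) (p : Coord) : ℝ := fderiv ℝ f p (coordBasis μ)

/-- Christoffel symbols of the Levi-Civita connection,
`Γ^l_{μν} = ½ G^{ls} (∂_μ G_{sν} + ∂_ν G_{sμ} - ∂_s G_{μν})`. -/
def christoffel (G : Coord → Matrix Idx Idx ℝ) (l μ ν : Idx) (p : Coord) : ℝ :=
  (1 / 2) * ∑ s, (G p)⁻¹ l s *
    (pd μ (fun q => G q s ν) p + pd ν (fun q => G q s μ) p - pd s (fun q => G q μ ν) p)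

/-- The curvature tensor
`R^r_{sμν} = ∂_μ Γ^r_{νs} - ∂_ν Γ^r_{μs} + Γ^r_{μl} Γ^l_{νs} - Γ^r_{νl} Γ^l_{μs}`. -/
def riemannUp (G : Coord → Matrix Idx Idx ℝ) (r s μ ν : Idx) (p : Coord) : ℝ :=
  pd μ (christoffel G r ν s) p - pd ν (christoffel G r μ s) p
    + ∑ l, (christoffel G r μ l p * christoffel G l ν s p
        - christoffel G r ν l p * christoffel G l μ s p)

/-- The curvature tensor with all indices lowered, `R_{rsμν} = G_{rl} R^l_{sμν}`. -/
def riemannDown (G : Coord → Matrix Idx Idx ℝ) (r s μ ν : Idx) (p : Coord) : ℝ :=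
  ∑ l, G p r l * riemannUp G l s μ ν p

/-- The Ricci tensor `R_{sν} = R^r_{srν}`. -/
def ricci (G : Coord → Matrix Idx Idx ℝ) (s ν : Idx) (p : Coord) : ℝ :=
  ∑ r, riemannUp G r s r ν p

/-- The Lie derivative `(L_X G)_{μν} = X^l ∂_l G_{μν} + G_{lν} ∂_μ X^l + G_{μl} ∂_ν X^l`. -/
def lieDeriv (X : Coord → Idx → ℝ) (G : Coord → Matrix Idx Idx ℝ) (μ ν : Idx) (p : Coord) : ℝ :=
  ∑ l, (X p l * pd l (fun q => G q μ ν) p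
    + G p l ν * pd μ (fun q => X q l) p + G p μ l * pd ν (fun q => X q l) p)

/-- The norm, relative to a positive definite matrix `h`, of a covariant `k`-tensor with
components `A`: `|A|² = h^{a₁b₁} ⋯ h^{a_k b_k} A_{a₁…a_k} A_{b₁…b_k}`. -/
def tensorNorm {k : ℕ} (h : Matrix Idx Idx ℝ) (A : (Fin k → Idx) → ℝ) : ℝ :=
  Real.sqrt (∑ a : Fin k → Idx, ∑ b : Fin k → Idx, (∏ i, h⁻¹ (a i) (b i)) * A a * A b)

/-! ### Symmetric two-tensors, volume and asymptotic flatness on a three-manifold -/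

section Leaf

variable {S : Type*} [TopologicalSpace S] [ChartedSpace E3 S]

/-- The coordinate vector field `∂_i` of the chart `c`, at the point with coordinates `y`. -/
def coordVec (c : OpenPartialHomeomorph S E3) (y : E3) (i : Fin 3) :
    TangentSpace 𝓘(ℝ, E3) (c.symm y) :=
  mfderiv 𝓘(ℝ, E3) 𝓘(ℝ, E3) c.symm y (EuclideanSpace.single i (1 : ℝ) : E3)

variable (S) in
/-- Fields of bilinear forms on the tangent spaces of `S`. -/
abbrev BilinField : Type _ :=
  ∀ x : S, TangentSpace 𝓘(ℝ, E3) x →L[ℝ] TangentSpace 𝓘(ℝ, E3) x →L[ℝ] ℝ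

/-- The components `g_{ij} = g(∂_i, ∂_j)` in the chart `c`, at the point with coordinates `y`. -/
def gram (g : BilinField S) (c : OpenPartialHomeomorph S E3) (y : E3) :
    Matrix (Fin 3) (Fin 3) ℝ :=
  Matrix.of fun i j => g (c.symm y) (coordVec c y i) (coordVec c y j)

/-- The volume measure `dv_g`. In a chart it is `√(det g_{ij}) dy`; these local measures agree on
overlaps, and their least upper bound is the measure they glue to. -/
def riemVolume [MeasurableSpace S] (g : BilinField S) : Measure S :=
  ⨆ c ∈ atlas E3 S, Measure.map c.symm
    ((volume.restrict c.target).withDensity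
      fun y => ENNReal.ofReal (Real.sqrt (gram g c y).det))

/-- `(S, g)` is asymptotically flat: outside a compact set it consists of finitely many ends, each
of which carries smooth coordinates ranging over the exterior of a ball in `ℝ³`, in which
`∂^m (g_{ij} - δ_{ij}) = O(|y|^{-τ-m})`, `m = 0, 1, 2`, for some `τ > 0`. The coordinates extend
inwards beyond the boundary `|y| = r` of the ends, so that `S` has no further (incomplete) end at
the inner boundary. -/
def IsAsymptoticallyFlat (g : BilinField S) : Prop :=
  ∃ (N : ℕ) (φ : Fin N → OpenPartialHomeomorph S E3) (r₀ r τ : ℝ),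
    0 < N ∧ 0 < r₀ ∧ r₀ < r ∧ 0 < τ ∧
    (∀ j, φ j ∈ IsManifold.maximalAtlas 𝓘(ℝ, E3) ∞ S) ∧
    (∀ j, (φ j).target = {y | r₀ < ‖y‖}) ∧
    (Pairwise fun j j' => Disjoint (φ j).source (φ j').source) ∧
    IsCompact (⋃ j, {x | x ∈ (φ j).source ∧ r < ‖φ j x‖})ᶜ ∧
    ∀ (j : Fin N) (i l : Fin 3) (m : ℕ), m ≤ 2 →
      (fun y => iteratedFDeriv ℝ m
          (fun z => gram g (φ j) z i l - (1 : Matrix (Fin 3) (Fin 3) ℝ) i l) y)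
        =O[Bornology.cobounded E3] fun y => ‖y‖ ^ (-τ - (m : ℝ))

end Leaf

/-! ### Foliated spacetimes -/

/-- A smooth spacetime region `I × S` foliated by the leaves `Σ_t = {t} × S`, `t ∈ I`, in
transported coordinates: the Lorentzian metric is `-n² dt² + g_t`, with lapse `n > 0` and
Riemannian metrics `g_t` on `S`. Lapse and metrics depend smoothly on `(t, x)`, up to those end
points of `I` that belong to `I`. -/
structure FoliatedSpacetime (S : Type*) [TopologicalSpace S] [ChartedSpace E3 S]
    (I : Set ℝ) where
  /-- The lapse function `n`. -/
  lapse : ℝ → S → ℝ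
  /-- The induced metrics `g_t`. -/
  metric : ℝ → BilinField S
  lapse_pos : ∀ t ∈ I, ∀ x, 0 < lapse t x
  metric_symm : ∀ t ∈ I, ∀ x v w, metric t x v w = metric t x w v
  metric_pos : ∀ t ∈ I, ∀ x v, v ≠ 0 → 0 < metric t x v v
  smooth : ∃ W : Set (ℝ × S), IsOpen W ∧ I ×ˢ Set.univ ⊆ W ∧
    ∀ c ∈ atlas E3 S,
      ContDiffOn ℝ ∞ (fun p : Coord => lapse p.1 (c.symm p.2))
        {p | p.2 ∈ c.target ∧ (p.1, c.symm p.2) ∈ W} ∧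
      ∀ i j, ContDiffOn ℝ ∞ (fun p : Coord => gram (metric p.1) c p.2 i j)
        {p | p.2 ∈ c.target ∧ (p.1, c.symm p.2) ∈ W}

namespace FoliatedSpacetime

variable {S : Type*} [TopologicalSpace S] [ChartedSpace E3 S] {I : Set ℝ}
  (M : FoliatedSpacetime S I)

/-- The lapse in the transported coordinates `(t, y)` given by the chart `c` of `S`. -/
def lapseIn (c : OpenPartialHomeomorph S E3) (p : Coord) : ℝ := M.lapse p.1 (c.symm p.2)

/-- The spacetime metric `-n² dt² + g_{ij} dxⁱ dxʲ` in transported coordinates. -/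
def spacetimeMetric (c : OpenPartialHomeomorph S E3) (p : Coord) : Matrix Idx Idx ℝ :=
  Matrix.fromBlocks (Matrix.of fun _ _ => -(M.lapseIn c p) ^ 2) 0 0 (gram (M.metric p.1) c p.2)

/-- The Riemannian metric `X⁰ Y⁰ + g(X̲, Y̲)`, where `X = X⁰ T + X̲` with `X̲` tangent to the
leaves; as `∂_t = n T`, it is `n² dt² + g_{ij} dxⁱ dxʲ` in transported coordinates. -/
def riemannianMetric (c : OpenPartialHomeomorph S E3) (p : Coord) : Matrix Idx Idx ℝ :=
  Matrix.fromBlocks (Matrix.of fun _ _ => (M.lapseIn c p) ^ 2) 0 0 (gram (M.metric p.1) c p.2)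

/-- The future unit normal `T = n⁻¹ ∂_t` of the leaves in transported coordinates. -/
def unitNormal (c : OpenPartialHomeomorph S E3) (p : Coord) : Idx → ℝ :=
  Sum.elim (fun _ => (M.lapseIn c p)⁻¹) 0

/-- The Einstein vacuum equations: the Ricci tensor of the spacetime metric vanishes on `I × S`. -/
def IsVacuum : Prop :=
  ∀ c ∈ atlas E3 S, ∀ t ∈ I, ∀ y ∈ c.target, ∀ μ ν : Idx, ricci (M.spacetimeMetric c) μ ν (t, y) = 0

/-- The pointwise norm `|R|` of the spacetime curvature tensor at `(t, x)`, relative to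
`riemannianMetric` (computed in the preferred chart at `x`; it does not depend on the chart). -/
def curvatureNorm (t : ℝ) (x : S) : ℝ :=
  tensorNorm (M.riemannianMetric (chartAt E3 x) (t, chartAt E3 x x))
    fun a : Fin 4 → Idx =>
      riemannDown (M.spacetimeMetric (chartAt E3 x)) (a 0) (a 1) (a 2) (a 3) (t, chartAt E3 x x)

/-- The pointwise norm `|π|` of the deformation tensor `π = L_T 𝐠` at `(t, x)`, relative to
`riemannianMetric` (computed in the preferred chart at `x`; it does not depend on the chart). -/
def deformationNorm (t : ℝ) (x : S) : ℝ :=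
  tensorNorm (M.riemannianMetric (chartAt E3 x) (t, chartAt E3 x x))
    fun a : Fin 2 → Idx =>
      lieDeriv (M.unitNormal (chartAt E3 x)) (M.spacetimeMetric (chartAt E3 x)) (a 0) (a 1)
        (t, chartAt E3 x x)

/-- `‖π(t)‖_{L^∞}`, the supremum of the continuous function `|π|` over `Σ_t`. -/
def deformationSup (t : ℝ) : ℝ≥0∞ := ⨆ x, ENNReal.ofReal (M.deformationNorm t x)

/-- `‖R(t)‖_{L²} = (∫_{Σ_t} |R|² dv_g)^{1/2}`, possibly infinite. -/
def curvatureL2 [MeasurableSpace S] (t : ℝ) : ℝ≥0∞ :=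
  (∫⁻ x, ENNReal.ofReal (M.curvatureNorm t x) ^ 2 ∂riemVolume (M.metric t)) ^ (1 / 2 : ℝ)

end FoliatedSpacetime

end VacuumFoliation

end

open scoped Manifold ContDiff Matrix ENNReal Topology
open MeasureTheory

set_option linter.unusedSectionVars false

noncomputable section

namespace VacuumFoliation

/-! ### Partial derivatives of functions and of matrix-valued functions -/

section Calculus

variable {f g : Coord → ℝ} {p : Coord} {U : Set Coord}

/-! The curvature of a vacuum metric is a family of Maxwell fields. For a fixed last pair of frame
indices `c, d` the two-form `R_{abcd}` is closed by the second Bianchi identity (moved to the first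
pair by pair symmetry) and divergence free by the contracted identity and `Ric = 0`. Both hold for
the covariant derivative, that is, up to terms in the connection coefficients of the frame. In an
orthonormal frame `E_0 = T, E_1, E_2, E_3`, add the Maxwell energies `(1/4) F_{ab}²` and Poynting
vectors `F_{0m} F_{im}` over all `c, d`, with Euclidean signs. The energy density is then exactly
`(1/4)|R|²`. The Euclidean sum over `c, d` is not Lorentz invariant but is invariant under
rotations, so the divergence of the current is quadratic in `R` with coefficients linear in the
boost part of the connection. That part consists of the second fundamental form and the acceleration
of `T`, both components of the deformation tensor. Hence the divergence is at most `9000 |π| |R|²`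
(`abs_div_le`, `IsFrame.abs_div_current_le`), with a purely numerical constant.

Integrating over a leaf gives a differential inequality for `∫ |R|²`, and Grönwall bounds its growth
by the exponential of `36000 N₀ ∫ ‖π‖`, which the hypotheses control by `N₀ K₀`. The estimate works
in both time directions.

On a noncompact leaf the integration must be localized, because the energy may be infinite. The
cutoff is `H(t,x) = η(2(φ(x) - θ(t)))`, with `φ` compactly supported. The flux through its level
sets is dominated by the energy density times `|dφ|`, so a profile `θ` moving at speed proportional
to `sup |dφ|` gives `∂_t H` the sign that absorbs it (`absorbs_movingCutoff`). If `|dφ|` is small,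
`θ` stays below `1/2` and the set where `φ = 1` is not lost (`energy_le_of_small_gradient`). On a
compact leaf `φ = 1` serves. On an asymptotically flat leaf `φ` cuts off at coordinate radius `R` in
the ends, so that `|dφ| = O(1/R)`. The metrics at other times are comparable because `∂_t g = n π`.
Letting `R → ∞` removes the cutoff by monotone convergence.

The integrals are computed in charts and glued by a partition of unity. The energy density and the
flux pairing do not depend on the chart, so the flux terms created by the partition functions add up
to zero. -/

lemma pd_congr (μ : Idx) (h : f =ᶠ[𝓝 p] g) : pd μ f p = pd μ g p := by
  simp only [pd, h.fderiv_eq]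

lemma pd_congr_on (μ : Idx) (hU : IsOpen U) (hp : p ∈ U) (h : ∀ q ∈ U, f q = g q) :
    pd μ f p = pd μ g p :=
  pd_congr μ (Filter.eventually_of_mem (hU.mem_nhds hp) h)

lemma pd_const (μ : Idx) (a : ℝ) : pd μ (fun _ => a) p = 0 := by
  simp [pd]

lemma pd_add (μ : Idx) (hf : DifferentiableAt ℝ f p) (hg : DifferentiableAt ℝ g p) :
    pd μ (fun q => f q + g q) p = pd μ f p + pd μ g p := by
  simp only [pd, fderiv_fun_add hf hg, add_apply]

lemma pd_sub (μ : Idx) (hf : DifferentiableAt ℝ f p) (hg : DifferentiableAt ℝ g p) :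
    pd μ (fun q => f q - g q) p = pd μ f p - pd μ g p := by
  simp only [pd, fderiv_fun_sub hf hg, sub_apply]

lemma pd_neg (μ : Idx) : pd μ (fun q => -f q) p = -pd μ f p := by
  simp only [pd, fderiv_fun_neg, neg_apply]

lemma pd_mul (μ : Idx) (hf : DifferentiableAt ℝ f p) (hg : DifferentiableAt ℝ g p) :
    pd μ (fun q => f q * g q) p = pd μ f p * g p + f p * pd μ g p := by
  simp only [pd, fderiv_fun_mul hf hg, add_apply, smul_apply, smul_eq_mul]
  ring

lemma pd_sum {ι : Type*} (s : Finset ι) {F : ι → Coord → ℝ} (μ : Idx)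
    (hF : ∀ i ∈ s, DifferentiableAt ℝ (F i) p) :
    pd μ (fun q => ∑ i ∈ s, F i q) p = ∑ i ∈ s, pd μ (F i) p := by
  simp only [pd, fderiv_fun_sum hF, sum_apply]

lemma pd_sum_mul {ι : Type*} [Fintype ι] {F H : ι → Coord → ℝ} (μ : Idx)
    (hF : ∀ i, DifferentiableAt ℝ (F i) p) (hH : ∀ i, DifferentiableAt ℝ (H i) p) :
    pd μ (fun q => ∑ i, F i q * H i q) p = ∑ i, (pd μ (F i) p * H i p + F i p * pd μ (H i) p) := by
  rw [pd_sum (F := fun i q => F i q * H i q) _ _ fun i _ => (hF i).mul (hH i)]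
  exact Finset.sum_congr rfl fun i _ => pd_mul μ (hF i) (hH i)

lemma smoothOn_diffAt (hU : IsOpen U) (hp : p ∈ U) (hf : ContDiffOn ℝ ∞ f U) :
    DifferentiableAt ℝ f p :=
  (hf.contDiffAt (hU.mem_nhds hp)).differentiableAt (by simp)

lemma smoothOn_pd (hU : IsOpen U) (hf : ContDiffOn ℝ ∞ f U) (μ : Idx) :
    ContDiffOn ℝ ∞ (pd μ f) U :=
  (hf.fderiv_of_isOpen hU (m := ∞) (by simp)).clm_apply contDiffOn_const

lemma pd_comm (hU : IsOpen U) (hp : p ∈ U) (hf : ContDiffOn ℝ ∞ f U) (μ ν : Idx) :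
    pd μ (pd ν f) p = pd ν (pd μ f) p := by
  have hc : ContDiffAt ℝ ∞ f p := hf.contDiffAt (hU.mem_nhds hp)
  have hd : DifferentiableAt ℝ (fderiv ℝ f) p :=
    (((hf.fderiv_of_isOpen hU (m := ∞) (by simp)).contDiffAt (hU.mem_nhds hp))).differentiableAt
      (by simp)
  have key : ∀ a b : Idx, pd a (pd b f) p
      = fderiv ℝ (fderiv ℝ f) p (coordBasis a) (coordBasis b) := by
    intro a b
    have : pd b f = fun q => fderiv ℝ f q (coordBasis b) := rfl
    rw [this, pd, fderiv_clm_apply hd (differentiableAt_const _)]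
    simp
  rw [key, key]
  exact (hc.isSymmSndFDerivAt (by
    rw [minSmoothness_of_isRCLikeNormedField]; exact WithTop.coe_le_coe.2 le_top)) _ _

/-- Smoothness of all entries of a matrix-valued function. -/
def SmoothMat (A : Coord → Matrix Idx Idx ℝ) (U : Set Coord) : Prop :=
  ∀ i j, ContDiffOn ℝ ∞ (fun q => A q i j) U

/-- The entrywise partial derivative of a matrix-valued function. -/
def pdM (μ : Idx) (A : Coord → Matrix Idx Idx ℝ) (p : Coord) : Matrix Idx Idx ℝ :=
  Matrix.of fun i j => pd μ (fun q => A q i j) p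

variable {A B : Coord → Matrix Idx Idx ℝ}

lemma pdM_apply (μ : Idx) (i j : Idx) : pdM μ A p i j = pd μ (fun q => A q i j) p := rfl

lemma SmoothMat.mul (hA : SmoothMat A U) (hB : SmoothMat B U) :
    SmoothMat (fun q => A q * B q) U := fun i j => by
  simp only [Matrix.mul_apply]
  exact ContDiffOn.sum fun k _ => (hA i k).mul (hB k j)

lemma SmoothMat.add (hA : SmoothMat A U) (hB : SmoothMat B U) :
    SmoothMat (fun q => A q + B q) U := fun i j => (hA i j).add (hB i j)

lemma SmoothMat.sub (hA : SmoothMat A U) (hB : SmoothMat B U) :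
    SmoothMat (fun q => A q - B q) U := fun i j => (hA i j).sub (hB i j)

lemma SmoothMat.transpose (hA : SmoothMat A U) : SmoothMat (fun q => (A q)ᵀ) U :=
  fun i j => hA j i

lemma SmoothMat.pdM (hU : IsOpen U) (hA : SmoothMat A U) (μ : Idx) : SmoothMat (pdM μ A) U :=
  fun i j => smoothOn_pd hU (hA i j) μ

lemma SmoothMat.congr (hA : SmoothMat A U) (h : ∀ q ∈ U, B q = A q) : SmoothMat B U :=
  fun i j => (hA i j).congr fun q hq => by simp only [h q hq]

lemma smoothOn_det {n : Type*} [Fintype n] [DecidableEq n] {A : Coord → Matrix n n ℝ}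
    (hA : ∀ i j, ContDiffOn ℝ ∞ (fun q => A q i j) U) :
    ContDiffOn ℝ ∞ (fun q => (A q).det) U := by
  simp only [Matrix.det_apply]
  refine ContDiffOn.sum fun σ _ => ContDiffOn.const_smul _ ?_
  exact contDiffOn_prod fun i _ => hA _ _

/-- By Cramer's rule each entry of the inverse is a quotient of determinants, that is, of
polynomials in the entries. -/
lemma smoothOn_inv {n : Type*} [Fintype n] [DecidableEq n] {A : Coord → Matrix n n ℝ}
    (hA : ∀ i j, ContDiffOn ℝ ∞ (fun q => A q i j) U) (hd : ∀ q ∈ U, (A q).det ≠ 0) (i j : n) :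
    ContDiffOn ℝ ∞ (fun q => (A q)⁻¹ i j) U := by
  have h : ∀ q ∈ U, (A q)⁻¹ i j
      = (A q).det⁻¹ * ((A q).updateRow j (Pi.single i 1)).det := by
    intro q _
    rw [Matrix.inv_def, Matrix.smul_apply, Ring.inverse_eq_inv', Matrix.adjugate_apply]
    rfl
  refine ContDiffOn.congr (((smoothOn_det hA).inv hd).mul (smoothOn_det fun a b => ?_)) h
  by_cases hb : a = j
  · subst hb
    simp only [Matrix.updateRow_self]
    exact contDiffOn_const
  · simp only [Matrix.updateRow_ne hb]
    exact hA a b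

lemma SmoothMat.inv (hA : SmoothMat A U) (hd : ∀ q ∈ U, (A q).det ≠ 0) :
    SmoothMat (fun q => (A q)⁻¹) U := fun i j => smoothOn_inv hA hd i j

lemma pdM_congr_on (μ : Idx) (hU : IsOpen U) (hp : p ∈ U) (h : ∀ q ∈ U, A q = B q) :
    pdM μ A p = pdM μ B p := by
  ext i j
  exact pd_congr_on μ hU hp fun q hq => by rw [h q hq]

lemma pdM_const (μ : Idx) (C : Matrix Idx Idx ℝ) : pdM μ (fun _ => C) p = 0 := by
  ext i j
  simp [pdM_apply, pd_const]

lemma pdM_transpose (μ : Idx) : pdM μ (fun q => (A q)ᵀ) p = (pdM μ A p)ᵀ := rfl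

lemma pdM_add (μ : Idx) (hU : IsOpen U) (hp : p ∈ U) (hA : SmoothMat A U) (hB : SmoothMat B U) :
    pdM μ (fun q => A q + B q) p = pdM μ A p + pdM μ B p := by
  ext i j
  exact pd_add μ (smoothOn_diffAt hU hp (hA i j)) (smoothOn_diffAt hU hp (hB i j))

lemma pdM_sub (μ : Idx) (hU : IsOpen U) (hp : p ∈ U) (hA : SmoothMat A U) (hB : SmoothMat B U) :
    pdM μ (fun q => A q - B q) p = pdM μ A p - pdM μ B p := by
  ext i j
  exact pd_sub μ (smoothOn_diffAt hU hp (hA i j)) (smoothOn_diffAt hU hp (hB i j))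

lemma pdM_mul (μ : Idx) (hU : IsOpen U) (hp : p ∈ U) (hA : SmoothMat A U) (hB : SmoothMat B U) :
    pdM μ (fun q => A q * B q) p = pdM μ A p * B p + A p * pdM μ B p := by
  ext i j
  simp only [pdM_apply, Matrix.mul_apply, Matrix.add_apply]
  rw [← Finset.sum_add_distrib]
  exact pd_sum_mul μ (fun k => smoothOn_diffAt hU hp (hA i k))
    (fun k => smoothOn_diffAt hU hp (hB k j))

lemma pdM_comm (hU : IsOpen U) (hp : p ∈ U) (hA : SmoothMat A U) (μ ν : Idx) :
    pdM μ (pdM ν A) p = pdM ν (pdM μ A) p := by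
  ext i j
  exact pd_comm hU hp (hA i j) μ ν

end Calculus

/-! ### Curvature of matrix-valued one-forms -/

section Gauge

variable {p : Coord} {U : Set Coord}

/-- The curvature `∂_μ A_ν - ∂_ν A_μ + [A_μ, A_ν]`. -/
def curv (A : Idx → Coord → Matrix Idx Idx ℝ) (μ ν : Idx) (p : Coord) : Matrix Idx Idx ℝ :=
  pdM μ (A ν) p - pdM ν (A μ) p + (A μ p * A ν p - A ν p * A μ p)

variable {A B : Idx → Coord → Matrix Idx Idx ℝ}

lemma smoothMat_curv (hU : IsOpen U) (hA : ∀ μ, SmoothMat (A μ) U) (μ ν : Idx) :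
    SmoothMat (curv A μ ν) U :=
  (((hA ν).pdM hU μ).sub ((hA μ).pdM hU ν)).add (((hA μ).mul (hA ν)).sub ((hA ν).mul (hA μ)))

lemma curv_antisymm (μ ν : Idx) : curv A ν μ p = -curv A μ ν p := by
  simp only [curv]
  abel

lemma pdM_curv (hU : IsOpen U) (hp : p ∈ U) (hA : ∀ μ, SmoothMat (A μ) U) (x μ ν : Idx) :
    pdM x (curv A μ ν) p = pdM x (pdM μ (A ν)) p - pdM x (pdM ν (A μ)) p
      + ((pdM x (A μ) p * A ν p + A μ p * pdM x (A ν) p)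
        - (pdM x (A ν) p * A μ p + A ν p * pdM x (A μ) p)) := by
  have h1 := (hA ν).pdM hU μ
  have h2 := (hA μ).pdM hU ν
  have h3 := (hA μ).mul (hA ν)
  have h4 := (hA ν).mul (hA μ)
  have e : curv A μ ν = fun q => (pdM μ (A ν) q - pdM ν (A μ) q)
      + (A μ q * A ν q - A ν q * A μ q) := rfl
  rw [e, pdM_add x hU hp (h1.sub h2) (h3.sub h4), pdM_sub x hU hp h1 h2, pdM_sub x hU hp h3 h4,
    pdM_mul x hU hp (hA μ) (hA ν), pdM_mul x hU hp (hA ν) (hA μ)]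

/-- The second Bianchi identity. -/
lemma bianchi (hU : IsOpen U) (hp : p ∈ U) (hA : ∀ μ, SmoothMat (A μ) U) (x μ ν : Idx) :
    (pdM x (curv A μ ν) p + A x p * curv A μ ν p - curv A μ ν p * A x p)
      + (pdM μ (curv A ν x) p + A μ p * curv A ν x p - curv A ν x p * A μ p)
      + (pdM ν (curv A x μ) p + A ν p * curv A x μ p - curv A x μ p * A ν p) = 0 := by
  -- Mixed second derivatives cancel in pairs by Schwarz's theorem. The quadratic terms cancel by
  -- the Leibniz rule and the cubic ones by the Jacobi identity for commutators.
  rw [pdM_curv hU hp hA, pdM_curv hU hp hA, pdM_curv hU hp hA,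
    pdM_comm hU hp (hA ν) x μ, pdM_comm hU hp (hA μ) x ν, pdM_comm hU hp (hA x) μ ν]
  simp only [curv]
  noncomm_ring

/-- The curvature is covariant under gauge transformations. -/
lemma curv_gauge (hU : IsOpen U) (hp : p ∈ U) (hA : ∀ μ, SmoothMat (A μ) U)
    (hB : ∀ μ, SmoothMat (B μ) U) {g : Coord → Matrix Idx Idx ℝ} (hg : SmoothMat g U)
    (h : ∀ q ∈ U, ∀ μ, g q * A μ q = B μ q * g q + pdM μ g q) (μ ν : Idx) :
    g p * curv A μ ν p = curv B μ ν p * g p := by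
  -- Differentiate the gauge relation once more. Antisymmetrizing in the two directions removes the
  -- second derivatives of `g`; its first derivatives are then eliminated by the relation itself, so
  -- invertibility of `g` is never needed.
  have key : ∀ a b : Idx, pdM a g p * A b p + g p * pdM a (A b) p
      = pdM a (B b) p * g p + B b p * pdM a g p + pdM a (pdM b g) p := by
    intro a b
    rw [← pdM_mul a hU hp hg (hA b), ← pdM_mul a hU hp (hB b) hg,
      ← pdM_add a hU hp ((hB b).mul hg) (hg.pdM hU b)]
    exact pdM_congr_on a hU hp fun q hq => h q hq b
  have h1 := key μ ν
  have h2 := key ν μ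
  rw [pdM_comm hU hp hg ν μ] at h2
  have e1 : ∀ a, pdM a g p = g p * A a p - B a p * g p := fun a => by
    rw [h p hp a]; abel
  rw [e1 μ] at h1
  rw [e1 ν] at h2
  have h3 : g p * pdM μ (A ν) p - g p * pdM ν (A μ) p
      = (pdM μ (B ν) p * g p + B ν p * (g p * A μ p - B μ p * g p))
        - (g p * A μ p - B μ p * g p) * A ν p
        - ((pdM ν (B μ) p * g p + B μ p * (g p * A ν p - B ν p * g p))
        - (g p * A ν p - B ν p * g p) * A μ p) := by
    have := congrArg₂ (· - ·) h1 h2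
    have h4 : ∀ a b c d e f g' : Matrix Idx Idx ℝ, a + b - (c + d) = e + g' - (f + g') →
        b - d = e - a - (f - c) := by
      intro a b c d e f g' hh
      have : b - d = (a + b - (c + d)) - a + c := by abel
      rw [this, hh]; abel
    exact h4 _ _ _ _ _ _ _ this
  have h5 : g p * curv A μ ν p = (g p * pdM μ (A ν) p - g p * pdM ν (A μ) p)
      + g p * (A μ p * A ν p - A ν p * A μ p) := by
    simp only [curv]; noncomm_ring
  rw [h5, h3]
  simp only [curv]
  noncomm_ring

end Gauge

/-! ### The Levi-Civita connection -/

section LeviCivita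

variable {p : Coord} {U : Set Coord} {G : Coord → Matrix Idx Idx ℝ}

/-- The connection matrices `(A_μ)^r_s = Γ^r_{μ s}`. -/
def conn (G : Coord → Matrix Idx Idx ℝ) (μ : Idx) (p : Coord) : Matrix Idx Idx ℝ :=
  Matrix.of fun r s => christoffel G r μ s p

lemma conn_apply (μ r s : Idx) : conn G μ p r s = christoffel G r μ s p := rfl

lemma riemannUp_eq (r s μ ν : Idx) : riemannUp G r s μ ν p = curv (conn G) μ ν p r s := by
  simp only [riemannUp, curv, Matrix.add_apply, Matrix.sub_apply, Matrix.mul_apply, pdM_apply,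
    conn_apply, Finset.sum_sub_distrib]

lemma riemannDown_eq (r s μ ν : Idx) :
    riemannDown G r s μ ν p = (G p * curv (conn G) μ ν p) r s := by
  simp only [riemannDown, riemannUp_eq, Matrix.mul_apply]

lemma smoothMat_conn (hU : IsOpen U) (hG : SmoothMat G U) (hd : ∀ q ∈ U, (G q).det ≠ 0) (μ : Idx) :
    SmoothMat (conn G μ) U := by
  intro r s
  simp only [conn_apply, christoffel]
  refine contDiffOn_const.mul (ContDiffOn.sum fun k _ => (smoothOn_inv hG hd r k).mul ?_)
  exact ((smoothOn_pd hU (hG k s) μ).add (smoothOn_pd hU (hG k μ) s)).sub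
    (smoothOn_pd hU (hG μ s) k)

lemma pd_metric_symm (hU : IsOpen U) (hp : p ∈ U) (hs : ∀ q ∈ U, (G q)ᵀ = G q) (μ a b : Idx) :
    pd μ (fun q => G q a b) p = pd μ (fun q => G q b a) p :=
  pd_congr_on μ hU hp fun q hq => by conv_lhs => rw [← hs q hq, Matrix.transpose_apply]

lemma christoffel_symm (hU : IsOpen U) (hp : p ∈ U) (hs : ∀ q ∈ U, (G q)ᵀ = G q) (l μ ν : Idx) :
    christoffel G l μ ν p = christoffel G l ν μ p := by
  simp only [christoffel]
  congr 1
  refine Finset.sum_congr rfl fun s _ => ?_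
  rw [pd_metric_symm hU hp hs s μ ν]
  ring

/-- Lowering the upper index cancels the inverse metric and leaves the Christoffel symbols of the
first kind, which are linear in the derivatives of the metric. -/
lemma metric_mul_conn (hd : (G p).det ≠ 0) (s μ ν : Idx) :
    (G p * conn G μ p) s ν = (1 / 2) * (pd μ (fun q => G q s ν) p + pd ν (fun q => G q s μ) p
      - pd s (fun q => G q μ ν) p) := by
  have h : conn G μ p = (1 / 2 : ℝ) • ((G p)⁻¹ * Matrix.of fun k n =>
      (pd μ (fun q => G q k n) p + pd n (fun q => G q k μ) p - pd k (fun q => G q μ n) p)) := by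
    ext r n
    simp [conn_apply, christoffel, Matrix.mul_apply]
  rw [h, Matrix.mul_smul, ← Matrix.mul_assoc, Matrix.mul_nonsing_inv _ (isUnit_iff_ne_zero.2 hd),
    Matrix.one_mul, Matrix.smul_apply, Matrix.of_apply, smul_eq_mul]

/-- Compatibility of the Levi-Civita connection with the metric. -/
lemma metric_compat (hU : IsOpen U) (hp : p ∈ U) (hs : ∀ q ∈ U, (G q)ᵀ = G q)
    (hd : (G p).det ≠ 0) (μ : Idx) :
    pdM μ G p = (conn G μ p)ᵀ * G p + G p * conn G μ p := by
  have h : (conn G μ p)ᵀ * G p = (G p * conn G μ p)ᵀ := by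
    rw [Matrix.transpose_mul, hs p hp]
  rw [h]
  ext a b
  rw [Matrix.add_apply, Matrix.transpose_apply, metric_mul_conn hd, metric_mul_conn hd, pdM_apply,
    pd_metric_symm hU hp hs μ b a, pd_metric_symm hU hp hs b μ a, pd_metric_symm hU hp hs a μ b]
  ring

/-- Uniqueness of the Levi-Civita connection. -/
lemma conn_unique (hs : (G p)ᵀ = G p) (hd : (G p).det ≠ 0)
    {C : Idx → Matrix Idx Idx ℝ} (hC : ∀ l μ ν, C μ l ν = C ν l μ)
    (hm : ∀ μ, pdM μ G p = (C μ)ᵀ * G p + G p * C μ) (μ : Idx) : conn G μ p = C μ := by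
  have hsG : ∀ a b, G p a b = G p b a := fun a b => by
    conv_lhs => rw [← hs, Matrix.transpose_apply]
  have key : G p * conn G μ p = G p * C μ := by
    ext s ν
    -- Koszul's argument: insert compatibility in the three derivatives of the metric; by the
    -- symmetry of `C` all but two equal terms cancel.
    rw [metric_mul_conn hd, ← pdM_apply, ← pdM_apply, ← pdM_apply, hm, hm, hm]
    simp only [Matrix.add_apply, Matrix.mul_apply, Matrix.transpose_apply]
    have h1 : ∑ x, C μ x s * G p x ν = ∑ x, C s x μ * G p x ν :=
      Finset.sum_congr rfl fun x _ => by rw [hC]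
    have h2 : ∑ x, C ν x s * G p x μ = ∑ x, G p μ x * C s x ν :=
      Finset.sum_congr rfl fun x _ => by rw [hC, hsG]; ring
    have h3 : ∑ x, G p s x * C ν x μ = ∑ x, G p s x * C μ x ν :=
      Finset.sum_congr rfl fun x _ => by rw [hC]
    rw [h1, h2, h3]
    ring
  have := congrArg (fun M => (G p)⁻¹ * M) key
  simpa [← Matrix.mul_assoc, Matrix.nonsing_inv_mul _ (isUnit_iff_ne_zero.2 hd)] using this

/-- The first Bianchi identity. -/
lemma first_bianchi (hU : IsOpen U) (hp : p ∈ U) (hs : ∀ q ∈ U, (G q)ᵀ = G q) (r s μ ν : Idx) :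
    curv (conn G) μ ν p r s + curv (conn G) ν s p r μ + curv (conn G) s μ p r ν = 0 := by
  have h : ∀ q ∈ U, ∀ l a b, christoffel G l a b q = christoffel G l b a q :=
    fun q hq l a b => christoffel_symm hU hq hs l a b
  have hpd : ∀ x l a b, pd x (christoffel G l a b) p = pd x (christoffel G l b a) p :=
    fun x l a b => pd_congr_on x hU hp fun q hq => h q hq l a b
  rw [← riemannUp_eq, ← riemannUp_eq, ← riemannUp_eq]
  simp only [riemannUp, Finset.sum_sub_distrib]
  rw [hpd μ r s ν, hpd ν r s μ, hpd s r ν μ]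
  have e : ∀ a b c, ∑ l, christoffel G r a l p * christoffel G l b c p
      = ∑ l, christoffel G r a l p * christoffel G l c b p :=
    fun a b c => Finset.sum_congr rfl fun l _ => by rw [h p hp l b c]
  rw [e μ s ν, e ν s μ, e s ν μ]
  ring

/-- The curvature of a metric connection takes values in the skew-adjoint matrices. -/
lemma riemann_antisymm (hU : IsOpen U) (hp : p ∈ U) (hG : SmoothMat G U)
    (hs : ∀ q ∈ U, (G q)ᵀ = G q) (hd : ∀ q ∈ U, (G q).det ≠ 0) (μ ν : Idx) :
    (G p * curv (conn G) μ ν p)ᵀ = -(G p * curv (conn G) μ ν p) := by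
  have hA := smoothMat_conn hU hG hd
  -- Metric compatibility expresses the second derivatives of `G` through the connection. Their
  -- commutator vanishes, and it is the symmetric part of the lowered curvature.
  have key : ∀ a b, pdM a (pdM b G) p
      = (pdM a (conn G b) p)ᵀ * G p + (conn G b p)ᵀ * pdM a G p
        + (pdM a G p * conn G b p + G p * pdM a (conn G b) p) := by
    intro a b
    rw [pdM_congr_on a hU hp fun q hq => metric_compat hU hq hs (hd q hq) b,
      pdM_add a hU hp ((hA b).transpose.mul hG) (hG.mul (hA b)),
      pdM_mul a hU hp (hA b).transpose hG, pdM_mul a hU hp hG (hA b), pdM_transpose]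
  have h1 := key μ ν
  have h2 := key ν μ
  rw [pdM_comm hU hp hG ν μ, h1] at h2
  rw [metric_compat hU hp hs (hd p hp) μ, metric_compat hU hp hs (hd p hp) ν] at h2
  have h3 := sub_eq_zero.2 h2
  rw [Matrix.transpose_mul, hs p hp]
  simp only [curv, Matrix.transpose_add, Matrix.transpose_sub, Matrix.transpose_mul]
  rw [eq_neg_iff_add_eq_zero, ← h3]
  noncomm_ring

/-- The pair symmetry of the curvature tensor. -/
lemma riemann_pair_symm (hU : IsOpen U) (hp : p ∈ U) (hG : SmoothMat G U)
    (hs : ∀ q ∈ U, (G q)ᵀ = G q) (hd : ∀ q ∈ U, (G q).det ≠ 0) (a b c d : Idx) :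
    riemannDown G a b c d p = riemannDown G c d a b p := by
  have h1 : ∀ a b c d, riemannDown G a b c d p = -riemannDown G b a c d p := by
    intro a b c d
    have := congrFun (congrFun (riemann_antisymm hU hp hG hs hd c d) b) a
    rw [riemannDown_eq, riemannDown_eq]
    simpa using this
  have h2 : ∀ a b c d, riemannDown G a b c d p = -riemannDown G a b d c p := by
    intro a b c d
    rw [riemannDown_eq, riemannDown_eq, curv_antisymm]
    simp
  have h3 : ∀ a b c d, riemannDown G a b c d p + riemannDown G a c d b p
      + riemannDown G a d b c p = 0 := by
    intro a b c d
    simp only [riemannDown_eq, Matrix.mul_apply, ← Finset.sum_add_distrib, ← mul_add]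
    exact Finset.sum_eq_zero fun l _ => by rw [first_bianchi hU hp hs l b c d, mul_zero]
  -- The octahedron argument: four instances of the first Bianchi identity, combined with skewness
  -- in each pair.
  linarith [h3 a b c d, h3 b c d a, h3 c d a b, h3 d a b c, h1 a b c d, h1 a b d c, h1 a c b d,
    h1 a c d b, h1 a d b c, h1 a d c b, h1 b c a d, h1 b c d a, h1 b d a c, h1 b d c a,
    h1 c d a b, h1 c d b a, h2 a b c d, h2 b a c d, h2 a c b d, h2 c a b d, h2 a d b c, h2 d a b c,
    h2 b c a d, h2 c b a d, h2 b d a c, h2 d b a c, h2 c d a b, h2 d c a b]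

end LeviCivita

/-! ### Changes of coordinates -/

section Pullback

/-- The coordinates of a point of `ℝ × ℝ³`. -/
def coords (v : Coord) : Idx → ℝ := Sum.elim (fun _ => v.1) (fun i => v.2 i)

lemma sum_coords (v : Coord) : ∑ α, coords v α • coordBasis α = v := by
  ext i
  · simp [Fintype.sum_sum_type, coords, coordBasis, Prod.fst_sum]
  · simp [Fintype.sum_sum_type, coords, coordBasis, Prod.snd_sum, Pi.single_apply]

/-- The Jacobian matrix of a map between coordinate spaces. -/
def jac (Ψ : Coord → Coord) (q : Coord) : Matrix Idx Idx ℝ :=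
  Matrix.of fun α a => pd a (fun z => coords (Ψ z) α) q

lemma jac_apply {Ψ : Coord → Coord} {q : Coord} (α a : Idx) :
    jac Ψ q α a = pd a (fun z => coords (Ψ z) α) q := rfl

variable {Ψ : Coord → Coord} {U V : Set Coord} {q : Coord}

lemma contDiff_coords (α : Idx) : ContDiff ℝ ∞ fun v : Coord => coords v α := by
  rcases α with _ | i
  · exact contDiff_fst
  · simp only [coords, Sum.elim_inr]
    fun_prop

lemma jac_eq (hΨ : DifferentiableAt ℝ Ψ q) (α a : Idx) :
    jac Ψ q α a = coords (fderiv ℝ Ψ q (coordBasis a)) α := by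
  rcases α with _ | i
  · have : HasFDerivAt (fun z => (Ψ z).1) ((ContinuousLinearMap.fst ℝ ℝ E3).comp (fderiv ℝ Ψ q)) q :=
      hΨ.hasFDerivAt.fst
    simp [jac_apply, pd, coords, this.fderiv]
  · have : HasFDerivAt (fun z => (Ψ z).2 i) ((EuclideanSpace.proj i : E3 →L[ℝ] ℝ).comp
        ((ContinuousLinearMap.snd ℝ ℝ E3).comp (fderiv ℝ Ψ q))) q :=
      (EuclideanSpace.proj i : E3 →L[ℝ] ℝ).hasFDerivAt.comp q hΨ.hasFDerivAt.snd
    simp [jac_apply, pd, coords, this.fderiv]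

lemma pd_comp {f : Coord → ℝ} (hf : DifferentiableAt ℝ f (Ψ q)) (hΨ : DifferentiableAt ℝ Ψ q)
    (a : Idx) : pd a (fun z => f (Ψ z)) q = ∑ α, jac Ψ q α a * pd α f (Ψ q) := by
  have : pd a (fun z => f (Ψ z)) q = fderiv ℝ f (Ψ q) (fderiv ℝ Ψ q (coordBasis a)) := by
    rw [pd, show (fun z => f (Ψ z)) = f ∘ Ψ from rfl, fderiv_comp q hf hΨ]
    rfl
  rw [this, ← sum_coords (fderiv ℝ Ψ q (coordBasis a)), map_sum]
  refine Finset.sum_congr rfl fun α _ => ?_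
  rw [map_smul, jac_eq hΨ, smul_eq_mul, pd]

lemma smoothMat_jac (hU : IsOpen U) (hΨ : ContDiffOn ℝ ∞ Ψ U) : SmoothMat (jac Ψ) U :=
  fun α a => smoothOn_pd hU ((contDiff_coords α).comp_contDiffOn hΨ) a

lemma pd_jac_symm (hU : IsOpen U) (hq : q ∈ U) (hΨ : ContDiffOn ℝ ∞ Ψ U) (α a b : Idx) :
    pd a (fun z => jac Ψ z α b) q = pd b (fun z => jac Ψ z α a) q :=
  pd_comm hU hq ((contDiff_coords α).comp_contDiffOn hΨ) a b

/-- The pullback of a matrix-valued one-form. -/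
def pull (Ψ : Coord → Coord) (A : Idx → Coord → Matrix Idx Idx ℝ) (a : Idx) (q : Coord) :
    Matrix Idx Idx ℝ :=
  ∑ α, jac Ψ q α a • A α (Ψ q)

variable {A : Idx → Coord → Matrix Idx Idx ℝ}

lemma pull_apply (a i j : Idx) :
    pull Ψ A a q i j = ∑ α, jac Ψ q α a * A α (Ψ q) i j := by
  simp [pull, Matrix.sum_apply]

lemma smoothMat_comp {A : Coord → Matrix Idx Idx ℝ} (hΨ : ContDiffOn ℝ ∞ Ψ U)
    (hUV : Set.MapsTo Ψ U V) (hA : SmoothMat A V) : SmoothMat (fun q => A (Ψ q)) U :=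
  fun i j => (hA i j).comp hΨ hUV

lemma smoothMat_pull (hU : IsOpen U) (hΨ : ContDiffOn ℝ ∞ Ψ U) (hUV : Set.MapsTo Ψ U V)
    (hA : ∀ μ, SmoothMat (A μ) V) (a : Idx) : SmoothMat (pull Ψ A a) U := by
  intro i j
  simp only [pull_apply]
  exact ContDiffOn.sum fun α _ =>
    (smoothMat_jac hU hΨ α a).mul ((hA α i j).comp hΨ hUV)

/-- Isolates the Hessian of `Ψ`, which is symmetric in `a` and `b` and therefore drops out of the
curvature. -/
lemma pdM_pull (hU : IsOpen U) (hV : IsOpen V) (hΨ : ContDiffOn ℝ ∞ Ψ U) (hUV : Set.MapsTo Ψ U V)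
    (hA : ∀ μ, SmoothMat (A μ) V) (hq : q ∈ U) (a b : Idx) :
    pdM a (pull Ψ A b) q = ∑ α, pd a (fun z => jac Ψ z α b) q • A α (Ψ q)
      + ∑ α, ∑ β, (jac Ψ q β a * jac Ψ q α b) • pdM β (A α) (Ψ q) := by
  have hΨd : DifferentiableAt ℝ Ψ q := (hΨ.contDiffAt (hU.mem_nhds hq)).differentiableAt (by simp)
  ext i j
  simp only [pdM_apply, pull_apply, Matrix.add_apply, Matrix.sum_apply, Matrix.smul_apply,
    smul_eq_mul]
  have hd : ∀ α, DifferentiableAt ℝ (fun z => A α (Ψ z) i j) q := fun α =>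
    smoothOn_diffAt hU hq ((hA α i j).comp hΨ hUV)
  rw [pd_sum_mul a (fun α => smoothOn_diffAt hU hq (smoothMat_jac hU hΨ α b)) hd,
    ← Finset.sum_add_distrib]
  refine Finset.sum_congr rfl fun α _ => ?_
  congr 1
  rw [pd_comp (f := fun z => A α z i j) (smoothOn_diffAt hV (hUV hq) (hA α i j)) hΨd,
    Finset.mul_sum]
  exact Finset.sum_congr rfl fun β _ => by ring

/-- The curvature of a pullback is the pullback of the curvature. -/
lemma curv_pull (hU : IsOpen U) (hV : IsOpen V) (hΨ : ContDiffOn ℝ ∞ Ψ U)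
    (hUV : Set.MapsTo Ψ U V) (hA : ∀ μ, SmoothMat (A μ) V) (hq : q ∈ U) (a b : Idx) :
    curv (pull Ψ A) a b q
      = ∑ α, ∑ β, (jac Ψ q α a * jac Ψ q β b) • curv A α β (Ψ q) := by
  have h1 : ∑ α, pd a (fun z => jac Ψ z α b) q • A α (Ψ q)
      = ∑ α, pd b (fun z => jac Ψ z α a) q • A α (Ψ q) :=
    Finset.sum_congr rfl fun α _ => by rw [pd_jac_symm hU hq hΨ]
  have h2 : ∑ α, ∑ β, (jac Ψ q β a * jac Ψ q α b) • pdM β (A α) (Ψ q)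
      = ∑ α, ∑ β, (jac Ψ q α a * jac Ψ q β b) • pdM α (A β) (Ψ q) := Finset.sum_comm
  have h3 : ∑ α, ∑ β, (jac Ψ q β b * jac Ψ q α a) • pdM β (A α) (Ψ q)
      = ∑ α, ∑ β, (jac Ψ q α a * jac Ψ q β b) • pdM β (A α) (Ψ q) :=
    Finset.sum_congr rfl fun α _ => Finset.sum_congr rfl fun β _ => by rw [mul_comm]
  have h4 : pull Ψ A a q * pull Ψ A b q
      = ∑ α, ∑ β, (jac Ψ q α a * jac Ψ q β b) • (A α (Ψ q) * A β (Ψ q)) := by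
    simp only [pull, Finset.sum_mul, Finset.mul_sum, smul_mul_smul_comm]
    exact Finset.sum_comm
  have h5 : pull Ψ A b q * pull Ψ A a q
      = ∑ α, ∑ β, (jac Ψ q α a * jac Ψ q β b) • (A β (Ψ q) * A α (Ψ q)) := by
    simp only [pull, Finset.sum_mul, Finset.mul_sum, smul_mul_smul_comm]
    exact Finset.sum_congr rfl fun α _ => Finset.sum_congr rfl fun β _ => by rw [mul_comm]
  rw [curv, pdM_pull hU hV hΨ hUV hA hq, pdM_pull hU hV hΨ hUV hA hq, h1, h2, h3, h4, h5]
  simp only [curv, smul_add, smul_sub, Finset.sum_add_distrib, Finset.sum_sub_distrib]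
  abel

variable {G G' : Coord → Matrix Idx Idx ℝ}

/-- The transformation law of the Christoffel symbols. -/
lemma conn_pull (hU : IsOpen U) (hV : IsOpen V) (hΨ : ContDiffOn ℝ ∞ Ψ U)
    (hUV : Set.MapsTo Ψ U V) (hG : SmoothMat G V) (hs : ∀ p ∈ V, (G p)ᵀ = G p)
    (hd : ∀ p ∈ V, (G p).det ≠ 0) (hJ : ∀ z ∈ U, (jac Ψ z).det ≠ 0)
    (hG' : ∀ z ∈ U, G' z = (jac Ψ z)ᵀ * G (Ψ z) * jac Ψ z) (hq : q ∈ U) (a : Idx) :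
    jac Ψ q * conn G' a q = pull Ψ (conn G) a q * jac Ψ q + pdM a (jac Ψ) q := by
  have hΨd : DifferentiableAt ℝ Ψ q := (hΨ.contDiffAt (hU.mem_nhds hq)).differentiableAt (by simp)
  set J := jac Ψ q with hJdef
  have hJu : IsUnit J.det := isUnit_iff_ne_zero.2 (hJ q hq)
  -- The transformation law, solved for the connection, defines the candidate. It is torsion free
  -- and compatible with `G'`, so uniqueness identifies it.
  let C : Idx → Matrix Idx Idx ℝ := fun a => J⁻¹ * (pull Ψ (conn G) a q * J + pdM a (jac Ψ) q)
  have hJC : ∀ a, J * C a = pull Ψ (conn G) a q * J + pdM a (jac Ψ) q := fun a => by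
    simp only [C]
    rw [← Matrix.mul_assoc, Matrix.mul_nonsing_inv _ hJu, Matrix.one_mul]
  have hsJ := smoothMat_jac hU hΨ
  have hGΨ := smoothMat_comp hΨ hUV hG
  suffices h : conn G' a q = C a by rw [h, hJC]
  refine conn_unique ?_ ?_ ?_ ?_ a
  · rw [hG' q hq]
    simp [Matrix.transpose_mul, hs _ (hUV hq), Matrix.mul_assoc]
  · rw [hG' q hq]
    simp [hJ q hq, hd _ (hUV hq)]
  · have hsym : ∀ α b c, (pull Ψ (conn G) b q * J + pdM b (jac Ψ) q) α c
        = (pull Ψ (conn G) c q * J + pdM c (jac Ψ) q) α b := by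
      intro α b c
      simp only [Matrix.add_apply, Matrix.mul_apply, pull_apply, pdM_apply]
      rw [pd_jac_symm hU hq hΨ]
      congr 1
      simp only [Finset.sum_mul]
      rw [Finset.sum_comm]
      refine Finset.sum_congr rfl fun x _ => Finset.sum_congr rfl fun y _ => ?_
      rw [conn_apply, conn_apply, christoffel_symm hV (hUV hq) hs]
      ring
    intro l μ ν
    change ∑ x, J⁻¹ l x * (pull Ψ (conn G) μ q * J + pdM μ (jac Ψ) q) x ν
      = ∑ x, J⁻¹ l x * (pull Ψ (conn G) ν q * J + pdM ν (jac Ψ) q) x μ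
    exact Finset.sum_congr rfl fun x _ => by rw [hsym]
  · intro b
    have hpull : pdM b (fun z => G (Ψ z)) q
        = (pull Ψ (conn G) b q)ᵀ * G (Ψ q) + G (Ψ q) * pull Ψ (conn G) b q := by
      have : pdM b (fun z => G (Ψ z)) q = ∑ β, J β b • pdM β G (Ψ q) := by
        ext i j
        simp only [pdM_apply, Matrix.sum_apply, Matrix.smul_apply, smul_eq_mul]
        exact pd_comp (f := fun z => G z i j) (smoothOn_diffAt hV (hUV hq) (hG i j)) hΨd b
      rw [this]
      simp only [pull, Matrix.transpose_sum, Matrix.transpose_smul, Finset.sum_mul, Finset.mul_sum,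
        smul_mul_assoc, mul_smul_comm, ← Finset.sum_add_distrib, ← smul_add]
      exact Finset.sum_congr rfl fun β _ => by
        rw [metric_compat hV (hUV hq) hs (hd _ (hUV hq))]
    rw [pdM_congr_on b hU hq hG', pdM_mul b hU hq (hsJ.transpose.mul hGΨ) hsJ,
      pdM_mul b hU hq hsJ.transpose hGΨ, hpull, hG' q hq, pdM_transpose]
    have e1 : (C b)ᵀ * (Jᵀ * G (Ψ q) * J) = (J * C b)ᵀ * G (Ψ q) * J := by
      rw [Matrix.transpose_mul J]; simp only [Matrix.mul_assoc]
    have e2 : Jᵀ * G (Ψ q) * J * C b = Jᵀ * G (Ψ q) * (J * C b) := by simp only [Matrix.mul_assoc]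
    rw [← hJdef, e1, e2, hJC, Matrix.transpose_add, Matrix.transpose_mul]
    noncomm_ring

lemma sum_comm_pairs {ι : Type*} [Fintype ι] (f : ι → ι → ι → ι → ℝ) :
    ∑ a, ∑ b, ∑ c, ∑ d, f a b c d = ∑ c, ∑ d, ∑ a, ∑ b, f a b c d := by
  calc ∑ a, ∑ b, ∑ c, ∑ d, f a b c d = ∑ a, ∑ c, ∑ b, ∑ d, f a b c d :=
        Finset.sum_congr rfl fun a _ => Finset.sum_comm
    _ = ∑ c, ∑ a, ∑ b, ∑ d, f a b c d := Finset.sum_comm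
    _ = ∑ c, ∑ a, ∑ d, ∑ b, f a b c d :=
        Finset.sum_congr rfl fun c _ => Finset.sum_congr rfl fun a _ => Finset.sum_comm
    _ = ∑ c, ∑ d, ∑ a, ∑ b, f a b c d := Finset.sum_congr rfl fun c _ => Finset.sum_comm

/-- The transformation law of the curvature tensor. -/
lemma riemannDown_pull (hU : IsOpen U) (hV : IsOpen V) (hΨ : ContDiffOn ℝ ∞ Ψ U)
    (hUV : Set.MapsTo Ψ U V) (hG : SmoothMat G V) (hs : ∀ p ∈ V, (G p)ᵀ = G p)
    (hd : ∀ p ∈ V, (G p).det ≠ 0) (hJ : ∀ z ∈ U, (jac Ψ z).det ≠ 0)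
    (hG' : ∀ z ∈ U, G' z = (jac Ψ z)ᵀ * G (Ψ z) * jac Ψ z) (hq : q ∈ U) (r s a b : Idx) :
    riemannDown G' r s a b q = ∑ ρ, ∑ σ, ∑ α, ∑ β, jac Ψ q ρ r * jac Ψ q σ s * jac Ψ q α a
      * jac Ψ q β b * riemannDown G ρ σ α β (Ψ q) := by
  have hsJ := smoothMat_jac hU hΨ
  have hGs' : SmoothMat G' U :=
    ((hsJ.transpose.mul (smoothMat_comp hΨ hUV hG)).mul hsJ).congr hG'
  have hd' : ∀ z ∈ U, (G' z).det ≠ 0 := fun z hz => by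
    rw [hG' z hz]; simp [hJ z hz, hd _ (hUV hz)]
  -- The transformation law of the connection says that the Jacobian matrix is a gauge
  -- transformation between the connection of `G'` and the pulled back one.
  have hg := curv_gauge hU hq (smoothMat_conn hU hGs' hd')
    (smoothMat_pull hU hΨ hUV (smoothMat_conn hV hG hd)) hsJ
    (fun z hz c => conn_pull hU hV hΨ hUV hG hs hd hJ hG' hz c) a b
  rw [curv_pull hU hV hΨ hUV (smoothMat_conn hV hG hd) hq] at hg
  rw [riemannDown_eq, hG' q hq, Matrix.mul_assoc, hg]
  simp only [Finset.sum_mul, Finset.mul_sum, Matrix.sum_apply, smul_mul_assoc, mul_smul_comm,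
    Matrix.smul_apply, smul_eq_mul]
  have e : ∀ α β, ((jac Ψ q)ᵀ * G (Ψ q) * (curv (conn G) α β (Ψ q) * jac Ψ q)) r s
      = ∑ ρ, ∑ σ, jac Ψ q ρ r * jac Ψ q σ s * riemannDown G ρ σ α β (Ψ q) := by
    intro α β
    rw [show (jac Ψ q)ᵀ * G (Ψ q) * (curv (conn G) α β (Ψ q) * jac Ψ q)
      = (jac Ψ q)ᵀ * ((G (Ψ q) * curv (conn G) α β (Ψ q)) * jac Ψ q) by noncomm_ring]
    rw [Matrix.mul_apply]
    refine Finset.sum_congr rfl fun ρ _ => ?_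
    rw [Matrix.mul_apply, Finset.mul_sum]
    refine Finset.sum_congr rfl fun σ _ => ?_
    rw [riemannDown_eq, Matrix.transpose_apply]
    ring
  simp only [e, Finset.mul_sum]
  rw [sum_comm_pairs]
  refine Finset.sum_congr rfl fun ρ _ => Finset.sum_congr rfl fun σ _ => Finset.sum_congr rfl
    fun α _ => Finset.sum_congr rfl fun β _ => ?_
  ring

end Pullback

/-! ### Pointwise algebra of the energy identity in an orthonormal frame -/

section FrameAlgebra

/-- The components of the Minkowski metric. -/
def minkowski : Idx → ℝ := Sum.elim (fun _ => -1) (fun _ => 1)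

/-- The time index. -/
abbrev tIdx : Idx := Sum.inl ()

lemma minkowski_sq (a : Idx) : minkowski a * minkowski a = 1 := by
  rcases a with _ | i <;> simp [minkowski]

/-- The action of a matrix on a four-tensor. -/
def act (w : Idx → Idx → ℝ) (r : Idx → Idx → Idx → Idx → ℝ) (a b c d : Idx) : ℝ :=
  ∑ l, (w l a * r l b c d + w l b * r a l c d + w l c * r a b l d + w l d * r a b c l)

/-- The momentum components of the energy current. -/
def momentum (r : Idx → Idx → Idx → Idx → ℝ) (i : Idx) : ℝ :=
  ∑ m, ∑ c, ∑ d, r tIdx m c d * r i m c d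

/-- The sum of the squares of the components of a four-tensor. -/
def sqNorm (r : Idx → Idx → Idx → Idx → ℝ) : ℝ := ∑ a, ∑ b, ∑ c, ∑ d, r a b c d ^ 2

/-- The part of the divergence of the energy current which contains derivatives of the field. -/
def divField (r : Idx → Idx → Idx → Idx → ℝ) (dr : Idx → Idx → Idx → Idx → Idx → ℝ) : ℝ :=
  -(1 / 2) * ∑ a, ∑ b, ∑ c, ∑ d, r a b c d * dr tIdx a b c d
    + ∑ i : Fin 3, ∑ m, ∑ c, ∑ d, (dr (.inr i) tIdx m c d * r (.inr i) m c d
        + r tIdx m c d * dr (.inr i) (.inr i) m c d)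

/-- The part of the divergence of the energy current which contains the divergence of the frame. -/
def divFrame (r : Idx → Idx → Idx → Idx → ℝ) (w : Idx → Idx → Idx → ℝ) : ℝ :=
  -(1 / 4) * sqNorm r * ∑ b, w b b tIdx
    + ∑ i : Fin 3, momentum r (.inr i) * ∑ b, w b b (.inr i)

variable {r : Idx → Idx → Idx → Idx → ℝ} {dr D : Idx → Idx → Idx → Idx → Idx → ℝ}
  {w : Idx → Idx → Idx → ℝ}

/-- Conservation of energy for a field satisfying the Maxwell equations. -/
lemma maxwell_energy {F : Idx → Idx → ℝ} {DF : Idx → Idx → Idx → ℝ}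
    (hF : ∀ a b, F a b = -F b a) (hD : ∀ e a b, DF e a b = -DF e b a)
    (hcyc : ∀ e a b, DF e a b + DF a b e + DF b e a = 0)
    (hdiv : ∀ b, ∑ e, minkowski e * DF e e b = 0) :
    -(1 / 2) * ∑ a, ∑ b, F a b * DF tIdx a b
      + ∑ i : Fin 3, ∑ m, (DF (.inr i) tIdx m * F (.inr i) m
        + F tIdx m * DF (.inr i) (.inr i) m) = 0 := by
  have hF0 : ∀ a, F a a = 0 := fun a => by linarith [hF a a]
  have hD0 : ∀ e a, DF e a a = 0 := fun e a => by linarith [hD e a a]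
  -- Only the evolution equations enter: the spatial components of the divergence and the cyclic
  -- identities that involve the time index. They are paired below with the electric and magnetic
  -- components respectively.
  have d1 := hdiv (.inr 0)
  have d2 := hdiv (.inr 1)
  have d3 := hdiv (.inr 2)
  have c1 := hcyc tIdx (.inr 0) (.inr 1)
  have c2 := hcyc tIdx (.inr 0) (.inr 2)
  have c3 := hcyc tIdx (.inr 1) (.inr 2)
  simp only [Fintype.sum_sum_type, Finset.univ_unique, Finset.sum_singleton, Fin.sum_univ_three,
    minkowski, Sum.elim_inl, Sum.elim_inr, PUnit.default_eq_unit, hF0, hD0] at d1 d2 d3 c1 c2 c3 ⊢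
  simp only [hF (.inr _) tIdx, hF (.inr 1) (.inr 0), hF (.inr 2) (.inr 0), hF (.inr 2) (.inr 1),
    hD _ (.inr _) tIdx, hD _ (.inr 1) (.inr 0), hD _ (.inr 2) (.inr 0), hD _ (.inr 2) (.inr 1)]
    at d1 d2 d3 c1 c2 c3 ⊢
  linear_combination F tIdx (.inr 0) * d1 + F tIdx (.inr 1) * d2 + F tIdx (.inr 2) * d3
    - F (.inr 0) (.inr 1) * c1 - F (.inr 0) (.inr 2) * c2 - F (.inr 1) (.inr 2) * c3

/-- For each fixed last pair `c, d` the first two slots form a Maxwell field, and the current is the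
sum over `c, d` of the Maxwell currents. -/
lemma divField_maxwell (hr : ∀ a b c d, r a b c d = -r b a c d)
    (hD : ∀ e a b c d, D e a b c d = -D e b a c d)
    (hcyc : ∀ e a b c d, D e a b c d + D a b e c d + D b e a c d = 0)
    (hdiv : ∀ b c d, ∑ e, minkowski e * D e e b c d = 0) : divField r D = 0 := by
  have h : ∀ c d, _ := fun c d => maxwell_energy (F := fun a b => r a b c d)
    (DF := fun e a b => D e a b c d) (fun a b => hr a b c d) (fun e a b => hD e a b c d)
    (fun e a b => hcyc e a b c d) (fun b => hdiv b c d)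
  have h2 : ∑ c, ∑ d, (-(1 / 2) * ∑ a, ∑ b, r a b c d * D tIdx a b c d
      + ∑ i : Fin 3, ∑ m, (D (.inr i) tIdx m c d * r (.inr i) m c d
        + r tIdx m c d * D (.inr i) (.inr i) m c d)) = 0 :=
    Finset.sum_eq_zero fun c _ => Finset.sum_eq_zero fun d _ => h c d
  have h3 : ∑ c, ∑ d, (-(1 / 2) * ∑ a, ∑ b, r a b c d * D tIdx a b c d
      + ∑ i : Fin 3, ∑ m, (D (.inr i) tIdx m c d * r (.inr i) m c d
        + r tIdx m c d * D (.inr i) (.inr i) m c d))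
      = ∑ c, ∑ d, -(1 / 2) * ∑ a, ∑ b, r a b c d * D tIdx a b c d
        + ∑ c, ∑ d, ∑ i : Fin 3, ∑ m, (D (.inr i) tIdx m c d * r (.inr i) m c d
          + r tIdx m c d * D (.inr i) (.inr i) m c d) := by
    simp only [Finset.sum_add_distrib]
  rw [← h2, h3, divField]
  congr 1
  · rw [sum_comm_pairs]
    simp only [Finset.mul_sum]
  · calc _ = ∑ i : Fin 3, ∑ c, ∑ m, ∑ d, (D (.inr i) tIdx m c d * r (.inr i) m c d
        + r tIdx m c d * D (.inr i) (.inr i) m c d) :=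
          Finset.sum_congr rfl fun i _ => Finset.sum_comm
      _ = ∑ c, ∑ i : Fin 3, ∑ m, ∑ d, (D (.inr i) tIdx m c d * r (.inr i) m c d
        + r tIdx m c d * D (.inr i) (.inr i) m c d) := Finset.sum_comm
      _ = ∑ c, ∑ i : Fin 3, ∑ d, ∑ m, (D (.inr i) tIdx m c d * r (.inr i) m c d
        + r tIdx m c d * D (.inr i) (.inr i) m c d) :=
          Finset.sum_congr rfl fun c _ => Finset.sum_congr rfl fun i _ => Finset.sum_comm
      _ = _ := Finset.sum_congr rfl fun c _ => Finset.sum_comm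

lemma divField_add (dr dr' : Idx → Idx → Idx → Idx → Idx → ℝ) :
    divField r (fun e a b c d => dr e a b c d + dr' e a b c d) = divField r dr + divField r dr' := by
  have h1 : ∀ a b c d : Idx, r a b c d * (dr tIdx a b c d + dr' tIdx a b c d)
      = r a b c d * dr tIdx a b c d + r a b c d * dr' tIdx a b c d := fun a b c d => by ring
  have h2 : ∀ (i : Fin 3) (m c d : Idx),
      (dr (.inr i) tIdx m c d + dr' (.inr i) tIdx m c d) * r (.inr i) m c d
        + r tIdx m c d * (dr (.inr i) (.inr i) m c d + dr' (.inr i) (.inr i) m c d)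
      = (dr (.inr i) tIdx m c d * r (.inr i) m c d + r tIdx m c d * dr (.inr i) (.inr i) m c d)
        + (dr' (.inr i) tIdx m c d * r (.inr i) m c d
          + r tIdx m c d * dr' (.inr i) (.inr i) m c d) := fun i m c d => by ring
  simp only [divField, h1, h2]
  simp only [Finset.sum_add_distrib (f := fun d => r _ _ _ d * dr tIdx _ _ _ d),
    Finset.sum_add_distrib (f := fun c => ∑ d, r _ _ c d * dr tIdx _ _ c d),
    Finset.sum_add_distrib (f := fun b => ∑ c, ∑ d, r _ b c d * dr tIdx _ b c d),
    Finset.sum_add_distrib (f := fun a => ∑ b, ∑ c, ∑ d, r a b c d * dr tIdx a b c d),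
    Finset.sum_add_distrib (f := fun d => dr _ tIdx _ _ d * r _ _ _ d + r tIdx _ _ d * dr _ _ _ _ d),
    Finset.sum_add_distrib
      (f := fun c => ∑ d, (dr _ tIdx _ c d * r _ _ c d + r tIdx _ c d * dr _ _ _ c d)),
    Finset.sum_add_distrib
      (f := fun m => ∑ c, ∑ d, (dr _ tIdx m c d * r _ m c d + r tIdx m c d * dr _ _ m c d)),
    Finset.sum_add_distrib (f := fun i : Fin 3 => ∑ m, ∑ c, ∑ d,
      (dr (.inr i) tIdx m c d * r (.inr i) m c d + r tIdx m c d * dr (.inr i) (.inr i) m c d))]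
  ring

lemma act_add (u v : Idx → Idx → ℝ) (a b c d : Idx) :
    act (fun x y => u x y + v x y) r a b c d = act u r a b c d + act v r a b c d := by
  simp only [act, ← Finset.sum_add_distrib]
  exact Finset.sum_congr rfl fun l _ => by ring

lemma divFrame_add (u v : Idx → Idx → Idx → ℝ) :
    divFrame r (fun e a b => u e a b + v e a b) = divFrame r u + divFrame r v := by
  simp only [divFrame, Finset.sum_add_distrib, mul_add]
  ring

lemma skew_sum {ρ : Idx → Idx → ℝ} (hρ : ∀ a b, ρ a b = -ρ b a) {s : Idx → Idx → ℝ}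
    (hs : ∀ a b, s a b = s b a) : ∑ a, ∑ l, ρ l a * s l a = 0 := by
  have h : ∑ a, ∑ l, ρ l a * s l a = -∑ a, ∑ l, ρ l a * s l a := by
    conv_lhs => rw [Finset.sum_comm]
    simp only [← Finset.sum_neg_distrib]
    exact Finset.sum_congr rfl fun a _ => Finset.sum_congr rfl fun l _ => by
      rw [hρ a l, hs a l]; ring
  linarith

/-- The rotational terms in the last three slots cancel. -/
lemma skew_sum_three {ρ : Idx → Idx → ℝ} (hρ : ∀ a b, ρ a b = -ρ b a)
    (x y : Idx → Idx → Idx → ℝ) :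
    ∑ m, ∑ c, ∑ d, ((∑ l, (ρ l m * x l c d + ρ l c * x m l d + ρ l d * x m c l)) * y m c d
      + x m c d * ∑ l, (ρ l m * y l c d + ρ l c * y m l d + ρ l d * y m c l)) = 0 := by
  have h1 : ∀ c d, ∑ m, ∑ l, ρ l m * (x l c d * y m c d + x m c d * y l c d) = 0 := fun c d =>
    skew_sum hρ (s := fun l m => x l c d * y m c d + x m c d * y l c d) fun a b => by ring
  have h2 : ∀ m d, ∑ c, ∑ l, ρ l c * (x m l d * y m c d + x m c d * y m l d) = 0 := fun m d =>
    skew_sum hρ (s := fun l c => x m l d * y m c d + x m c d * y m l d) fun a b => by ring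
  have h3 : ∀ m c, ∑ d, ∑ l, ρ l d * (x m c l * y m c d + x m c d * y m c l) = 0 := fun m c =>
    skew_sum hρ (s := fun l d => x m c l * y m c d + x m c d * y m c l) fun a b => by ring
  have e : ∀ m c d, (∑ l, (ρ l m * x l c d + ρ l c * x m l d + ρ l d * x m c l)) * y m c d
      + x m c d * ∑ l, (ρ l m * y l c d + ρ l c * y m l d + ρ l d * y m c l)
      = ∑ l, ρ l m * (x l c d * y m c d + x m c d * y l c d)
        + ∑ l, ρ l c * (x m l d * y m c d + x m c d * y m l d)
        + ∑ l, ρ l d * (x m c l * y m c d + x m c d * y m c l) := by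
    intro m c d
    simp only [Finset.sum_mul, Finset.mul_sum, ← Finset.sum_add_distrib]
    exact Finset.sum_congr rfl fun l _ => by ring
  simp only [e]
  have k1 : ∑ m, ∑ c, ∑ d, ∑ l, ρ l m * (x l c d * y m c d + x m c d * y l c d) = 0 := by
    rw [Finset.sum_comm]
    refine Finset.sum_eq_zero fun c _ => ?_
    rw [Finset.sum_comm]
    exact Finset.sum_eq_zero fun d _ => h1 c d
  have k2 : ∑ m, ∑ c, ∑ d, ∑ l, ρ l c * (x m l d * y m c d + x m c d * y m l d) = 0 := by
    refine Finset.sum_eq_zero fun m _ => ?_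
    rw [Finset.sum_comm]
    exact Finset.sum_eq_zero fun d _ => h2 m d
  have k3 : ∑ m, ∑ c, ∑ d, ∑ l, ρ l d * (x m c l * y m c d + x m c d * y m c l) = 0 :=
    Finset.sum_eq_zero fun m _ => Finset.sum_eq_zero fun c _ => h3 m c
  simp only [mul_add, Finset.sum_add_distrib] at k1 k2 k3 ⊢
  linarith

lemma act_eq (u : Idx → Idx → ℝ) (a b c d : Idx) : act u r a b c d = ∑ l, u l a * r l b c d
    + ∑ l, (u l b * r a l c d + u l c * r a b l d + u l d * r a b c l) := by
  rw [act, ← Finset.sum_add_distrib]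
  exact Finset.sum_congr rfl fun l _ => by ring

/-- Rotations of the frame do not contribute to the divergence of the energy current. -/
lemma div_rotation {ρ : Idx → Idx → Idx → ℝ} (hρ : ∀ e a b, ρ e a b = -ρ e b a)
    (h0 : ∀ e b, ρ e tIdx b = 0) :
    divField r (fun e => act (ρ e) r) + divFrame r ρ = 0 := by
  have h0' : ∀ e b, ρ e b tIdx = 0 := fun e b => by rw [hρ, h0, neg_zero]
  -- A rotation acting on the three contracted slots preserves the Euclidean inner product, so only
  -- its action on the free first slots `x` and `y` survives.
  have key : ∀ (e x y : Idx), ∑ m, ∑ c, ∑ d, (act (ρ e) r x m c d * r y m c d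
      + r x m c d * act (ρ e) r y m c d)
      = ∑ l, ρ e l x * ∑ m, ∑ c, ∑ d, r l m c d * r y m c d
        + ∑ l, ρ e l y * ∑ m, ∑ c, ∑ d, r x m c d * r l m c d := by
    intro e x y
    have h := skew_sum_three (hρ e) (r x) (r y)
    have e1 : ∀ m c d, act (ρ e) r x m c d * r y m c d + r x m c d * act (ρ e) r y m c d
        = (∑ l, ρ e l x * (r l m c d * r y m c d) + ∑ l, ρ e l y * (r x m c d * r l m c d))
          + ((∑ l, (ρ e l m * r x l c d + ρ e l c * r x m l d + ρ e l d * r x m c l)) * r y m c d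
      + r x m c d * ∑ l, (ρ e l m * r y l c d + ρ e l c * r y m l d + ρ e l d * r y m c l)) := by
      intro m c d
      rw [act_eq, act_eq, add_mul, mul_add, Finset.sum_mul, Finset.mul_sum]
      have a1 : ∑ l, ρ e l x * r l m c d * r y m c d = ∑ l, ρ e l x * (r l m c d * r y m c d) :=
        Finset.sum_congr rfl fun l _ => by ring
      have a2 : ∑ l, r x m c d * (ρ e l y * r l m c d) = ∑ l, ρ e l y * (r x m c d * r l m c d) :=
        Finset.sum_congr rfl fun l _ => by ring
      rw [a1, a2]
      ring
    have swap : ∀ (f : Idx → Idx → Idx → Idx → ℝ), ∑ m, ∑ c, ∑ d, ∑ l, f m c d l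
        = ∑ l, ∑ m, ∑ c, ∑ d, f m c d l := by
      intro f
      calc _ = ∑ m, ∑ c, ∑ l, ∑ d, f m c d l :=
            Finset.sum_congr rfl fun m _ => Finset.sum_congr rfl fun c _ => Finset.sum_comm
        _ = ∑ m, ∑ l, ∑ c, ∑ d, f m c d l := Finset.sum_congr rfl fun m _ => Finset.sum_comm
        _ = _ := Finset.sum_comm
    calc _ = ∑ m, ∑ c, ∑ d, (∑ l, ρ e l x * (r l m c d * r y m c d)
            + ∑ l, ρ e l y * (r x m c d * r l m c d)) + 0 := by
          rw [← h]
          simp only [← Finset.sum_add_distrib, e1]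
      _ = _ := by
          simp only [add_zero, Finset.sum_add_distrib]
          rw [swap fun m c d l => ρ e l x * (r l m c d * r y m c d),
            swap fun m c d l => ρ e l y * (r x m c d * r l m c d)]
          simp only [Finset.mul_sum]
  have t1 : ∑ a, ∑ b, ∑ c, ∑ d, r a b c d * act (ρ tIdx) r a b c d = 0 := by
    have h : ∑ a, ∑ b, ∑ c, ∑ d, (act (ρ tIdx) r a b c d * r a b c d
        + r a b c d * act (ρ tIdx) r a b c d) = 0 := by
      simp only [key]
      rw [Finset.sum_add_distrib, skew_sum (hρ tIdx) (s := fun l x => ∑ m, ∑ c, ∑ d, r l m c d * r x m c d),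
        skew_sum (hρ tIdx) (s := fun l x => ∑ m, ∑ c, ∑ d, r x m c d * r l m c d), add_zero]
      all_goals
        intro a b
        exact Finset.sum_congr rfl fun _ _ => Finset.sum_congr rfl fun _ _ =>
          Finset.sum_congr rfl fun _ _ => by ring
    have h' : ∀ a b c d, act (ρ tIdx) r a b c d * r a b c d + r a b c d * act (ρ tIdx) r a b c d
        = 2 * (r a b c d * act (ρ tIdx) r a b c d) := fun a b c d => by ring
    simp only [h', ← Finset.mul_sum] at h
    linarith
  -- The rotation fixes the time index, so only the index `i` is rotated.
  have t2 : ∀ i : Fin 3, ∑ m, ∑ c, ∑ d, (act (ρ (.inr i)) r tIdx m c d * r (.inr i) m c d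
      + r tIdx m c d * act (ρ (.inr i)) r (.inr i) m c d)
      = ∑ l : Fin 3, ρ (.inr i) (.inr l) (.inr i) * momentum r (.inr l) := by
    intro i
    rw [key]
    simp [h0', h0, momentum]
  rw [divField, t1, divFrame]
  simp only [t2]
  have t3 : ∑ b, ρ b b tIdx = 0 := Finset.sum_eq_zero fun b _ => h0' b b
  -- By skewness, this remainder is minus the term produced by the divergence of the spatial frame
  -- vectors.
  have t4 : ∑ i : Fin 3, ∑ l : Fin 3, ρ (.inr i) (.inr l) (.inr i) * momentum r (.inr l)
      = -∑ i : Fin 3, momentum r (.inr i) * ∑ b, ρ b b (.inr i) := by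
    rw [Finset.sum_comm, ← Finset.sum_neg_distrib]
    refine Finset.sum_congr rfl fun l _ => ?_
    simp only [Fintype.sum_sum_type, h0, Finset.sum_const_zero, zero_add, Finset.mul_sum,
      ← Finset.sum_neg_distrib]
    exact Finset.sum_congr rfl fun i _ => by rw [hρ]; ring
  rw [t3, t4]
  ring

lemma abs_sum_le_of_abs_le {ι : Type*} [Fintype ι] {f : ι → ℝ} {b : ℝ} (h : ∀ i, |f i| ≤ b) :
    |∑ i, f i| ≤ Fintype.card ι * b := by
  calc |∑ i, f i| ≤ ∑ i, |f i| := Finset.abs_sum_le_sum_abs _ _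
    _ ≤ ∑ _i : ι, b := Finset.sum_le_sum fun i _ => h i
    _ = Fintype.card ι * b := by simp

lemma abs_sum_idx_le {f : Idx → ℝ} {b : ℝ} (h : ∀ i, |f i| ≤ b) : |∑ i, f i| ≤ 4 * b := by
  simpa using abs_sum_le_of_abs_le h

lemma abs_sum_three_le {f : Fin 3 → ℝ} {b : ℝ} (h : ∀ i, |f i| ≤ b) : |∑ i, f i| ≤ 3 * b := by
  simpa using abs_sum_le_of_abs_le h

lemma sqNorm_nonneg : 0 ≤ sqNorm r := by
  unfold sqNorm
  positivity

lemma sq_le_sqNorm (a b c d : Idx) : r a b c d ^ 2 ≤ sqNorm r := by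
  have h4 : r a b c d ^ 2 ≤ ∑ d, r a b c d ^ 2 :=
    Finset.single_le_sum (f := fun d => r a b c d ^ 2) (fun _ _ => by positivity)
      (Finset.mem_univ d)
  have h3 : ∑ d, r a b c d ^ 2 ≤ ∑ c, ∑ d, r a b c d ^ 2 :=
    Finset.single_le_sum (f := fun c => ∑ d, r a b c d ^ 2) (fun _ _ => by positivity)
      (Finset.mem_univ c)
  have h2 : ∑ c, ∑ d, r a b c d ^ 2 ≤ ∑ b, ∑ c, ∑ d, r a b c d ^ 2 :=
    Finset.single_le_sum (f := fun b => ∑ c, ∑ d, r a b c d ^ 2) (fun _ _ => by positivity)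
      (Finset.mem_univ b)
  have h1 : ∑ b, ∑ c, ∑ d, r a b c d ^ 2 ≤ sqNorm r :=
    Finset.single_le_sum (f := fun a => ∑ b, ∑ c, ∑ d, r a b c d ^ 2) (fun _ _ => by positivity)
      (Finset.mem_univ a)
  linarith

lemma abs_mul_le_sqNorm (a b c d a' b' c' d' : Idx) :
    |r a b c d * r a' b' c' d'| ≤ sqNorm r := by
  rw [abs_le]
  constructor <;> nlinarith [sq_nonneg (r a b c d + r a' b' c' d'),
    sq_nonneg (r a b c d - r a' b' c' d'), sq_le_sqNorm (r := r) a b c d,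
    sq_le_sqNorm (r := r) a' b' c' d']

lemma abs_momentum_le (i : Idx) : |momentum r i| ≤ 64 * sqNorm r := by
  have := abs_sum_idx_le fun m => abs_sum_idx_le fun c => abs_sum_idx_le fun d =>
    abs_mul_le_sqNorm (r := r) tIdx m c d i m c d
  unfold momentum
  linarith

/-- The contribution of the boosts of the frame is controlled by their size. -/
lemma abs_div_boost_le {β : Idx → Idx → Idx → ℝ} {B : ℝ} (hβ : ∀ e a b, |β e a b| ≤ B) :
    |divField r (fun e => act (β e) r) + divFrame r β| ≤ 9000 * B * sqNorm r := by
  have hB : 0 ≤ B := (abs_nonneg _).trans (hβ tIdx tIdx tIdx)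
  have hQ := sqNorm_nonneg (r := r)
  have hBQ : 0 ≤ B * sqNorm r := mul_nonneg hB hQ
  have hterm : ∀ e l x a b c d a' b' c' d',
      |β e l x * r a b c d * r a' b' c' d'| ≤ B * sqNorm r := by
    intros
    rw [mul_assoc, abs_mul]
    exact mul_le_mul (hβ _ _ _) (abs_mul_le_sqNorm _ _ _ _ _ _ _ _) (abs_nonneg _) hB
  have hact : ∀ e a b c d a' b' c' d',
      |act (β e) r a b c d * r a' b' c' d'| ≤ 16 * (B * sqNorm r) := by
    intro e a b c d a' b' c' d'
    rw [act, Finset.sum_mul]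
    have : ∀ l, |(β e l a * r l b c d + β e l b * r a l c d + β e l c * r a b l d
        + β e l d * r a b c l) * r a' b' c' d'| ≤ 4 * (B * sqNorm r) := by
      intro l
      have h1 := abs_le.1 (hterm e l a l b c d a' b' c' d')
      have h2 := abs_le.1 (hterm e l b a l c d a' b' c' d')
      have h3 := abs_le.1 (hterm e l c a b l d a' b' c' d')
      have h4 := abs_le.1 (hterm e l d a b c l a' b' c' d')
      rw [abs_le]
      simp only [add_mul]
      constructor <;> linarith [h1.1, h1.2, h2.1, h2.2, h3.1, h3.2, h4.1, h4.2]
    linarith [abs_sum_idx_le this]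
  have t1 : |∑ a, ∑ b, ∑ c, ∑ d, r a b c d * act (β tIdx) r a b c d|
      ≤ 4 * (4 * (4 * (4 * (16 * (B * sqNorm r))))) :=
    abs_sum_idx_le fun a => abs_sum_idx_le fun b => abs_sum_idx_le fun c => abs_sum_idx_le fun d =>
      by rw [mul_comm]; exact hact _ _ _ _ _ _ _ _ _
  have t2 : |∑ i : Fin 3, ∑ m, ∑ c, ∑ d, (act (β (.inr i)) r tIdx m c d * r (.inr i) m c d
        + r tIdx m c d * act (β (.inr i)) r (.inr i) m c d)|
      ≤ 3 * (4 * (4 * (4 * (32 * (B * sqNorm r))))) :=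
    abs_sum_three_le fun i => abs_sum_idx_le fun m => abs_sum_idx_le fun c => abs_sum_idx_le
      fun d => by
        refine (abs_add_le _ _).trans ?_
        have h1 := hact (.inr i) tIdx m c d (.inr i) m c d
        have h2 := hact (.inr i) (.inr i) m c d tIdx m c d
        rw [mul_comm (r tIdx m c d)]
        linarith
  have t3 : |sqNorm r * ∑ b, β b b tIdx| ≤ sqNorm r * (4 * B) := by
    rw [abs_mul, abs_of_nonneg hQ]
    exact mul_le_mul_of_nonneg_left (abs_sum_idx_le fun b => hβ _ _ _) hQ
  have t4 : |∑ i : Fin 3, momentum r (.inr i) * ∑ b, β b b (.inr i)|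
      ≤ 3 * ((64 * sqNorm r) * (4 * B)) :=
    abs_sum_three_le fun i => by
      rw [abs_mul]
      exact mul_le_mul (abs_momentum_le _) (abs_sum_idx_le fun b => hβ _ _ _) (abs_nonneg _)
        (by positivity)
  -- The four bounds contribute `4096/2 + 6144 + 1 + 768 = 8961`, which is rounded up to `9000`.
  rw [divField, divFrame]
  have h1 := abs_le.1 t1
  have h2 := abs_le.1 t2
  have h3 := abs_le.1 t3
  have h4 := abs_le.1 t4
  rw [abs_le]
  constructor <;> nlinarith [h1.1, h1.2, h2.1, h2.2, h3.1, h3.2, h4.1, h4.2]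

/-- The divergence of the energy current of a vacuum curvature tensor, in terms of components with
respect to an orthonormal frame: it is controlled by the boosts of the frame. -/
lemma abs_div_le {B : ℝ} (hw : ∀ e a b, minkowski a * w e a b + minkowski b * w e b a = 0)
    (hB : ∀ e (i : Fin 3), |w e tIdx (.inr i)| ≤ B)
    (hanti : ∀ a b c d, r a b c d = -r b a c d) (hpair : ∀ a b c d, r a b c d = r c d a b)
    (hanti' : ∀ e a b c d, dr e a b c d = -dr e b a c d)
    (hpair' : ∀ e a b c d, dr e a b c d = dr e c d a b)
    (hric : ∀ b d, ∑ e, minkowski e * r e b e d = 0)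
    (hric' : ∀ x b d, ∑ e, minkowski e * dr x e b e d = 0)
    (hcyc : ∀ e a b c d, (dr e a b c d - act (w e) r a b c d)
      + (dr c a b d e - act (w c) r a b d e) + (dr d a b e c - act (w d) r a b e c) = 0) :
    |divField r dr + divFrame r w| ≤ 9000 * B * sqNorm r := by
  -- `D` is the covariant derivative of the curvature in the frame. The plan is to show that it
  -- satisfies the Maxwell equations in the first pair of slots, so that only the correction by the
  -- connection coefficients contributes.
  set D : Idx → Idx → Idx → Idx → Idx → ℝ := fun e a b c d => dr e a b c d - act (w e) r a b c d
    with hDdef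
  have hactanti : ∀ e a b c d, act (w e) r a b c d = -act (w e) r b a c d := by
    intro e a b c d
    simp only [act, ← Finset.sum_neg_distrib]
    exact Finset.sum_congr rfl fun l _ => by
      rw [hanti l b, hanti a l, hanti a b l d, hanti a b c l]; ring
  have hactpair : ∀ e a b c d, act (w e) r a b c d = act (w e) r c d a b := by
    intro e a b c d
    simp only [act]
    exact Finset.sum_congr rfl fun l _ => by
      rw [hpair l b, hpair a l, hpair a b l d, hpair a b c l]; ring
  have hDanti : ∀ e a b c d, D e a b c d = -D e b a c d := fun e a b c d => by
    simp only [hDdef]; rw [hanti', hactanti]; ring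
  have hDpair : ∀ e a b c d, D e a b c d = D e c d a b := fun e a b c d => by
    simp only [hDdef]; rw [hpair', hactpair]
  -- Pair symmetry carries the Bianchi identity from the last pair of slots to the first.
  have hDcyc : ∀ e a b c d, D e a b c d + D a b e c d + D b e a c d = 0 := fun e a b c d => by
    rw [hDpair, hDpair a, hDpair b]; exact hcyc e c d a b
  -- The covariant derivative of a trace-free tensor is trace free: corrections in the traced slots
  -- cancel by skewness of `w` relative to the Minkowski metric, and those in the other slots
  -- contain the vanishing Ricci tensor.
  have hDric : ∀ x b d, ∑ e, minkowski e * D x e b e d = 0 := by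
    intro x b d
    have e1 : ∀ e, minkowski e * D x e b e d = minkowski e * dr x e b e d
        - (∑ l, (minkowski e * w x l e * r l b e d + minkowski e * w x l e * r e b l d)
          + ∑ l, w x l b * (minkowski e * r e l e d) + ∑ l, w x l d * (minkowski e * r e b e l)) := by
      intro e
      simp only [hDdef, act, mul_sub, Finset.mul_sum, ← Finset.sum_add_distrib]
      congr 1
      exact Finset.sum_congr rfl fun l _ => by ring
    have s1 : ∑ e, ∑ l, (minkowski e * w x l e * r l b e d + minkowski e * w x l e * r e b l d)
        = 0 := by
      simp only [Finset.sum_add_distrib]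
      rw [Finset.sum_comm (f := fun e l => minkowski e * w x l e * r e b l d),
        ← Finset.sum_add_distrib]
      refine Finset.sum_eq_zero fun e _ => ?_
      rw [← Finset.sum_add_distrib]
      refine Finset.sum_eq_zero fun l _ => ?_
      have h := hw x l e
      have h1 := minkowski_sq e
      have h2 := minkowski_sq l
      have : minkowski e * w x l e + minkowski l * w x e l = 0 := by
        linear_combination (minkowski e * minkowski l) * h - (minkowski l * w x e l) * h1
          - (minkowski e * w x l e) * h2
      linear_combination (r l b e d) * this
    have s2 : ∑ e, ∑ l, w x l b * (minkowski e * r e l e d) = 0 := by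
      rw [Finset.sum_comm]
      exact Finset.sum_eq_zero fun l _ => by rw [← Finset.mul_sum, hric, mul_zero]
    have s3 : ∑ e, ∑ l, w x l d * (minkowski e * r e b e l) = 0 := by
      rw [Finset.sum_comm]
      exact Finset.sum_eq_zero fun l _ => by rw [← Finset.mul_sum, hric, mul_zero]
    simp only [e1, Finset.sum_sub_distrib, Finset.sum_add_distrib] at s1 s2 s3 ⊢
    rw [hric', s1, s2, s3]
    ring
  have hDlast : ∀ e a b c d, D e a b c d = -D e a b d c := fun e a b c d => by
    rw [hDpair, hDanti, hDpair]
  -- The contracted Bianchi identity: two of the three terms are traces of `D`, hence zero.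
  have hDdiv : ∀ b c d, ∑ e, minkowski e * D e e b c d = 0 := by
    intro b c d
    have e1 : ∀ e, minkowski e * D e e b c d
        = minkowski e * D c e b e d - minkowski e * D d e b e c := by
      intro e
      have := hcyc e e b c d
      change D e e b c d + D c e b d e + D d e b e c = 0 at this
      rw [hDlast c] at this
      linear_combination minkowski e * this
    simp only [e1, Finset.sum_sub_distrib, hDric, sub_zero]
  have hsplit : divField r dr = divField r D + divField r (fun e => act (w e) r) := by
    rw [← divField_add]
    congr 1
    funext e a b c d
    simp [hDdef]
  rw [hsplit, divField_maxwell hanti hDanti hDcyc hDdiv, zero_add]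
  -- Split the connection coefficients into a rotation part `ρ` (both indices spatial) and a boost
  -- part `β` (one time index). Only the boosts are bounded by `B`; the rotations may be arbitrarily
  -- large.
  let ρ : Idx → Idx → Idx → ℝ := fun e a b =>
    Sum.elim (fun _ => 0) (fun i => Sum.elim (fun _ => 0) (fun j => w e (.inr i) (.inr j)) b) a
  let β : Idx → Idx → Idx → ℝ := fun e a b => w e a b - ρ e a b
  have hwρβ : w = fun e a b => ρ e a b + β e a b := by
    funext e a b
    simp [β]
  have hB0 : 0 ≤ B := (abs_nonneg _).trans (hB tIdx 0)
  have hβ : ∀ e a b, |β e a b| ≤ B := by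
    intro e a b
    rcases a with ⟨⟩ | i <;> rcases b with ⟨⟩ | j
    · have h := hw e tIdx tIdx
      have : w e tIdx tIdx = 0 := by simp [minkowski] at h; linarith
      simp [β, ρ, this, hB0]
    · simpa [β, ρ] using hB e j
    · have h := hw e tIdx (.inr i)
      have : w e (.inr i) tIdx = w e tIdx (.inr i) := by simp [minkowski] at h; linarith
      simpa [β, ρ, this] using hB e i
    · simp [β, ρ, hB0]
  have hρ : ∀ e a b, ρ e a b = -ρ e b a := by
    intro e a b
    rcases a with ⟨⟩ | i <;> rcases b with ⟨⟩ | j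
    · simp [ρ]
    · simp [ρ]
    · simp [ρ]
    · have h := hw e (.inr i) (.inr j)
      simp only [minkowski, Sum.elim_inr, one_mul] at h
      simp only [ρ, Sum.elim_inr]
      linarith
  have hsplit2 : divField r (fun e => act (w e) r) + divFrame r w
      = (divField r (fun e => act (ρ e) r) + divFrame r ρ)
        + (divField r (fun e => act (β e) r) + divFrame r β) := by
    rw [hwρβ, divFrame_add]
    have : divField r (fun e a b c d => act (ρ e) r a b c d + act (β e) r a b c d) = _ :=
      divField_add (r := r) (fun e => act (ρ e) r) (fun e => act (β e) r)
    rw [show (fun e => act (fun a b => ρ e a b + β e a b) r)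
      = fun e a b c d => act (ρ e) r a b c d + act (β e) r a b c d by
        funext e a b c d; exact act_add _ _ _ _ _ _, this]
    ring
  rw [hsplit2, div_rotation hρ (fun e b => by simp [ρ]), zero_add]
  exact abs_div_boost_le hβ

end FrameAlgebra

/-! ### Lie derivatives of the metric -/

section LieDerivative

variable {p : Coord} {U : Set Coord} {G : Coord → Matrix Idx Idx ℝ} {X : Coord → Idx → ℝ}

/-- The covariant derivative `D_μ X^l` of a vector field. -/
def covDeriv (G : Coord → Matrix Idx Idx ℝ) (X : Coord → Idx → ℝ) (p : Coord) :
    Matrix Idx Idx ℝ :=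
  Matrix.of fun l μ => pd μ (fun q => X q l) p + ∑ k, conn G μ p l k * X p k

/-- The Lie derivative of the metric is the symmetrized covariant derivative. -/
lemma lieDeriv_eq (hU : IsOpen U) (hp : p ∈ U) (hs : ∀ q ∈ U, (G q)ᵀ = G q)
    (hd : (G p).det ≠ 0) (μ ν : Idx) :
    lieDeriv X G μ ν p = ((covDeriv G X p)ᵀ * G p + G p * covDeriv G X p) μ ν := by
  have hM : ∀ l μ, covDeriv G X p l μ
      = pd μ (fun q => X q l) p + ∑ k, conn G k p l μ * X p k := by
    intro l μ
    simp only [covDeriv, Matrix.of_apply]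
    congr 1
    exact Finset.sum_congr rfl fun k _ => by
      rw [conn_apply, conn_apply, christoffel_symm hU hp hs]
  have hc : ∀ l, pd l (fun q => G q μ ν) p
      = ∑ k, (conn G l p k μ * G p k ν + G p μ k * conn G l p k ν) := by
    intro l
    rw [← pdM_apply, metric_compat hU hp hs hd, Matrix.add_apply,
      Matrix.mul_apply, Matrix.mul_apply, ← Finset.sum_add_distrib]
    rfl
  have e1 : ∑ l, X p l * ∑ k, (conn G l p k μ * G p k ν + G p μ k * conn G l p k ν)
      = ∑ l, ((∑ k, conn G k p l μ * X p k) * G p l ν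
        + G p μ l * ∑ k, conn G k p l ν * X p k) := by
    simp only [Finset.mul_sum, Finset.sum_mul, ← Finset.sum_add_distrib]
    rw [Finset.sum_comm]
    exact Finset.sum_congr rfl fun l _ => Finset.sum_congr rfl fun k _ => by ring
  simp only [lieDeriv, hc]
  rw [Finset.sum_add_distrib, Finset.sum_add_distrib, e1, Matrix.add_apply, Matrix.mul_apply,
    Matrix.mul_apply]
  simp only [Matrix.transpose_apply, hM, ← Finset.sum_add_distrib]
  exact Finset.sum_congr rfl fun l _ => by ring

/-- The transformation law of the Lie derivative of the metric. -/
lemma lieDeriv_pull {V : Set Coord} {Ψ : Coord → Coord} {G' : Coord → Matrix Idx Idx ℝ}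
    {X' : Coord → Idx → ℝ} {q : Coord} (hU : IsOpen U) (hV : IsOpen V)
    (hΨ : ContDiffOn ℝ ∞ Ψ U) (hUV : Set.MapsTo Ψ U V) (hG : SmoothMat G V)
    (hs : ∀ p ∈ V, (G p)ᵀ = G p) (hd : ∀ p ∈ V, (G p).det ≠ 0)
    (hJ : ∀ z ∈ U, (jac Ψ z).det ≠ 0)
    (hG' : ∀ z ∈ U, G' z = (jac Ψ z)ᵀ * G (Ψ z) * jac Ψ z)
    (hX : ∀ l, ContDiffOn ℝ ∞ (fun p => X p l) V)
    (hX' : ∀ l, ContDiffOn ℝ ∞ (fun p => X' p l) U)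
    (hXX : ∀ z ∈ U, ∀ l, X (Ψ z) l = ∑ k, jac Ψ z l k * X' z k) (hq : q ∈ U) (a b : Idx) :
    lieDeriv X' G' a b q
      = ∑ α, ∑ β, jac Ψ q α a * jac Ψ q β b * lieDeriv X G α β (Ψ q) := by
  have hs' : ∀ z ∈ U, (G' z)ᵀ = G' z := fun z hz => by
    rw [hG' z hz]
    simp [Matrix.transpose_mul, hs _ (hUV hz), Matrix.mul_assoc]
  have hd' : ∀ z ∈ U, (G' z).det ≠ 0 := fun z hz => by
    rw [hG' z hz]; simp [hJ z hz, hd _ (hUV hz)]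
  have hΨd : DifferentiableAt ℝ Ψ q := (hΨ.contDiffAt (hU.mem_nhds hq)).differentiableAt (by simp)
  set J := jac Ψ q with hJdef
  -- The covariant derivative transforms as a mixed tensor: the derivative of the Jacobian produced
  -- by differentiating the vector field cancels the inhomogeneous term in the law of the
  -- Christoffel symbols.
  have key : J * covDeriv G' X' q = covDeriv G X (Ψ q) * J := by
    ext l μ
    have h1 : pd μ (fun z => X (Ψ z) l) q
        = ∑ k, (pd μ (fun z => jac Ψ z l k) q * X' q k + J l k * pd μ (fun z => X' z k) q) := by
      rw [pd_congr_on μ hU hq fun z hz => hXX z hz l]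
      exact pd_sum_mul μ (fun k => smoothOn_diffAt hU hq (smoothMat_jac hU hΨ l k))
        fun k => smoothOn_diffAt hU hq (hX' k)
    rw [pd_comp (f := fun z => X z l) (smoothOn_diffAt hV (hUV hq) (hX l)) hΨd] at h1
    have h2 : ∀ k, ∑ j, J l j * conn G' μ q j k
        = ∑ j, pull Ψ (conn G) μ q l j * J j k + pd μ (fun z => jac Ψ z l k) q := by
      intro k
      have := congrFun (congrFun (conn_pull hU hV hΨ hUV hG hs hd hJ hG' hq μ) l) k
      simpa only [Matrix.mul_apply, Matrix.add_apply, pdM_apply] using this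
    have h3 : ∑ j, J l j * ∑ k, conn G' μ q j k * X' q k
        = ∑ k, (∑ j, J l j * conn G' μ q j k) * X' q k := by
      simp only [Finset.mul_sum, Finset.sum_mul]
      rw [Finset.sum_comm]
      exact Finset.sum_congr rfl fun k _ => Finset.sum_congr rfl fun j _ => by ring
    have h4 : ∑ k, (∑ j, pull Ψ (conn G) μ q l j * J j k) * X' q k
        = ∑ α, J α μ * ∑ j, conn G α (Ψ q) l j * X (Ψ q) j := by
      simp only [pull_apply, hXX q hq, Finset.sum_mul, Finset.mul_sum]
      calc _ = ∑ j, ∑ k, ∑ α, jac Ψ q α μ * conn G α (Ψ q) l j * J j k * X' q k :=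
            Finset.sum_comm
        _ = ∑ j, ∑ α, ∑ k, jac Ψ q α μ * conn G α (Ψ q) l j * J j k * X' q k :=
            Finset.sum_congr rfl fun j _ => Finset.sum_comm
        _ = ∑ α, ∑ j, ∑ k, jac Ψ q α μ * conn G α (Ψ q) l j * J j k * X' q k :=
            Finset.sum_comm
        _ = _ := Finset.sum_congr rfl fun α _ => Finset.sum_congr rfl fun j _ =>
            Finset.sum_congr rfl fun k _ => by rw [hJdef]; ring
    simp only [Matrix.mul_apply, covDeriv, Matrix.of_apply, mul_add, Finset.sum_add_distrib,
      add_mul] at h1 ⊢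
    rw [h3]
    simp only [h2, add_mul, Finset.sum_add_distrib]
    rw [h4]
    have h5 : ∑ x, pd x (fun q => X q l) (Ψ q) * J x μ = ∑ α, J α μ * pd α (fun z => X z l) (Ψ q) :=
      Finset.sum_congr rfl fun x _ => mul_comm _ _
    have h6 : ∑ x, (∑ k, conn G x (Ψ q) l k * X (Ψ q) k) * J x μ
        = ∑ α, J α μ * ∑ j, conn G α (Ψ q) l j * X (Ψ q) j :=
      Finset.sum_congr rfl fun x _ => mul_comm _ _
    rw [h5, h6]
    linear_combination -h1
  have hmat : (covDeriv G' X' q)ᵀ * G' q + G' q * covDeriv G' X' q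
      = Jᵀ * ((covDeriv G X (Ψ q))ᵀ * G (Ψ q) + G (Ψ q) * covDeriv G X (Ψ q)) * J := by
    rw [hG' q hq, ← hJdef]
    have e1 : (covDeriv G' X' q)ᵀ * (Jᵀ * G (Ψ q) * J)
        = (J * covDeriv G' X' q)ᵀ * G (Ψ q) * J := by
      rw [Matrix.transpose_mul J]; simp only [Matrix.mul_assoc]
    have e2 : Jᵀ * G (Ψ q) * J * covDeriv G' X' q = Jᵀ * G (Ψ q) * (J * covDeriv G' X' q) := by
      simp only [Matrix.mul_assoc]
    rw [e1, e2, key, Matrix.transpose_mul]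
    noncomm_ring
  rw [lieDeriv_eq hU hq hs' (hd' q hq), hmat, Matrix.mul_assoc, Matrix.mul_apply]
  refine Finset.sum_congr rfl fun α _ => ?_
  rw [Matrix.mul_apply, Finset.mul_sum]
  exact Finset.sum_congr rfl fun β _ => by
    rw [lieDeriv_eq hV (hUV hq) hs (hd _ (hUV hq)), Matrix.transpose_apply]; ring

end LieDerivative

/-! ### The energy identity in an orthonormal frame -/

section Frame

variable {p : Coord} {U : Set Coord} {G E : Coord → Matrix Idx Idx ℝ}

/-- The Minkowski metric as a matrix. -/
def minkowskiM : Matrix Idx Idx ℝ := Matrix.diagonal minkowski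

/-- The components of the curvature tensor in a frame. -/
def frameRiem (G E : Coord → Matrix Idx Idx ℝ) (p : Coord) (a b c d : Idx) : ℝ :=
  ∑ ρ, ∑ σ, ∑ α, ∑ β, E p ρ a * E p σ b * E p α c * E p β d * riemannDown G ρ σ α β p

/-- The connection form of the Levi-Civita connection in a frame. -/
def frameConn (G E : Coord → Matrix Idx Idx ℝ) (μ : Idx) (p : Coord) : Matrix Idx Idx ℝ :=
  (E p)⁻¹ * (pdM μ E p + conn G μ p * E p)

/-- The connection coefficients in a frame: `D_{E_e} E_b = ∑ a, w e a b • E_a`. -/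
def frameCoeff (G E : Coord → Matrix Idx Idx ℝ) (p : Coord) (e a b : Idx) : ℝ :=
  ∑ x, E p x e * frameConn G E x p a b

/-- The derivatives of the frame components of the curvature in the directions of the frame. -/
def frameDeriv (G E : Coord → Matrix Idx Idx ℝ) (p : Coord) (e a b c d : Idx) : ℝ :=
  ∑ x, E p x e * pd x (fun q => frameRiem G E q a b c d) p

/-- An orthonormal frame on an open set. -/
structure IsFrame (G E : Coord → Matrix Idx Idx ℝ) (U : Set Coord) : Prop where
  isOpen : IsOpen U
  smooth_metric : SmoothMat G U
  smooth_frame : SmoothMat E U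
  symm : ∀ q ∈ U, (G q)ᵀ = G q
  ortho : ∀ q ∈ U, (E q)ᵀ * G q * E q = minkowskiM

lemma det_minkowskiM : minkowskiM.det = -1 := by
  simp [minkowskiM, minkowski, Matrix.det_diagonal]

/-! ### Connection and curvature forms of an orthonormal frame. -/

namespace IsFrame

variable (h : IsFrame G E U)
include h

lemma det_mul (hp : p ∈ U) : (E p).det ^ 2 * (G p).det = -1 := by
  rw [← det_minkowskiM, ← h.ortho p hp]
  simp
  ring

lemma det_metric_neg (hp : p ∈ U) : (G p).det < 0 := by
  by_contra hc
  have := h.det_mul hp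
  nlinarith [mul_nonneg (sq_nonneg (E p).det) (not_lt.1 hc)]

lemma det_frame (hp : p ∈ U) : (E p).det ≠ 0 := fun hc => by
  have := h.det_mul hp
  simp [hc] at this

lemma smooth_conn (μ : Idx) : SmoothMat (conn G μ) U :=
  smoothMat_conn h.isOpen h.smooth_metric (fun _ hq => (h.det_metric_neg hq).ne) μ

lemma smooth_frameConn (μ : Idx) : SmoothMat (frameConn G E μ) U :=
  (h.smooth_frame.inv fun _ hq => h.det_frame hq).mul
    ((h.smooth_frame.pdM h.isOpen μ).add ((h.smooth_conn μ).mul h.smooth_frame))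

lemma frame_mul_conn (hp : p ∈ U) (μ : Idx) :
    E p * frameConn G E μ p = conn G μ p * E p + pdM μ E p := by
  rw [frameConn, ← Matrix.mul_assoc, Matrix.mul_nonsing_inv _ (isUnit_iff_ne_zero.2 (h.det_frame hp)),
    Matrix.one_mul, add_comm]

lemma inv_frame (hp : p ∈ U) : (E p)ᵀ * G p = minkowskiM * (E p)⁻¹ := by
  rw [← h.ortho p hp, Matrix.mul_assoc, Matrix.mul_nonsing_inv _
    (isUnit_iff_ne_zero.2 (h.det_frame hp)), Matrix.mul_one]

/-- Differentiate the orthonormality relation, whose right-hand side is constant, and use metric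
compatibility for the derivative of `G`. -/
lemma frameConn_skew (hp : p ∈ U) (μ : Idx) :
    (frameConn G E μ p)ᵀ * minkowskiM + minkowskiM * frameConn G E μ p = 0 := by
  have hE := h.smooth_frame
  have h1 : pdM μ (fun q => (E q)ᵀ * G q * E q) p = 0 := by
    rw [pdM_congr_on μ h.isOpen hp h.ortho, pdM_const]
  rw [pdM_mul μ h.isOpen hp (hE.transpose.mul h.smooth_metric) hE,
    pdM_mul μ h.isOpen hp hE.transpose h.smooth_metric, pdM_transpose,
    metric_compat h.isOpen hp h.symm (h.det_metric_neg hp).ne] at h1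
  have h2 : pdM μ E p = E p * frameConn G E μ p - conn G μ p * E p := by
    rw [h.frame_mul_conn hp]; abel
  rw [h2, Matrix.transpose_sub, Matrix.transpose_mul, Matrix.transpose_mul] at h1
  rw [← h.ortho p hp, ← h1]
  noncomm_ring

lemma frameCoeff_skew (hp : p ∈ U) (e a b : Idx) :
    minkowski a * frameCoeff G E p e a b + minkowski b * frameCoeff G E p e b a = 0 := by
  simp only [frameCoeff, Finset.mul_sum, ← Finset.sum_add_distrib]
  refine Finset.sum_eq_zero fun x _ => ?_
  have := congrFun (congrFun (h.frameConn_skew hp x) a) b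
  simp only [minkowskiM, Matrix.add_apply, Matrix.mul_diagonal, Matrix.diagonal_mul,
    Matrix.transpose_apply, Matrix.zero_apply] at this
  linear_combination E p x e * this

/-- The frame matrix is a gauge transformation from the frame connection to the coordinate
connection. -/
lemma curv_frameConn (hp : p ∈ U) (μ ν : Idx) :
    E p * curv (frameConn G E) μ ν p = curv (conn G) μ ν p * E p :=
  curv_gauge h.isOpen hp h.smooth_frameConn h.smooth_conn h.smooth_frame
    (fun _ hq μ => h.frame_mul_conn hq μ) μ ν

lemma lowered_curv (hp : p ∈ U) (μ ν : Idx) :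
    minkowskiM * curv (frameConn G E) μ ν p = (E p)ᵀ * (G p * curv (conn G) μ ν p) * E p := by
  rw [← h.ortho p hp, Matrix.mul_assoc _ (E p), h.curv_frameConn hp]
  simp only [Matrix.mul_assoc]

end IsFrame

/-- The curvature two-form with frame indices `a b`, in coordinates. -/
def frameForm (G E : Coord → Matrix Idx Idx ℝ) (a b : Idx) (q : Coord) : Matrix Idx Idx ℝ :=
  Matrix.of fun α β => minkowski a * curv (frameConn G E) α β q a b

/-! ### Bianchi identities, Ricci tensor and deformation tensor in a frame. -/

namespace IsFrame

variable (h : IsFrame G E U)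
include h

lemma smooth_frameForm (a b : Idx) : SmoothMat (frameForm G E a b) U := fun α β =>
  contDiffOn_const.mul (smoothMat_curv h.isOpen h.smooth_frameConn α β a b)

/-- Treats the two pairs of slots differently: the first as matrix indices of the curvature of the
frame connection, the second as form indices. This makes the Bianchi identity for matrix-valued
one-forms applicable. -/
lemma frameRiem_eq (hp : p ∈ U) (a b c d : Idx) :
    frameRiem G E p a b c d = ((E p)ᵀ * frameForm G E a b p * E p) c d := by
  have e1 : ∀ α β, frameForm G E a b p α β
      = ∑ ρ, ∑ σ, E p ρ a * E p σ b * riemannDown G ρ σ α β p := by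
    intro α β
    have : frameForm G E a b p α β = (minkowskiM * curv (frameConn G E) α β p) a b := by
      simp [frameForm, minkowskiM]
    rw [this, h.lowered_curv hp, Matrix.mul_assoc, Matrix.mul_apply]
    refine Finset.sum_congr rfl fun ρ _ => ?_
    rw [Matrix.mul_apply, Finset.mul_sum]
    exact Finset.sum_congr rfl fun σ _ => by
      rw [riemannDown_eq, Matrix.transpose_apply]; ring
  rw [frameRiem, sum_comm_pairs, Matrix.mul_assoc, Matrix.mul_apply]
  refine Finset.sum_congr rfl fun α _ => ?_
  rw [Matrix.mul_apply, Finset.mul_sum]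
  refine Finset.sum_congr rfl fun β _ => ?_
  rw [e1, Matrix.transpose_apply]
  simp only [Finset.mul_sum, Finset.sum_mul]
  exact Finset.sum_congr rfl fun ρ _ => Finset.sum_congr rfl fun σ _ => by ring

lemma smooth_frameRiem (a b c d : Idx) : ContDiffOn ℝ ∞ (fun q => frameRiem G E q a b c d) U :=
  ((((h.smooth_frame.transpose.mul (h.smooth_frameForm a b)).mul h.smooth_frame) c d)).congr
    fun _ hq => h.frameRiem_eq hq a b c d

/-- The derivative of the frame is `E w - Γ E`. Its `w` terms act on the last two frame slots, and
its `Γ` terms complete the derivative of the two-form to a covariant one. -/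
lemma pd_frameRiem (hp : p ∈ U) (x a b c d : Idx) :
    pd x (fun q => frameRiem G E q a b c d) p
      = ∑ l, (frameConn G E x p l c * frameRiem G E p a b l d
          + frameConn G E x p l d * frameRiem G E p a b c l)
        + ((E p)ᵀ * (pdM x (frameForm G E a b) p - (conn G x p)ᵀ * frameForm G E a b p
          - frameForm G E a b p * conn G x p) * E p) c d := by
  have hE := h.smooth_frame
  have hΦ := h.smooth_frameForm a b
  have h1 : pd x (fun q => frameRiem G E q a b c d) p
      = pdM x (fun q => (E q)ᵀ * frameForm G E a b q * E q) p c d :=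
    pd_congr_on x h.isOpen hp fun q hq => h.frameRiem_eq hq a b c d
  have h2 : pdM x E p = E p * frameConn G E x p - conn G x p * E p := by
    rw [h.frame_mul_conn hp]; abel
  have h3 : ∑ l, (frameConn G E x p l c * frameRiem G E p a b l d
          + frameConn G E x p l d * frameRiem G E p a b c l)
      = ((frameConn G E x p)ᵀ * ((E p)ᵀ * frameForm G E a b p * E p)
        + ((E p)ᵀ * frameForm G E a b p * E p) * frameConn G E x p) c d := by
    rw [Matrix.add_apply, Matrix.mul_apply, Matrix.mul_apply, ← Finset.sum_add_distrib]
    exact Finset.sum_congr rfl fun l _ => by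
      rw [h.frameRiem_eq hp, h.frameRiem_eq hp, Matrix.transpose_apply]; ring
  rw [h1, h3, ← Matrix.add_apply, pdM_mul x h.isOpen hp (hE.transpose.mul hΦ) hE,
    pdM_mul x h.isOpen hp hE.transpose hΦ, pdM_transpose, h2, Matrix.transpose_sub,
    Matrix.transpose_mul, Matrix.transpose_mul]
  refine congrFun (congrFun ?_ c) d
  noncomm_ring

omit h in
-- Renaming the summation indices gives the three sums one common coefficient, whose factor is the
-- cyclic sum of `Z`.
lemma cyclic_contraction (M : Matrix Idx Idx ℝ) {Z : Idx → Idx → Idx → ℝ}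
    (hZ : ∀ x α β, Z x α β + Z α β x + Z β x α = 0) (e c d : Idx) :
    ∑ x, ∑ α, ∑ β, M x e * M α c * M β d * Z x α β
      + ∑ x, ∑ α, ∑ β, M x c * M α d * M β e * Z x α β
      + ∑ x, ∑ α, ∑ β, M x d * M α e * M β c * Z x α β = 0 := by
  have h2 : ∑ x, ∑ α, ∑ β, M x c * M α d * M β e * Z x α β
      = ∑ x, ∑ α, ∑ β, M α c * M β d * M x e * Z α β x := by
    calc _ = ∑ x, ∑ β, ∑ α, M x c * M α d * M β e * Z x α β :=
          Finset.sum_congr rfl fun _ _ => Finset.sum_comm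
      _ = _ := Finset.sum_comm
  have h3 : ∑ x, ∑ α, ∑ β, M x d * M α e * M β c * Z x α β
      = ∑ x, ∑ α, ∑ β, M β d * M x e * M α c * Z β x α := by
    calc _ = ∑ α, ∑ x, ∑ β, M x d * M α e * M β c * Z x α β := Finset.sum_comm
      _ = _ := Finset.sum_congr rfl fun _ _ => Finset.sum_comm
  rw [h2, h3]
  simp only [← Finset.sum_add_distrib]
  refine Finset.sum_eq_zero fun x _ => Finset.sum_eq_zero fun α _ => Finset.sum_eq_zero fun β _ => ?_
  linear_combination (M x e * M α c * M β d) * hZ x α β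

/-- The second Bianchi identity in a frame. -/
lemma frame_bianchi (hp : p ∈ U) (e a b c d : Idx) :
    (frameDeriv G E p e a b c d - act (frameCoeff G E p e) (frameRiem G E p) a b c d)
      + (frameDeriv G E p c a b d e - act (frameCoeff G E p c) (frameRiem G E p) a b d e)
      + (frameDeriv G E p d a b e c - act (frameCoeff G E p d) (frameRiem G E p) a b e c) = 0 := by
  let cf := frameConn G E
  -- The full covariant derivative of the curvature: coordinate symbols act on the form slots, frame
  -- coefficients on `a` and `b`.
  let Y : Idx → Matrix Idx Idx ℝ := fun x =>
    (pdM x (frameForm G E a b) p - (conn G x p)ᵀ * frameForm G E a b p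
          - frameForm G E a b p * conn G x p)
      - ∑ l, (cf x p l a • frameForm G E l b p + cf x p l b • frameForm G E a l p)
  have key : ∀ e c d, frameDeriv G E p e a b c d
      - act (frameCoeff G E p e) (frameRiem G E p) a b c d
      = ∑ x, ∑ α, ∑ β, E p x e * E p α c * E p β d * Y x α β := by
    intro e c d
    have e1 : act (frameCoeff G E p e) (frameRiem G E p) a b c d
        = ∑ x, E p x e * ∑ l, (cf x p l a * frameRiem G E p l b c d
          + cf x p l b * frameRiem G E p a l c d + cf x p l c * frameRiem G E p a b l d
          + cf x p l d * frameRiem G E p a b c l) := by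
      simp only [act, frameCoeff, Finset.sum_mul, Finset.mul_sum, ← Finset.sum_add_distrib]
      rw [Finset.sum_comm]
      exact Finset.sum_congr rfl fun x _ => Finset.sum_congr rfl fun l _ => by
        simp only [cf]; ring
    have e2 : ∀ x, ((E p)ᵀ * Y x * E p) c d = ∑ α, ∑ β, E p α c * E p β d * Y x α β := by
      intro x
      rw [Matrix.mul_assoc, Matrix.mul_apply]
      refine Finset.sum_congr rfl fun α _ => ?_
      rw [Matrix.mul_apply, Finset.mul_sum]
      exact Finset.sum_congr rfl fun β _ => by rw [Matrix.transpose_apply]; ring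
    have e3 : ∀ x, ((E p)ᵀ * Y x * E p) c d
        = ((E p)ᵀ * (pdM x (frameForm G E a b) p - (conn G x p)ᵀ * frameForm G E a b p
          - frameForm G E a b p * conn G x p) * E p) c d
          - ∑ l, (cf x p l a * frameRiem G E p l b c d + cf x p l b * frameRiem G E p a l c d) := by
      intro x
      simp only [Y]
      rw [Matrix.mul_sub, Matrix.sub_mul, Matrix.sub_apply]
      congr 1
      simp only [Finset.mul_sum, Finset.sum_mul, Matrix.sum_apply]
      refine Finset.sum_congr rfl fun l _ => ?_
      rw [Matrix.mul_add, Matrix.add_mul, Matrix.add_apply, Matrix.mul_smul, Matrix.smul_mul,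
        Matrix.mul_smul, Matrix.smul_mul, Matrix.smul_apply, Matrix.smul_apply,
        ← h.frameRiem_eq hp, ← h.frameRiem_eq hp, smul_eq_mul, smul_eq_mul]
    rw [e1, frameDeriv, ← Finset.sum_sub_distrib]
    refine Finset.sum_congr rfl fun x _ => ?_
    have e4 : ∑ α, ∑ β, E p x e * E p α c * E p β d * Y x α β
        = E p x e * ((E p)ᵀ * Y x * E p) c d := by
      rw [e2]
      simp only [Finset.mul_sum]
      exact Finset.sum_congr rfl fun α _ => Finset.sum_congr rfl fun β _ => by ring
    rw [e4, e3, h.pd_frameRiem hp]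
    have e5 : ∑ l, (cf x p l a * frameRiem G E p l b c d
          + cf x p l b * frameRiem G E p a l c d + cf x p l c * frameRiem G E p a b l d
          + cf x p l d * frameRiem G E p a b c l)
        = ∑ l, (cf x p l a * frameRiem G E p l b c d + cf x p l b * frameRiem G E p a l c d)
          + ∑ l, (cf x p l c * frameRiem G E p a b l d + cf x p l d * frameRiem G E p a b c l) := by
      rw [← Finset.sum_add_distrib]
      exact Finset.sum_congr rfl fun l _ => by ring
    rw [e5]
    simp only [cf]
    ring
  rw [key, key, key]
  refine cyclic_contraction (E p) (Z := fun x => Y x) (fun x μ ν => ?_) e c d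
  have hsym : ∀ l α β, conn G α p l β = conn G β p l α := fun l α β =>
    christoffel_symm h.isOpen hp h.symm l α β
  have hanti : ∀ α β, frameForm G E a b p α β = -frameForm G E a b p β α := fun α β => by
    simp only [frameForm, Matrix.of_apply]; rw [curv_antisymm]; simp
  have hΓ : ∀ x α β, ((conn G x p)ᵀ * frameForm G E a b p + frameForm G E a b p * conn G x p) α β
      = ∑ l, (conn G x p l α * frameForm G E a b p l β - conn G x p l β * frameForm G E a b p l α) := by
    intro x α β
    rw [Matrix.add_apply, Matrix.mul_apply, Matrix.mul_apply, ← Finset.sum_add_distrib]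
    exact Finset.sum_congr rfl fun l _ => by rw [Matrix.transpose_apply, hanti α l]; ring
  have hYeq : ∀ x α β, Y x α β = (minkowskiM * (pdM x (curv cf α β) p + cf x p * curv cf α β p
      - curv cf α β p * cf x p)) a b
      - ∑ l, (conn G x p l α * frameForm G E a b p l β
        - conn G x p l β * frameForm G E a b p l α) := by
    intro x α β
    rw [← hΓ]
    have f1 : pdM x (frameForm G E a b) p α β = (minkowskiM * pdM x (curv cf α β) p) a b := by
      simp only [minkowskiM, Matrix.diagonal_mul, pdM_apply, frameForm, Matrix.of_apply]
      rw [pd_mul x (differentiableAt_const _) (smoothOn_diffAt h.isOpen hp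
        (smoothMat_curv h.isOpen h.smooth_frameConn α β a b)), pd_const]
      simp [cf]
    have f2 : (∑ l, (cf x p l a • frameForm G E l b p + cf x p l b • frameForm G E a l p)) α β
        = ((cf x p)ᵀ * (minkowskiM * curv cf α β p) + minkowskiM * curv cf α β p * cf x p) a b := by
      rw [Matrix.sum_apply, Matrix.add_apply, Matrix.mul_apply, Matrix.mul_apply,
        ← Finset.sum_add_distrib]
      refine Finset.sum_congr rfl fun l _ => ?_
      simp only [minkowskiM, Matrix.add_apply, Matrix.smul_apply, frameForm, Matrix.of_apply,
        smul_eq_mul, Matrix.transpose_apply, Matrix.diagonal_mul, cf]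
      ring
    have f3 : (cf x p)ᵀ * (minkowskiM * curv cf α β p) = -(minkowskiM * cf x p * curv cf α β p) := by
      rw [← Matrix.mul_assoc, eq_neg_of_add_eq_zero_left (h.frameConn_skew hp x), Matrix.neg_mul]
    simp only [Y]
    rw [Matrix.sub_apply, f2, f3, Matrix.sub_apply, Matrix.sub_apply, f1]
    simp only [Matrix.mul_sub, Matrix.mul_add, Matrix.add_apply, Matrix.sub_apply,
      Matrix.neg_apply, Matrix.mul_assoc]
    ring
  have hb : (minkowskiM * ((pdM x (curv cf μ ν) p + cf x p * curv cf μ ν p - curv cf μ ν p * cf x p)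
      + (pdM μ (curv cf ν x) p + cf μ p * curv cf ν x p - curv cf ν x p * cf μ p)
      + (pdM ν (curv cf x μ) p + cf ν p * curv cf x μ p - curv cf x μ p * cf ν p))) a b = 0 := by
    rw [bianchi h.isOpen hp h.smooth_frameConn x μ ν, Matrix.mul_zero, Matrix.zero_apply]
  rw [Matrix.mul_add, Matrix.mul_add, Matrix.add_apply, Matrix.add_apply] at hb
  rw [hYeq, hYeq, hYeq]
  -- In the cyclic sum the Christoffel terms cancel in pairs because the connection is torsion free.
  -- What is left is the Bianchi identity of the frame connection.
  have hz : ∑ l, (conn G x p l μ * frameForm G E a b p l ν - conn G x p l ν * frameForm G E a b p l μ)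
      + ∑ l, (conn G μ p l ν * frameForm G E a b p l x - conn G μ p l x * frameForm G E a b p l ν)
      + ∑ l, (conn G ν p l x * frameForm G E a b p l μ - conn G ν p l μ * frameForm G E a b p l x)
      = 0 := by
    rw [← Finset.sum_add_distrib, ← Finset.sum_add_distrib]
    refine Finset.sum_eq_zero fun l _ => ?_
    rw [hsym l μ x, hsym l ν x, hsym l ν μ]
    ring
  linear_combination hb - hz

lemma frameRiem_pair (hp : p ∈ U) (a b c d : Idx) :
    frameRiem G E p a b c d = frameRiem G E p c d a b := by
  rw [frameRiem, frameRiem, sum_comm_pairs]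
  refine Finset.sum_congr rfl fun ρ _ => Finset.sum_congr rfl fun σ _ => Finset.sum_congr rfl
    fun α _ => Finset.sum_congr rfl fun β _ => ?_
  rw [riemann_pair_symm h.isOpen hp h.smooth_metric h.symm
    (fun q hq => (h.det_metric_neg hq).ne) α β ρ σ]
  ring

omit h in
lemma frameRiem_anti_last (a b c d : Idx) :
    frameRiem G E p a b c d = -frameRiem G E p a b d c := by
  rw [frameRiem, frameRiem]
  simp only [← Finset.sum_neg_distrib]
  refine Finset.sum_congr rfl fun ρ _ => Finset.sum_congr rfl fun σ _ => ?_
  rw [Finset.sum_comm]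
  refine Finset.sum_congr rfl fun α _ => Finset.sum_congr rfl fun β _ => ?_
  rw [riemannDown_eq, riemannDown_eq, curv_antisymm, Matrix.mul_neg, Matrix.neg_apply]
  ring

lemma frameRiem_anti (hp : p ∈ U) (a b c d : Idx) :
    frameRiem G E p a b c d = -frameRiem G E p b a c d := by
  rw [h.frameRiem_pair hp, frameRiem_anti_last, h.frameRiem_pair hp c d b a]

/-- The frame components of the Ricci tensor. -/
lemma frame_ricci (hp : p ∈ U) (b d : Idx) :
    ∑ e, minkowski e * frameRiem G E p e b e d
      = ∑ β, ∑ σ, E p β d * E p σ b * ricci G σ β p := by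
  have h1 : ∀ e, minkowski e * frameRiem G E p e b e d
      = ∑ α, ∑ β, E p β d * (E p α e * curv (frameConn G E) α β p e b) := by
    intro e
    rw [h.frameRiem_eq hp, Matrix.mul_assoc, Matrix.mul_apply, Finset.mul_sum]
    refine Finset.sum_congr rfl fun α _ => ?_
    rw [Matrix.mul_apply, Finset.mul_sum, Finset.mul_sum]
    refine Finset.sum_congr rfl fun β _ => ?_
    simp only [frameForm, Matrix.of_apply, Matrix.transpose_apply]
    linear_combination (E p α e * curv (frameConn G E) α β p e b * E p β d) * minkowski_sq e
  simp only [h1]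
  calc _ = ∑ α, ∑ β, ∑ e, E p β d * (E p α e * curv (frameConn G E) α β p e b) := by
        rw [Finset.sum_comm]
        exact Finset.sum_congr rfl fun α _ => Finset.sum_comm
    _ = ∑ α, ∑ β, E p β d * ∑ σ, curv (conn G) α β p α σ * E p σ b := by
        refine Finset.sum_congr rfl fun α _ => Finset.sum_congr rfl fun β _ => ?_
        rw [← Finset.mul_sum, ← Matrix.mul_apply, ← Matrix.mul_apply, h.curv_frameConn hp]
    _ = ∑ β, ∑ α, E p β d * ∑ σ, curv (conn G) α β p α σ * E p σ b := Finset.sum_comm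
    _ = _ := by
        refine Finset.sum_congr rfl fun β _ => ?_
        simp only [ricci, riemannUp_eq, Finset.mul_sum]
        rw [Finset.sum_comm]
        exact Finset.sum_congr rfl fun σ _ => Finset.sum_congr rfl fun α _ => by ring

/-- The frame components of the deformation tensor of the first vector of the frame. -/
lemma frame_deformation (hp : p ∈ U) (a b : Idx) :
    ∑ μ, ∑ ν, E p μ a * E p ν b * lieDeriv (fun q l => E q l tIdx) G μ ν p
      = minkowski b * frameCoeff G E p a b tIdx + minkowski a * frameCoeff G E p b a tIdx := by
  let M : Matrix Idx Idx ℝ := Matrix.of fun l μ => (E p * frameConn G E μ p) l tIdx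
  have hM : M = covDeriv G (fun q l => E q l tIdx) p := by
    ext l μ
    simp only [M, covDeriv, Matrix.of_apply]
    rw [h.frame_mul_conn hp, Matrix.add_apply, Matrix.mul_apply, pdM_apply, add_comm]
  have hL : ∀ μ ν, lieDeriv (fun q l => E q l tIdx) G μ ν p = (Mᵀ * G p + G p * M) μ ν := by
    intro μ ν
    rw [hM]
    exact lieDeriv_eq h.isOpen hp h.symm (h.det_metric_neg hp).ne μ ν
  have hEM : ∀ c d, ((E p)ᵀ * (G p * M) * E p) c d = minkowski c * frameCoeff G E p d c tIdx := by
    intro c d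
    rw [← Matrix.mul_assoc, h.inv_frame hp, Matrix.mul_assoc, Matrix.mul_assoc, minkowskiM,
      Matrix.diagonal_mul]
    congr 1
    rw [← Matrix.mul_assoc, Matrix.mul_apply, frameCoeff]
    refine Finset.sum_congr rfl fun x _ => ?_
    have : ((E p)⁻¹ * M) c x = ((E p)⁻¹ * (E p * frameConn G E x p)) c tIdx := by
      simp only [Matrix.mul_apply (M := (E p)⁻¹)]
      rfl
    rw [this, ← Matrix.mul_assoc, Matrix.nonsing_inv_mul _
      (isUnit_iff_ne_zero.2 (h.det_frame hp)), Matrix.one_mul]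
    ring
  have hsum : ∑ μ, ∑ ν, E p μ a * E p ν b * lieDeriv (fun q l => E q l tIdx) G μ ν p
      = ((E p)ᵀ * (Mᵀ * G p + G p * M) * E p) a b := by
    rw [Matrix.mul_assoc, Matrix.mul_apply]
    refine Finset.sum_congr rfl fun μ _ => ?_
    rw [Matrix.mul_apply, Finset.mul_sum]
    exact Finset.sum_congr rfl fun ν _ => by rw [hL, Matrix.transpose_apply]; ring
  have htr : (E p)ᵀ * (Mᵀ * G p) * E p = ((E p)ᵀ * (G p * M) * E p)ᵀ := by
    simp only [Matrix.transpose_mul, Matrix.transpose_transpose, h.symm p hp, Matrix.mul_assoc]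
  rw [hsum, Matrix.mul_add, Matrix.add_mul, Matrix.add_apply, htr, Matrix.transpose_apply, hEM, hEM]

/-- In a frame adapted to the foliation the boosts are controlled by the deformation tensor. -/
lemma abs_boost_le (hp : p ∈ U) (hE0 : E p tIdx tIdx ≠ 0)
    (hEi : ∀ q ∈ U, ∀ i : Fin 3, E q tIdx (.inr i) = 0) {B : ℝ}
    (hB : ∀ a b, |∑ μ, ∑ ν, E p μ a * E p ν b * lieDeriv (fun q l => E q l tIdx) G μ ν p| ≤ B)
    (e : Idx) (i : Fin 3) : |frameCoeff G E p e tIdx (.inr i)| ≤ B := by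
  have hsk := h.frameCoeff_skew hp
  have h0 : ∀ e, frameCoeff G E p e tIdx tIdx = 0 := fun e => by
    have := hsk e tIdx tIdx
    simp [minkowski] at this
    linarith
  have hti : ∀ e (i : Fin 3), frameCoeff G E p e (.inr i) tIdx = frameCoeff G E p e tIdx (.inr i) :=
    fun e i => by
      have := hsk e tIdx (.inr i)
      simp [minkowski] at this
      linarith
  -- For `e` the time index the coefficient is the acceleration of the unit normal, which is the
  -- component `π(E_i, E_0)` because the normal has constant length.
  rcases e with ⟨⟩ | j
  · have := hB (.inr i) tIdx
    rw [h.frame_deformation hp, hti, h0] at this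
    simpa [minkowski] using this
  -- For spatial `e` the coefficient is the second fundamental form. It is symmetric since the
  -- spatial frame vectors have no time component, that is, since they are tangent to the leaves.
  -- Hence `π(E_j, E_i)` is twice this coefficient.
  · have hsym : frameCoeff G E p (.inr j) tIdx (.inr i) = frameCoeff G E p (.inr i) tIdx (.inr j) := by
      have key : ∀ k l : Fin 3, E p tIdx tIdx * frameCoeff G E p (.inr k) tIdx (.inr l)
          = ∑ μ, ∑ ν, E p μ (.inr k) * E p ν (.inr l) * conn G μ p tIdx ν := by
        intro k l
        rw [frameCoeff, Finset.mul_sum]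
        refine Finset.sum_congr rfl fun μ _ => ?_
        have h1 := congrFun (congrFun (h.frame_mul_conn hp μ) tIdx) (.inr l)
        rw [Matrix.mul_apply, Matrix.add_apply, pdM_apply,
          pd_congr_on μ h.isOpen hp (fun q hq => hEi q hq l), pd_const, add_zero,
          Matrix.mul_apply] at h1
        have h2 : ∑ j, E p tIdx j * frameConn G E μ p j (.inr l)
            = E p tIdx tIdx * frameConn G E μ p tIdx (.inr l) := by
          simp [Fintype.sum_sum_type, hEi p hp]
        rw [h2] at h1
        calc _ = E p μ (.inr k) * (E p tIdx tIdx * frameConn G E μ p tIdx (.inr l)) := by ring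
          _ = _ := by
            rw [h1, Finset.mul_sum]
            exact Finset.sum_congr rfl fun ν _ => by ring
      apply mul_left_cancel₀ hE0
      rw [key, key, Finset.sum_comm]
      refine Finset.sum_congr rfl fun μ _ => Finset.sum_congr rfl fun ν _ => ?_
      rw [conn_apply, conn_apply, christoffel_symm h.isOpen hp h.symm]
      ring
    have := hB (.inr j) (.inr i)
    rw [h.frame_deformation hp, hti, hti, ← hsym] at this
    simp only [minkowski, Sum.elim_inr, one_mul] at this
    rw [abs_le] at this ⊢
    constructor <;> linarith [this.1, this.2, (abs_nonneg _).trans (hB (.inr j) (.inr i))]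

end IsFrame

/-- Jacobi's formula for the derivative of a determinant. -/
lemma pd_det {A : Coord → Matrix Idx Idx ℝ} (hU : IsOpen U) (hp : p ∈ U) (hA : SmoothMat A U)
    (μ : Idx) : pd μ (fun q => (A q).det) p = ((A p).adjugate * pdM μ A p).trace := by
  have hd : ∀ i j, HasFDerivAt (fun q => A q i j) (fderiv ℝ (fun q => A q i j) p) p :=
    fun i j => (smoothOn_diffAt hU hp (hA i j)).hasFDerivAt
  have h1 : HasFDerivAt (fun q => (A q).det) (∑ σ : Equiv.Perm Idx, ((Equiv.Perm.sign σ : ℤ) : ℝ) •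
      ∑ i, (∏ j ∈ Finset.univ.erase i, A p (σ j) j) • fderiv ℝ (fun q => A q (σ i) i) p) p := by
    simp only [Matrix.det_apply']
    refine HasFDerivAt.fun_sum fun σ _ => HasFDerivAt.const_mul ?_ _
    exact HasFDerivAt.finsetProd fun i _ => hd (σ i) i
  have h2 : ((A p).adjugate * pdM μ A p).trace
      = ∑ i, ((A p).updateCol i fun k => pdM μ A p k i).det := by
    simp only [Matrix.trace, Matrix.diag]
    refine Finset.sum_congr rfl fun i _ => ?_
    rw [← Matrix.cramer_apply, Matrix.cramer_eq_adjugate_mulVec]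
    rfl
  rw [pd, h1.fderiv, h2]
  simp only [Matrix.det_apply', sum_apply, smul_apply,
    Finset.smul_sum, smul_eq_mul]
  rw [Finset.sum_comm]
  refine Finset.sum_congr rfl fun i _ => Finset.sum_congr rfl fun σ _ => ?_
  rw [← Finset.mul_prod_erase Finset.univ (fun j => ((A p).updateCol i fun k => pdM μ A p k i) (σ j) j)
    (Finset.mem_univ i), Matrix.updateCol_self]
  have : ∏ x ∈ Finset.univ.erase i, ((A p).updateCol i fun k => pdM μ A p k i) (σ x) x
      = ∏ x ∈ Finset.univ.erase i, A p (σ x) x :=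
    Finset.prod_congr rfl fun x hx => Matrix.updateCol_ne (Finset.ne_of_mem_erase hx)
  rw [this, pdM_apply, pd]
  ring

/-- The spacetime volume density. -/
def volDensity (G : Coord → Matrix Idx Idx ℝ) (q : Coord) : ℝ := Real.sqrt (-(G q).det)

/-- The energy current in coordinates. -/
def current (G E : Coord → Matrix Idx Idx ℝ) (μ : Idx) (q : Coord) : ℝ :=
  -(1 / 4) * sqNorm (frameRiem G E q) * E q μ tIdx
    + ∑ i : Fin 3, momentum (frameRiem G E q) (.inr i) * E q μ (.inr i)

/-! ### The divergence of the energy current. -/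

namespace IsFrame

variable (h : IsFrame G E U)
include h

lemma volDensity_pos (hp : p ∈ U) : 0 < volDensity G p :=
  Real.sqrt_pos.2 (by linarith [h.det_metric_neg hp])

lemma smooth_volDensity : ContDiffOn ℝ ∞ (volDensity G) U :=
  (smoothOn_det h.smooth_metric).neg.sqrt fun q hq => by
    have := h.det_metric_neg hq
    linarith

/-- Differentiating the square of the density avoids the root. Jacobi's formula gives the trace of
`G⁻¹ ∂_ν G`, in which the two remaining terms of the contracted Christoffel symbol cancel by
symmetry. -/
lemma pd_volDensity (hp : p ∈ U) (ν : Idx) :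
    pd ν (volDensity G) p = volDensity G p * ∑ μ, christoffel G μ μ ν p := by
  have hdet := h.det_metric_neg hp
  have hdd := smoothOn_diffAt h.isOpen hp (smoothOn_det h.smooth_metric)
  have hs : ∀ q ∈ U, volDensity G q * volDensity G q = -(G q).det := fun q hq =>
    Real.mul_self_sqrt (by linarith [h.det_metric_neg hq])
  have hvd := smoothOn_diffAt h.isOpen hp h.smooth_volDensity
  have h1 : pd ν (fun q => volDensity G q * volDensity G q) p = pd ν (fun q => -(G q).det) p :=
    pd_congr_on ν h.isOpen hp hs
  rw [pd_mul ν hvd hvd, pd_neg, pd_det h.isOpen hp h.smooth_metric] at h1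
  have hadj : (G p).adjugate = (G p).det • (G p)⁻¹ := by
    rw [Matrix.inv_def, smul_smul, Ring.inverse_eq_inv', mul_inv_cancel₀ hdet.ne, one_smul]
  have hGi : ∀ a b, (G p)⁻¹ a b = (G p)⁻¹ b a := fun a b => by
    have : ((G p)⁻¹)ᵀ = (G p)⁻¹ := by rw [Matrix.transpose_nonsing_inv, h.symm p hp]
    conv_lhs => rw [← this, Matrix.transpose_apply]
  have htr : ((G p)⁻¹ * pdM ν G p).trace = 2 * ∑ μ, christoffel G μ μ ν p := by
    simp only [christoffel, Finset.mul_sum, Matrix.trace, Matrix.diag, Matrix.mul_apply, pdM_apply]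
    have e : ∑ i, ∑ s, (G p)⁻¹ i s * pd i (fun q => G q s ν) p
        = ∑ i, ∑ s, (G p)⁻¹ i s * pd s (fun q => G q i ν) p := by
      rw [Finset.sum_comm]
      exact Finset.sum_congr rfl fun i _ => Finset.sum_congr rfl fun s _ => by rw [hGi]
    have e2 : ∀ i s, 2 * (1 / 2 * ((G p)⁻¹ i s * (pd i (fun q => G q s ν) p
        + pd ν (fun q => G q s i) p - pd s (fun q => G q i ν) p)))
        = (G p)⁻¹ i s * pd i (fun q => G q s ν) p + (G p)⁻¹ i s * pd ν (fun q => G q s i) p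
          - (G p)⁻¹ i s * pd s (fun q => G q i ν) p := fun i s => by ring
    simp only [e2, Finset.sum_sub_distrib, Finset.sum_add_distrib]
    rw [e]
    ring
  rw [hadj, Matrix.smul_mul, Matrix.trace_smul, smul_eq_mul, htr] at h1
  have hv := h.volDensity_pos hp
  apply mul_left_cancel₀ hv.ne'
  have := hs p hp
  linear_combination (1 / 2) * h1 - (∑ μ, christoffel G μ μ ν p) * this

/-- The divergence of a frame vector is a trace of connection coefficients. This splits the
divergence of the current into a part with derivatives of the curvature and a part with derivatives
of the frame. -/
lemma div_frame_vector (hp : p ∈ U) {f : Coord → ℝ} (hf : DifferentiableAt ℝ f p) (a : Idx) :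
    ∑ μ, pd μ (fun q => volDensity G q * (f q * E q μ a)) p
      = volDensity G p * (∑ μ, E p μ a * pd μ f p + f p * ∑ b, frameCoeff G E p b b a) := by
  have hvd := smoothOn_diffAt h.isOpen hp h.smooth_volDensity
  have hEd := fun μ => smoothOn_diffAt h.isOpen hp (h.smooth_frame μ a)
  have h1 : ∀ μ, pd μ (fun q => volDensity G q * (f q * E q μ a)) p
      = volDensity G p * (E p μ a * pd μ f p)
        + volDensity G p * f p * ((∑ l, christoffel G l l μ p) * E p μ a
          + pd μ (fun q => E q μ a) p) := by
    intro μ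
    rw [pd_mul μ hvd (hf.fun_mul (hEd μ)), pd_mul μ hf (hEd μ), h.pd_volDensity hp]
    ring
  simp only [h1, Finset.sum_add_distrib, ← Finset.mul_sum]
  have h2 : ∑ b, frameCoeff G E p b b a = ∑ μ, (E p * frameConn G E μ p) μ a := by
    simp only [frameCoeff, Matrix.mul_apply]
    exact Finset.sum_comm
  have h3 : ∑ μ, (∑ l, christoffel G l l μ p) * E p μ a
      = ∑ μ, ∑ l, christoffel G μ μ l p * E p l a := by
    simp only [Finset.sum_mul]
    exact Finset.sum_comm
  have h4 : ∑ μ, (E p * frameConn G E μ p) μ a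
      = ∑ μ, ∑ l, christoffel G μ μ l p * E p l a + ∑ μ, pd μ (fun q => E q μ a) p := by
    rw [← Finset.sum_add_distrib]
    refine Finset.sum_congr rfl fun μ _ => ?_
    rw [h.frame_mul_conn hp, Matrix.add_apply, Matrix.mul_apply, pdM_apply]
    rfl
  rw [h2, h3, h4]
  ring

lemma smooth_sqNorm : ContDiffOn ℝ ∞ (fun q => sqNorm (frameRiem G E q)) U :=
  ContDiffOn.sum fun a _ => ContDiffOn.sum fun b _ => ContDiffOn.sum fun c _ =>
    ContDiffOn.sum fun d _ => (h.smooth_frameRiem a b c d).pow 2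

lemma smooth_momentum (i : Idx) : ContDiffOn ℝ ∞ (fun q => momentum (frameRiem G E q) i) U :=
  ContDiffOn.sum fun b _ => ContDiffOn.sum fun c _ =>
    ContDiffOn.sum fun d _ => (h.smooth_frameRiem _ b c d).mul (h.smooth_frameRiem i b c d)

lemma smooth_current (μ : Idx) : ContDiffOn ℝ ∞ (current G E μ) U :=
  ((contDiffOn_const.mul h.smooth_sqNorm).mul (h.smooth_frame μ tIdx)).add
    (ContDiffOn.sum fun i _ => (h.smooth_momentum (.inr i)).mul (h.smooth_frame μ (.inr i)))

lemma frame_pd_sqNorm (hp : p ∈ U) :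
    ∑ μ, E p μ tIdx * pd μ (fun q => -(1 / 4) * sqNorm (frameRiem G E q)) p
      = -(1 / 2) * ∑ a, ∑ b, ∑ c, ∑ d, frameRiem G E p a b c d * frameDeriv G E p tIdx a b c d := by
  have hr := fun a b c d => smoothOn_diffAt h.isOpen hp (h.smooth_frameRiem a b c d)
  have h1 : ∀ μ, pd μ (fun q => -(1 / 4) * sqNorm (frameRiem G E q)) p
      = ∑ a, ∑ b, ∑ c, ∑ d, -(1 / 2) * (frameRiem G E p a b c d
        * pd μ (fun q => frameRiem G E q a b c d) p) := by
    intro μ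
    rw [pd_mul μ (differentiableAt_const _) (smoothOn_diffAt h.isOpen hp h.smooth_sqNorm), pd_const,
      zero_mul, zero_add]
    simp only [sqNorm]
    rw [pd_sum (F := fun a q => ∑ b, ∑ c, ∑ d, frameRiem G E q a b c d ^ 2) _ _ fun a _ =>
      DifferentiableAt.fun_sum fun b _ => DifferentiableAt.fun_sum fun c _ =>
        DifferentiableAt.fun_sum fun d _ => (hr a b c d).pow 2, Finset.mul_sum]
    refine Finset.sum_congr rfl fun a _ => ?_
    rw [pd_sum (F := fun b q => ∑ c, ∑ d, frameRiem G E q a b c d ^ 2) _ _ fun b _ =>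
      DifferentiableAt.fun_sum fun c _ =>
        DifferentiableAt.fun_sum fun d _ => (hr a b c d).pow 2, Finset.mul_sum]
    refine Finset.sum_congr rfl fun b _ => ?_
    rw [pd_sum (F := fun c q => ∑ d, frameRiem G E q a b c d ^ 2) _ _ fun c _ =>
        DifferentiableAt.fun_sum fun d _ => (hr a b c d).pow 2, Finset.mul_sum]
    refine Finset.sum_congr rfl fun c _ => ?_
    rw [pd_sum (F := fun d q => frameRiem G E q a b c d ^ 2) _ _ fun d _ => (hr a b c d).pow 2,
      Finset.mul_sum]
    refine Finset.sum_congr rfl fun d _ => ?_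
    simp only [pow_two]
    rw [pd_mul μ (hr a b c d) (hr a b c d)]
    ring
  simp only [h1, frameDeriv, Finset.mul_sum]
  rw [Finset.sum_comm]
  refine Finset.sum_congr rfl fun a _ => ?_
  rw [Finset.sum_comm]
  refine Finset.sum_congr rfl fun b _ => ?_
  rw [Finset.sum_comm]
  refine Finset.sum_congr rfl fun c _ => ?_
  rw [Finset.sum_comm]
  exact Finset.sum_congr rfl fun d _ => Finset.sum_congr rfl fun μ _ => by ring

lemma frame_pd_momentum (hp : p ∈ U) (i : Idx) :
    ∑ μ, E p μ i * pd μ (fun q => momentum (frameRiem G E q) i) p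
      = ∑ m, ∑ c, ∑ d, (frameDeriv G E p i tIdx m c d * frameRiem G E p i m c d
        + frameRiem G E p tIdx m c d * frameDeriv G E p i i m c d) := by
  have hr := fun a b c d => smoothOn_diffAt h.isOpen hp (h.smooth_frameRiem a b c d)
  have h1 : ∀ μ, pd μ (fun q => momentum (frameRiem G E q) i) p
      = ∑ m, ∑ c, ∑ d, (pd μ (fun q => frameRiem G E q tIdx m c d) p * frameRiem G E p i m c d
        + frameRiem G E p tIdx m c d * pd μ (fun q => frameRiem G E q i m c d) p) := by
    intro μ
    simp only [momentum]
    rw [pd_sum (F := fun m q => ∑ c, ∑ d, frameRiem G E q tIdx m c d * frameRiem G E q i m c d) _ _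
      fun m _ => DifferentiableAt.fun_sum fun c _ =>
        DifferentiableAt.fun_sum fun d _ => (hr _ m c d).mul (hr i m c d)]
    refine Finset.sum_congr rfl fun m _ => ?_
    rw [pd_sum (F := fun c q => ∑ d, frameRiem G E q tIdx m c d * frameRiem G E q i m c d) _ _
      fun c _ => DifferentiableAt.fun_sum fun d _ => (hr _ m c d).mul (hr i m c d)]
    refine Finset.sum_congr rfl fun c _ => ?_
    exact pd_sum_mul μ (fun d => hr _ m c d) (fun d => hr i m c d)
  simp only [h1, frameDeriv, Finset.mul_sum, Finset.sum_mul, ← Finset.sum_add_distrib]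
  rw [Finset.sum_comm]
  refine Finset.sum_congr rfl fun m _ => ?_
  rw [Finset.sum_comm]
  refine Finset.sum_congr rfl fun c _ => ?_
  rw [Finset.sum_comm]
  exact Finset.sum_congr rfl fun d _ => Finset.sum_congr rfl fun μ _ => by ring

lemma div_current (hp : p ∈ U) :
    ∑ μ, pd μ (fun q => volDensity G q * current G E μ q) p
      = volDensity G p * (divField (frameRiem G E p) (frameDeriv G E p)
        + divFrame (frameRiem G E p) (frameCoeff G E p)) := by
  have hvd := smoothOn_diffAt h.isOpen hp h.smooth_volDensity
  have hEd := fun μ a => smoothOn_diffAt h.isOpen hp (h.smooth_frame μ a)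
  have hsd : DifferentiableAt ℝ (fun q => -(1 / 4) * sqNorm (frameRiem G E q)) p :=
    (differentiableAt_const _).mul (smoothOn_diffAt h.isOpen hp h.smooth_sqNorm)
  have hmd := fun i => smoothOn_diffAt h.isOpen hp (h.smooth_momentum i)
  have h1 : ∀ μ, pd μ (fun q => volDensity G q * current G E μ q) p
      = pd μ (fun q => volDensity G q * (-(1 / 4) * sqNorm (frameRiem G E q) * E q μ tIdx)) p
        + ∑ i : Fin 3, pd μ (fun q => volDensity G q
          * (momentum (frameRiem G E q) (.inr i) * E q μ (.inr i))) p := by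
    intro μ
    have := pd_sum (p := p) Finset.univ (F := fun (i : Fin 3) q => volDensity G q
          * (momentum (frameRiem G E q) (.inr i) * E q μ (.inr i))) μ
          fun i _ => hvd.fun_mul ((hmd (.inr i)).fun_mul (hEd μ _))
    rw [← this, ← pd_add μ (hvd.fun_mul (hsd.fun_mul (hEd μ _))) (DifferentiableAt.fun_sum fun i _ =>
      hvd.fun_mul ((hmd (.inr i)).fun_mul (hEd μ _)))]
    simp only [current, mul_add, Finset.mul_sum]
  simp only [h1, Finset.sum_add_distrib]
  rw [Finset.sum_comm (f := fun μ (i : Fin 3) => pd μ (fun q => volDensity G q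
          * (momentum (frameRiem G E q) (.inr i) * E q μ (.inr i))) p)]
  rw [h.div_frame_vector hp hsd]
  have h2 : ∀ i : Fin 3, _ := fun i => h.div_frame_vector hp (hmd (.inr i)) (.inr i)
  simp only [h2, h.frame_pd_sqNorm hp, h.frame_pd_momentum hp, divField, divFrame,
    ← Finset.mul_sum, Finset.sum_add_distrib]
  ring

/-- The energy current of a vacuum curvature tensor is conserved up to the deformation tensor. -/
lemma abs_div_current_le (hp : p ∈ U) (hric : ∀ q ∈ U, ∀ μ ν, ricci G μ ν q = 0)
    (hE0 : E p tIdx tIdx ≠ 0) (hEi : ∀ q ∈ U, ∀ i : Fin 3, E q tIdx (.inr i) = 0) {B : ℝ}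
    (hB : ∀ a b, |∑ μ, ∑ ν, E p μ a * E p ν b * lieDeriv (fun q l => E q l tIdx) G μ ν p| ≤ B) :
    |∑ μ, pd μ (fun q => volDensity G q * current G E μ q) p|
      ≤ volDensity G p * (9000 * B * sqNorm (frameRiem G E p)) := by
  rw [h.div_current hp, abs_mul, abs_of_pos (h.volDensity_pos hp)]
  refine mul_le_mul_of_nonneg_left ?_ (h.volDensity_pos hp).le
  have hricf : ∀ q ∈ U, ∀ b d, ∑ e, minkowski e * frameRiem G E q e b e d = 0 := fun q hq b d => by
    rw [h.frame_ricci hq]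
    exact Finset.sum_eq_zero fun β _ => Finset.sum_eq_zero fun σ _ => by rw [hric q hq, mul_zero]
  refine abs_div_le (h.frameCoeff_skew hp) (h.abs_boost_le hp hE0 hEi hB)
    (h.frameRiem_anti hp) (h.frameRiem_pair hp) ?_ ?_ (hricf p hp) ?_ (h.frame_bianchi hp)
  · intro e a b c d
    simp only [frameDeriv, ← Finset.sum_neg_distrib, ← mul_neg, ← pd_neg]
    exact Finset.sum_congr rfl fun x _ => by
      rw [pd_congr_on x h.isOpen hp fun q hq => h.frameRiem_anti hq a b c d]
  · intro e a b c d
    simp only [frameDeriv]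
    exact Finset.sum_congr rfl fun x _ => by
      rw [pd_congr_on x h.isOpen hp fun q hq => h.frameRiem_pair hq a b c d]
  -- The trace vanishes identically on the open set, so its derivative vanishes too.
  · intro x b d
    have hr := fun a b c d => smoothOn_diffAt h.isOpen hp (h.smooth_frameRiem a b c d)
    have h1 : ∀ y, ∑ e, minkowski e * pd y (fun q => frameRiem G E q e b e d) p = 0 := by
      intro y
      have := pd_congr_on y h.isOpen hp fun q hq => hricf q hq b d
      rw [pd_const, pd_sum_mul y (F := fun e _ => minkowski e)
        (fun e => differentiableAt_const _) (fun e => hr e b e d)] at this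
      simpa [pd_const] using this
    simp only [frameDeriv, Finset.mul_sum]
    rw [Finset.sum_comm]
    refine Finset.sum_eq_zero fun y _ => ?_
    have := congrArg (fun z => E p y x * z) (h1 y)
    simp only [mul_zero, Finset.mul_sum] at this
    rw [← this]
    exact Finset.sum_congr rfl fun e _ => by ring

end IsFrame

end Frame

/-! ### Contractions of covariant tensors -/

section Contractions

variable {k : ℕ}

/-- The components of a covariant tensor in the frame given by the columns of `M`. -/
def contract (M : Matrix Idx Idx ℝ) (A : (Fin k → Idx) → ℝ) (κ : Fin k → Idx) : ℝ :=
  ∑ a : Fin k → Idx, (∏ i, M (a i) (κ i)) * A a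

/-- The contraction of two covariant tensors with a contravariant metric `K`. -/
def tensorInner (K : Matrix Idx Idx ℝ) (A B : (Fin k → Idx) → ℝ) : ℝ :=
  ∑ a : Fin k → Idx, ∑ b : Fin k → Idx, (∏ i, K (a i) (b i)) * A a * B b

lemma prod_mul_apply (M N : Matrix Idx Idx ℝ) (a κ : Fin k → Idx) :
    ∏ i, (M * N) (a i) (κ i) = ∑ b : Fin k → Idx, ∏ i, (M (a i) (b i) * N (b i) (κ i)) := by
  simp only [Matrix.mul_apply]
  rw [Finset.prod_univ_sum, Fintype.piFinset_univ]

lemma contract_contract (M N : Matrix Idx Idx ℝ) (A : (Fin k → Idx) → ℝ) :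
    contract N (contract M A) = contract (M * N) A := by
  funext κ
  simp only [contract, prod_mul_apply, Finset.mul_sum, Finset.sum_mul]
  rw [Finset.sum_comm]
  refine Finset.sum_congr rfl fun a _ => Finset.sum_congr rfl fun b _ => ?_
  rw [Finset.prod_mul_distrib]
  ring

lemma tensorInner_mul_transpose (M : Matrix Idx Idx ℝ) (A B : (Fin k → Idx) → ℝ) :
    tensorInner (M * Mᵀ) A B = ∑ κ, contract M A κ * contract M B κ := by
  simp only [tensorInner, contract, prod_mul_apply, Finset.mul_sum, Finset.sum_mul]
  calc _ = ∑ a : Fin k → Idx, ∑ κ : Fin k → Idx, ∑ b : Fin k → Idx,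
        (∏ i, (M (a i) (κ i) * Mᵀ (κ i) (b i))) * A a * B b :=
          Finset.sum_congr rfl fun a _ => Finset.sum_comm
    _ = ∑ κ : Fin k → Idx, ∑ a : Fin k → Idx, ∑ b : Fin k → Idx,
        (∏ i, (M (a i) (κ i) * Mᵀ (κ i) (b i))) * A a * B b := Finset.sum_comm
    _ = ∑ κ : Fin k → Idx, ∑ b : Fin k → Idx, ∑ a : Fin k → Idx,
        (∏ i, (M (a i) (κ i) * Mᵀ (κ i) (b i))) * A a * B b :=
          Finset.sum_congr rfl fun a _ => Finset.sum_comm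
    _ = _ := by
      refine Finset.sum_congr rfl fun κ _ => Finset.sum_congr rfl fun b _ =>
        Finset.sum_congr rfl fun a _ => ?_
      rw [Finset.prod_mul_distrib]
      simp only [Matrix.transpose_apply]
      ring

/-- Whatever can be written through `M * Mᵀ` is therefore independent of the choice of orthonormal
frame. -/
lemma inv_eq_of_ortho {h M : Matrix Idx Idx ℝ} (hM : Mᵀ * h * M = 1) : h⁻¹ = M * Mᵀ := by
  have h1 : M * (Mᵀ * h) = 1 := mul_eq_one_comm.1 hM
  exact Matrix.inv_eq_left_inv (by rw [Matrix.mul_assoc, h1])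

lemma tensorNorm_eq {h M : Matrix Idx Idx ℝ} (hM : Mᵀ * h * M = 1) (A : (Fin k → Idx) → ℝ) :
    tensorNorm h A = Real.sqrt (∑ κ, contract M A κ ^ 2) := by
  have : tensorNorm h A = Real.sqrt (tensorInner (M * Mᵀ) A A) := by
    rw [← inv_eq_of_ortho hM]
    rfl
  rw [this, tensorInner_mul_transpose]
  simp only [pow_two]

lemma tensorNorm_sq {h M : Matrix Idx Idx ℝ} (hM : Mᵀ * h * M = 1) (A : (Fin k → Idx) → ℝ) :
    tensorNorm h A ^ 2 = ∑ κ, contract M A κ ^ 2 := by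
  rw [tensorNorm_eq hM, Real.sq_sqrt (Finset.sum_nonneg fun _ _ => sq_nonneg _)]

lemma abs_contract_le {h M : Matrix Idx Idx ℝ} (hM : Mᵀ * h * M = 1) (A : (Fin k → Idx) → ℝ)
    (κ : Fin k → Idx) : |contract M A κ| ≤ tensorNorm h A := by
  rw [tensorNorm_eq hM]
  apply Real.abs_le_sqrt
  exact Finset.single_le_sum (f := fun κ => contract M A κ ^ 2) (fun _ _ => sq_nonneg _)
    (Finset.mem_univ κ)

/-- Norms of tensors do not depend on the coordinates. -/
lemma tensorNorm_pull {h h' J M : Matrix Idx Idx ℝ} (hh : h' = Jᵀ * h * J) (hM : Mᵀ * h' * M = 1)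
    (A : (Fin k → Idx) → ℝ) : tensorNorm h' (contract J A) = tensorNorm h A := by
  have hJM : (J * M)ᵀ * h * (J * M) = 1 := by
    rw [← hM, hh, Matrix.transpose_mul]
    simp only [Matrix.mul_assoc]
  rw [tensorNorm_eq hM, tensorNorm_eq hJM, contract_contract]

lemma sum_fin_succ_fun (f : (Fin (k + 1) → Idx) → ℝ) :
    ∑ a, f a = ∑ x, ∑ a : Fin k → Idx, f (Fin.cons x a) := by
  rw [← Fintype.sum_prod_type' (f := fun x (a : Fin k → Idx) => f (Fin.cons x a))]
  exact (Fintype.sum_equiv (Fin.consEquiv fun _ => Idx) _ _ fun _ => rfl).symm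

lemma sum_fin_zero_fun (f : (Fin 0 → Idx) → ℝ) : ∑ a, f a = f ![] := by
  rw [Fintype.sum_unique]
  congr 1

lemma sum_fin_two_fun (f : (Fin 2 → Idx) → ℝ) : ∑ a, f a = ∑ x, ∑ y, f ![x, y] := by
  simp only [sum_fin_succ_fun, sum_fin_zero_fun]
  rfl

lemma sum_fin_four_fun (f : (Fin 4 → Idx) → ℝ) :
    ∑ a, f a = ∑ x, ∑ y, ∑ z, ∑ w, f ![x, y, z, w] := by
  simp only [sum_fin_succ_fun, sum_fin_zero_fun]
  rfl

lemma contract_two (M : Matrix Idx Idx ℝ) (A : (Fin 2 → Idx) → ℝ) (a b : Idx) :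
    contract M A ![a, b] = ∑ μ, ∑ ν, M μ a * M ν b * A ![μ, ν] := by
  rw [contract, sum_fin_two_fun]
  simp [Fin.prod_univ_two]

lemma contract_four (M : Matrix Idx Idx ℝ) (A : (Fin 4 → Idx) → ℝ) (a b c d : Idx) :
    contract M A ![a, b, c, d]
      = ∑ ρ, ∑ σ, ∑ α, ∑ β, M ρ a * M σ b * M α c * M β d * A ![ρ, σ, α, β] := by
  rw [contract, sum_fin_four_fun]
  simp [Fin.prod_univ_four]

/-- The curvature tensor as a function of a multi-index. -/
def riem (G : Coord → Matrix Idx Idx ℝ) (p : Coord) (a : Fin 4 → Idx) : ℝ :=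
  riemannDown G (a 0) (a 1) (a 2) (a 3) p

/-- A symmetric two-tensor as a function of a multi-index. -/
def lie (X : Coord → Idx → ℝ) (G : Coord → Matrix Idx Idx ℝ) (p : Coord) (a : Fin 2 → Idx) : ℝ :=
  lieDeriv X G (a 0) (a 1) p

lemma frameRiem_eq_contract (G E : Coord → Matrix Idx Idx ℝ) (p : Coord) (a b c d : Idx) :
    frameRiem G E p a b c d = contract (E p) (riem G p) ![a, b, c, d] := by
  rw [contract_four]
  rfl

lemma tensorNorm_riem_sq {G E : Coord → Matrix Idx Idx ℝ} {p : Coord} {h : Matrix Idx Idx ℝ}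
    (hE : (E p)ᵀ * h * E p = 1) : tensorNorm h (riem G p) ^ 2 = sqNorm (frameRiem G E p) := by
  rw [tensorNorm_sq hE, sum_fin_four_fun]
  simp only [sqNorm, frameRiem_eq_contract]

/-- The pairing of the momentum of a four-tensor with a covector, in a frame. -/
def momentumPairing (M : Matrix Idx Idx ℝ) (A : (Fin 4 → Idx) → ℝ) (w : Idx → ℝ) : ℝ :=
  ∑ i, momentum (fun a b c d => contract M A ![a, b, c, d]) i * ∑ ρ, w ρ * M ρ i

/-- Here the frame enters only through `M * Mᵀ` and its time column. Two orthonormal frames with the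
same normal thus give the same pairing. -/
lemma momentumPairing_eq (M : Matrix Idx Idx ℝ) (A : (Fin 4 → Idx) → ℝ) (w : Idx → ℝ) :
    momentumPairing M A w = tensorInner (M * Mᵀ) A
      fun a => w (a 0) * ∑ κ, M κ tIdx * A ![κ, a 1, a 2, a 3] := by
  rw [tensorInner_mul_transpose, sum_fin_four_fun, momentumPairing]
  refine Finset.sum_congr rfl fun i _ => ?_
  simp only [momentum, Finset.sum_mul]
  refine Finset.sum_congr rfl fun m _ => Finset.sum_congr rfl fun c _ =>
    Finset.sum_congr rfl fun d _ => ?_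
  have h : contract M (fun a => w (a 0) * ∑ κ, M κ tIdx * A ![κ, a 1, a 2, a 3]) ![i, m, c, d]
      = (∑ ρ, w ρ * M ρ i) * contract M A ![tIdx, m, c, d] := by
    rw [contract_four, contract_four, Finset.sum_mul]
    refine Finset.sum_congr rfl fun ρ _ => ?_
    simp only [Matrix.cons_val_zero, Matrix.cons_val_one, Matrix.cons_val, Finset.mul_sum]
    calc _ = ∑ σ, ∑ κ, ∑ α, ∑ β, M ρ i * M σ m * M α c * M β d
          * (w ρ * (M κ tIdx * A ![κ, σ, α, β])) := by
            refine Finset.sum_congr rfl fun σ _ => ?_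
            calc _ = ∑ α, ∑ κ, ∑ β, M ρ i * M σ m * M α c * M β d
                * (w ρ * (M κ tIdx * A ![κ, σ, α, β])) :=
                  Finset.sum_congr rfl fun α _ => Finset.sum_comm
              _ = _ := Finset.sum_comm
      _ = ∑ κ, ∑ σ, ∑ α, ∑ β, M ρ i * M σ m * M α c * M β d
          * (w ρ * (M κ tIdx * A ![κ, σ, α, β])) := Finset.sum_comm
      _ = _ := by
        refine Finset.sum_congr rfl fun κ _ => Finset.sum_congr rfl fun σ _ =>
          Finset.sum_congr rfl fun α _ => Finset.sum_congr rfl fun β _ => ?_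
        ring
  rw [h]
  ring

/-- The momentum pairing does not depend on the orthonormal frame. -/
lemma momentumPairing_congr {h M N : Matrix Idx Idx ℝ} (hM : Mᵀ * h * M = 1)
    (hN : Nᵀ * h * N = 1) (h0 : ∀ κ, M κ tIdx = N κ tIdx) (A : (Fin 4 → Idx) → ℝ) (w : Idx → ℝ) :
    momentumPairing M A w = momentumPairing N A w := by
  rw [momentumPairing_eq, momentumPairing_eq, ← inv_eq_of_ortho hM, ← inv_eq_of_ortho hN]
  simp only [h0]

/-- The momentum pairing does not depend on the coordinates. -/
lemma momentumPairing_pull (J M : Matrix Idx Idx ℝ) (A : (Fin 4 → Idx) → ℝ) (w : Idx → ℝ) :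
    momentumPairing M (contract J A) (fun ρ => ∑ σ, J σ ρ * w σ)
      = momentumPairing (J * M) A w := by
  simp only [momentumPairing, contract_contract]
  refine Finset.sum_congr rfl fun i _ => ?_
  congr 1
  simp only [Matrix.mul_apply, Finset.sum_mul, Finset.mul_sum]
  rw [Finset.sum_comm]
  exact Finset.sum_congr rfl fun σ _ => Finset.sum_congr rfl fun ρ _ => by ring

end Contractions

/-! ### Orthonormal frames for metrics on a three-dimensional space -/

section GramSchmidt

/-- Orthogonal vectors, as columns, obtained by the Gram-Schmidt process without normalization. -/
def orthoVec (g : Matrix (Fin 3) (Fin 3) ℝ) : Matrix (Fin 3) (Fin 3) ℝ :=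
  !![1, -g 0 1, g 0 1 * g 1 2 - g 0 2 * g 1 1;
     0, g 0 0, g 0 1 * g 0 2 - g 0 0 * g 1 2;
     0, 0, g 0 0 * g 1 1 - g 0 1 * g 0 1]

/-- The squared lengths of the columns of `orthoVec`. -/
def orthoLen (g : Matrix (Fin 3) (Fin 3) ℝ) : Fin 3 → ℝ :=
  ![g 0 0, g 0 0 * (g 0 0 * g 1 1 - g 0 1 * g 0 1),
    (g 0 0 * g 1 1 * g 2 2 + 2 * g 0 1 * g 1 2 * g 0 2 - g 0 0 * g 1 2 ^ 2 - g 1 1 * g 0 2 ^ 2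
      - g 2 2 * g 0 1 ^ 2) * (g 0 0 * g 1 1 - g 0 1 * g 0 1)]

/-- An orthonormal frame, as columns. -/
def orthoFrame (g : Matrix (Fin 3) (Fin 3) ℝ) : Matrix (Fin 3) (Fin 3) ℝ :=
  Matrix.of fun i j => orthoVec g i j * (Real.sqrt (orthoLen g j))⁻¹

variable {g : Matrix (Fin 3) (Fin 3) ℝ}

/-- Without divisions the process has polynomial entries, so orthogonality is a polynomial identity.
Smoothness of the normalized frame then only requires positive lengths. -/
lemma orthoVec_mul (hs : gᵀ = g) : (orthoVec g)ᵀ * g * orthoVec g = Matrix.diagonal (orthoLen g) := by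
  have h10 : g 1 0 = g 0 1 := by conv_lhs => rw [← hs, Matrix.transpose_apply]
  have h20 : g 2 0 = g 0 2 := by conv_lhs => rw [← hs, Matrix.transpose_apply]
  have h21 : g 2 1 = g 1 2 := by conv_lhs => rw [← hs, Matrix.transpose_apply]
  ext i j
  fin_cases i <;> fin_cases j <;>
  · simp [orthoVec, orthoLen, Matrix.mul_apply, Fin.sum_univ_three, h10, h20, h21]
    try ring

/-- The diagonal entry of each column is the preceding leading minor. Its positivity makes the
column nonzero, hence of positive length, which in turn gives the next minor. -/
lemma orthoLen_pos (hs : gᵀ = g) (hpos : ∀ v : Fin 3 → ℝ, v ≠ 0 → 0 < v ⬝ᵥ g *ᵥ v) (j : Fin 3) :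
    0 < orthoLen g j := by
  have key : ∀ j, orthoVec g j j ≠ 0 → 0 < orthoLen g j := by
    intro j hj
    have h1 := hpos (fun i => orthoVec g i j) fun h0 => hj (congrFun h0 j)
    have h2 := congrFun (congrFun (orthoVec_mul hs) j) j
    rw [Matrix.diagonal_apply_eq] at h2
    rw [← h2, Matrix.mul_assoc]
    exact h1
  have h0 : 0 < orthoLen g 0 := key 0 (by simp [orthoVec])
  have h00 : 0 < g 0 0 := by simpa [orthoLen] using h0
  have h1 : 0 < orthoLen g 1 := key 1 (by simpa [orthoVec] using h00.ne')
  have h11 : 0 < g 0 0 * g 1 1 - g 0 1 * g 0 1 := by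
    have : 0 < g 0 0 * (g 0 0 * g 1 1 - g 0 1 * g 0 1) := by simpa [orthoLen] using h1
    exact (mul_pos_iff_of_pos_left h00).1 this
  have h2 : 0 < orthoLen g 2 := key 2 (by simpa [orthoVec] using h11.ne')
  fin_cases j
  · exact h0
  · exact h1
  · exact h2

lemma orthoFrame_ortho (hs : gᵀ = g) (hpos : ∀ v : Fin 3 → ℝ, v ≠ 0 → 0 < v ⬝ᵥ g *ᵥ v) :
    (orthoFrame g)ᵀ * g * orthoFrame g = 1 := by
  have h1 : orthoFrame g = orthoVec g * Matrix.diagonal fun j => (Real.sqrt (orthoLen g j))⁻¹ := by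
    ext i j
    simp [orthoFrame]
  have h2 : (orthoFrame g)ᵀ * g * orthoFrame g
      = (Matrix.diagonal fun j => (Real.sqrt (orthoLen g j))⁻¹)
        * ((orthoVec g)ᵀ * g * orthoVec g)
        * Matrix.diagonal fun j => (Real.sqrt (orthoLen g j))⁻¹ := by
    rw [h1, Matrix.transpose_mul, Matrix.diagonal_transpose]
    simp only [Matrix.mul_assoc]
  rw [h2, orthoVec_mul hs, Matrix.diagonal_mul_diagonal, Matrix.diagonal_mul_diagonal,
    ← Matrix.diagonal_one]
  congr 1
  funext j
  have hp := orthoLen_pos hs hpos j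
  have := Real.mul_self_sqrt hp.le
  have hne := (Real.sqrt_pos.2 hp).ne'
  field_simp
  linarith

lemma smooth_orthoFrame {U : Set Coord} {g : Coord → Matrix (Fin 3) (Fin 3) ℝ}
    (hg : ∀ i j, ContDiffOn ℝ ∞ (fun q => g q i j) U) (hs : ∀ q ∈ U, (g q)ᵀ = g q)
    (hpos : ∀ q ∈ U, ∀ v : Fin 3 → ℝ, v ≠ 0 → 0 < v ⬝ᵥ g q *ᵥ v) (i j : Fin 3) :
    ContDiffOn ℝ ∞ (fun q => orthoFrame (g q) i j) U := by
  have h1 : ContDiffOn ℝ ∞ (fun q => orthoVec (g q) i j) U := by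
    fin_cases i <;> fin_cases j <;> simp [orthoVec] <;> fun_prop
  have h2 : ContDiffOn ℝ ∞ (fun q => orthoLen (g q) j) U := by
    fin_cases j <;> simp [orthoLen] <;> fun_prop
  exact h1.mul ((h2.sqrt fun q hq => (orthoLen_pos (hs q hq) (hpos q hq) j).ne').inv
    fun q hq => (Real.sqrt_pos.2 (orthoLen_pos (hs q hq) (hpos q hq) j)).ne')

end GramSchmidt

/-! ### Charts of the leaves -/

section Charts

variable {S : Type*} [TopologicalSpace S] [ChartedSpace E3 S]

/-- The derivative of the inverse of a chart, as a map between the model spaces. -/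
def symmDeriv (c : OpenPartialHomeomorph S E3) (y : E3) : E3 →L[ℝ] E3 :=
  mfderiv 𝓘(ℝ, E3) 𝓘(ℝ, E3) c.symm y

/-- A field of bilinear forms, as a map into the bilinear forms on the model space. -/
def bil (g : BilinField S) (x : S) : E3 →L[ℝ] E3 →L[ℝ] ℝ := g x

lemma gram_eq (g : BilinField S) (c : OpenPartialHomeomorph S E3) (y : E3) (i j : Fin 3) :
    gram g c y i j = bil g (c.symm y) (symmDeriv c y (EuclideanSpace.single i 1))
      (symmDeriv c y (EuclideanSpace.single j 1)) := rfl

lemma sum_single (v : E3) : ∑ i, v i • EuclideanSpace.single i (1 : ℝ) = v := by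
  ext j
  simp [Pi.single_apply]

/-- Exhibits the matrix as the pullback of a bilinear form, from which positivity and behaviour
under coordinate changes are read off. -/
lemma gram_quad (g : BilinField S) (c : OpenPartialHomeomorph S E3) (y : E3) (v : E3) :
    (v : Fin 3 → ℝ) ⬝ᵥ gram g c y *ᵥ (v : Fin 3 → ℝ)
      = bil g (c.symm y) (symmDeriv c y v) (symmDeriv c y v) := by
  have hv : symmDeriv c y v = ∑ i, v i • symmDeriv c y (EuclideanSpace.single i 1) := by
    conv_lhs => rw [← sum_single v]
    simp only [map_sum, map_smul]
  rw [hv]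
  simp only [map_sum, map_smul, sum_apply, smul_apply,
    dotProduct, Matrix.mulVec, gram_eq, smul_eq_mul, Finset.mul_sum]
  rw [Finset.sum_comm]
  refine Finset.sum_congr rfl fun i _ => Finset.sum_congr rfl fun j _ => ?_
  ring

/-- The coordinate change between two charts. -/
def trans (c c' : OpenPartialHomeomorph S E3) (y : E3) : E3 := c' (c.symm y)

/-- The Jacobian matrix of a coordinate change. -/
def transJac (c c' : OpenPartialHomeomorph S E3) (y : E3) : Matrix (Fin 3) (Fin 3) ℝ :=
  Matrix.of fun k i => fderiv ℝ (trans c c') y (EuclideanSpace.single i 1) k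

/-- The domain of a coordinate change. -/
def transDom (c c' : OpenPartialHomeomorph S E3) : Set E3 := c.target ∩ c.symm ⁻¹' c'.source

variable {c c' : OpenPartialHomeomorph S E3} {y : E3}

lemma isOpen_transDom : IsOpen (transDom c c') :=
  c.symm.isOpen_inter_preimage c'.open_source

lemma trans_mem (hy : y ∈ transDom c c') : trans c c' y ∈ c'.target := c'.map_source hy.2

lemma symm_trans (hy : y ∈ transDom c c') : c'.symm (trans c c' y) = c.symm y :=
  c'.left_inv hy.2

variable [IsManifold 𝓘(ℝ, E3) ∞ S]

lemma mdifferentiable_of_mem_maximalAtlas (hc : c ∈ IsManifold.maximalAtlas 𝓘(ℝ, E3) ∞ S) :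
    c.MDifferentiable 𝓘(ℝ, E3) 𝓘(ℝ, E3) :=
  ⟨(contMDiffOn_of_mem_maximalAtlas hc).mdifferentiableOn (by simp),
    (contMDiffOn_symm_of_mem_maximalAtlas hc).mdifferentiableOn (by simp)⟩

lemma symmDeriv_injective (hc : c ∈ IsManifold.maximalAtlas 𝓘(ℝ, E3) ∞ S) (hy : y ∈ c.target) :
    Function.Injective (symmDeriv c y) := by
  have h := (mdifferentiable_of_mem_maximalAtlas hc).comp_symm_deriv hy
  intro v w hvw
  have h1 : ∀ u : E3, (mfderiv 𝓘(ℝ, E3) 𝓘(ℝ, E3) c (c.symm y) : E3 →L[ℝ] E3) (symmDeriv c y u) = u :=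
    fun u => DFunLike.congr_fun h u
  rw [← h1 v, ← h1 w, hvw]

lemma smooth_trans (hc : c ∈ IsManifold.maximalAtlas 𝓘(ℝ, E3) ∞ S)
    (hc' : c' ∈ IsManifold.maximalAtlas 𝓘(ℝ, E3) ∞ S) :
    ContDiffOn ℝ ∞ (trans c c') (transDom c c') := by
  rw [← contMDiffOn_iff_contDiffOn]
  exact (contMDiffOn_of_mem_maximalAtlas hc').comp
    ((contMDiffOn_symm_of_mem_maximalAtlas hc).mono Set.inter_subset_left) fun y hy => hy.2

/-- The chain rule for `c.symm = c'.symm ∘ trans c c'`, valid near `y`. -/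
lemma symmDeriv_trans (hc : c ∈ IsManifold.maximalAtlas 𝓘(ℝ, E3) ∞ S)
    (hc' : c' ∈ IsManifold.maximalAtlas 𝓘(ℝ, E3) ∞ S) (hy : y ∈ transDom c c') :
    symmDeriv c y = (symmDeriv c' (trans c c' y)).comp (fderiv ℝ (trans c c') y) := by
  have h1 : (c.symm : E3 → S) =ᶠ[𝓝 y] c'.symm ∘ trans c c' :=
    Filter.eventually_of_mem (isOpen_transDom.mem_nhds hy) fun z hz => (symm_trans hz).symm
  have hd : DifferentiableAt ℝ (trans c c') y :=
    ((smooth_trans hc hc').contDiffAt (isOpen_transDom.mem_nhds hy)).differentiableAt (by simp)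
  have hd' : MDifferentiableAt 𝓘(ℝ, E3) 𝓘(ℝ, E3) c'.symm (trans c c' y) :=
    (mdifferentiable_of_mem_maximalAtlas hc').mdifferentiableAt_symm (trans_mem hy)
  have h2 := mfderiv_comp y hd' hd.mdifferentiableAt
  rw [mfderiv_eq_fderiv] at h2
  have h3 := h1.mfderiv_eq (I := 𝓘(ℝ, E3)) (I' := 𝓘(ℝ, E3))
  ext1 v
  have h4 : (mfderiv 𝓘(ℝ, E3) 𝓘(ℝ, E3) c.symm y : E3 →L[ℝ] E3)
    = (mfderiv 𝓘(ℝ, E3) 𝓘(ℝ, E3) (c'.symm ∘ trans c c') y : E3 →L[ℝ] E3) := h3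
  rw [symmDeriv, h4]
  exact DFunLike.congr_fun h2 v

/-- The transformation law of the components of a bilinear form. -/
lemma gram_trans (hc : c ∈ IsManifold.maximalAtlas 𝓘(ℝ, E3) ∞ S)
    (hc' : c' ∈ IsManifold.maximalAtlas 𝓘(ℝ, E3) ∞ S) (g : BilinField S)
    (hy : y ∈ transDom c c') :
    gram g c y = (transJac c c' y)ᵀ * gram g c' (trans c c' y) * transJac c c' y := by
  have h1 : ∀ i, symmDeriv c y (EuclideanSpace.single i 1)
      = ∑ k, transJac c c' y k i • symmDeriv c' (trans c c' y) (EuclideanSpace.single k 1) := by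
    intro i
    rw [symmDeriv_trans hc hc' hy, ContinuousLinearMap.comp_apply,
      ← sum_single (fderiv ℝ (trans c c') y (EuclideanSpace.single i 1))]
    simp only [map_sum, map_smul]
    rfl
  ext i j
  rw [gram_eq, h1, h1, Matrix.mul_assoc, Matrix.mul_apply]
  simp only [map_sum, map_smul, sum_apply, smul_apply,
    smul_eq_mul, Matrix.mul_apply, Finset.mul_sum, gram_eq, symm_trans hy, Matrix.transpose_apply]
  rw [Finset.sum_comm]
  exact Finset.sum_congr rfl fun k _ => Finset.sum_congr rfl fun l _ => by ring

/-- The coordinate change of spacetime induced by a coordinate change of the leaves. -/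
def spacetimeTrans (c c' : OpenPartialHomeomorph S E3) (p : Coord) : Coord :=
  (p.1, trans c c' p.2)

lemma jac_spacetimeTrans {p : Coord} (hd : DifferentiableAt ℝ (trans c c') p.2) :
    jac (spacetimeTrans c c') p = Matrix.fromBlocks 1 0 0 (transJac c c' p.2) := by
  have h : HasFDerivAt (spacetimeTrans c c')
      ((ContinuousLinearMap.id ℝ ℝ).prodMap (fderiv ℝ (trans c c') p.2)) p :=
    HasFDerivAt.prodMap p (hasFDerivAt_id _) hd.hasFDerivAt
  ext α a
  rw [jac_eq h.differentiableAt, h.fderiv]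
  rcases α with ⟨⟩ | k <;> rcases a with ⟨⟩ | i <;> simp [coords, coordBasis, transJac]

end Charts

/-! ### Adapted frames of the foliation and changes of chart. -/

namespace FoliatedSpacetime

variable {S : Type*} [TopologicalSpace S] [ChartedSpace E3 S] {I : Set ℝ}
  (M : FoliatedSpacetime S I) {c c' : OpenPartialHomeomorph S E3}

/-- The coordinate domain of a chart, at interior times. -/
def coordDom (I : Set ℝ) (c : OpenPartialHomeomorph S E3) : Set Coord :=
  interior I ×ˢ c.target

lemma isOpen_coordDom : IsOpen (coordDom I c) := isOpen_interior.prod c.open_target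

/-- The orthonormal frame in a chart. -/
def frame (c : OpenPartialHomeomorph S E3) (p : Coord) : Matrix Idx Idx ℝ :=
  Matrix.fromBlocks (Matrix.of fun _ _ => (M.lapseIn c p)⁻¹) 0 0
    (orthoFrame (gram (M.metric p.1) c p.2))

lemma frame_tIdx (p : Coord) (a : Idx) : M.frame c p a tIdx = M.unitNormal c p a := by
  rcases a with ⟨⟩ | i <;> simp [frame, unitNormal]

/-- The open set contains also the end times that belong to `I`; this later gives continuity of the
energy up to those times. -/
lemma exists_smooth_nhds (hc : c ∈ atlas E3 S) : ∃ V : Set Coord, IsOpen V ∧ I ×ˢ c.target ⊆ V ∧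
    ContDiffOn ℝ ∞ (M.lapseIn c) V ∧
    ∀ i j, ContDiffOn ℝ ∞ (fun p : Coord => gram (M.metric p.1) c p.2 i j) V := by
  obtain ⟨W, hW, hIW, hsm⟩ := M.smooth
  refine ⟨{p | p.2 ∈ c.target ∧ (p.1, c.symm p.2) ∈ W}, ?_, ?_, (hsm c hc).1, (hsm c hc).2⟩
  · have hcont : ContinuousOn (fun p : Coord => (p.1, c.symm p.2)) {p : Coord | p.2 ∈ c.target} :=
      continuousOn_fst.prodMk (c.continuousOn_symm.comp continuousOn_snd fun p hp => hp)
    exact hcont.isOpen_inter_preimage (c.open_target.preimage continuous_snd) hW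
  · rintro ⟨t, y⟩ ⟨ht, hy⟩
    exact ⟨hy, hIW ⟨ht, Set.mem_univ _⟩⟩

lemma gram_symm {t : ℝ} (ht : t ∈ I) (y : E3) :
    (gram (M.metric t) c y)ᵀ = gram (M.metric t) c y := by
  ext i j
  exact M.metric_symm t ht _ _ _

variable [IsManifold 𝓘(ℝ, E3) ∞ S]

lemma gram_pos {t : ℝ} (ht : t ∈ I) (hc : c ∈ IsManifold.maximalAtlas 𝓘(ℝ, E3) ∞ S) {y : E3}
    (hy : y ∈ c.target) (v : Fin 3 → ℝ) (hv : v ≠ 0) : 0 < v ⬝ᵥ gram (M.metric t) c y *ᵥ v := by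
  have h := gram_quad (M.metric t) c y (WithLp.toLp 2 v)
  rw [h]
  refine M.metric_pos t ht _ _ fun h0 => hv ?_
  have : (WithLp.toLp 2 v : E3) = 0 :=
    symmDeriv_injective hc hy (by rw [map_zero]; exact h0)
  simpa using congrArg (WithLp.ofLp) this

lemma orthoFrame_gram {t : ℝ} (ht : t ∈ I) (hc : c ∈ IsManifold.maximalAtlas 𝓘(ℝ, E3) ∞ S) {y : E3}
    (hy : y ∈ c.target) : (orthoFrame (gram (M.metric t) c y))ᵀ * gram (M.metric t) c y
      * orthoFrame (gram (M.metric t) c y) = 1 :=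
  orthoFrame_ortho (M.gram_symm ht y) (M.gram_pos ht hc hy)

lemma gram_det_pos {t : ℝ} (ht : t ∈ I) (hc : c ∈ IsManifold.maximalAtlas 𝓘(ℝ, E3) ∞ S) {y : E3}
    (hy : y ∈ c.target) : 0 < (gram (M.metric t) c y).det := by
  have h := congrArg Matrix.det (M.orthoFrame_gram ht hc hy)
  simp only [Matrix.det_mul, Matrix.det_transpose, Matrix.det_one] at h
  by_contra hn
  nlinarith [mul_nonneg (sq_nonneg (orthoFrame (gram (M.metric t) c y)).det)
    (neg_nonneg.2 (not_lt.1 hn))]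

lemma frame_riemannian {t : ℝ} (ht : t ∈ I) (hc : c ∈ IsManifold.maximalAtlas 𝓘(ℝ, E3) ∞ S) {y : E3}
    (hy : y ∈ c.target) :
    (M.frame c (t, y))ᵀ * M.riemannianMetric c (t, y) * M.frame c (t, y) = 1 := by
  have hn : M.lapseIn c (t, y) ≠ 0 := (M.lapse_pos t ht _).ne'
  rw [frame, riemannianMetric, Matrix.fromBlocks_transpose, Matrix.fromBlocks_multiply,
    Matrix.fromBlocks_multiply]
  simp only [Matrix.transpose_zero, Matrix.zero_mul, Matrix.mul_zero, add_zero, zero_add,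
    M.orthoFrame_gram ht hc hy]
  rw [← Matrix.fromBlocks_one]
  congr 1
  ext i j
  rcases i with ⟨⟩
  rcases j with ⟨⟩
  simp [Matrix.mul_apply]
  field_simp

lemma frame_spacetime {t : ℝ} (ht : t ∈ I) (hc : c ∈ IsManifold.maximalAtlas 𝓘(ℝ, E3) ∞ S) {y : E3}
    (hy : y ∈ c.target) :
    (M.frame c (t, y))ᵀ * M.spacetimeMetric c (t, y) * M.frame c (t, y) = minkowskiM := by
  have hn : M.lapseIn c (t, y) ≠ 0 := (M.lapse_pos t ht _).ne'
  rw [frame, spacetimeMetric, Matrix.fromBlocks_transpose, Matrix.fromBlocks_multiply,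
    Matrix.fromBlocks_multiply]
  simp only [Matrix.transpose_zero, Matrix.zero_mul, Matrix.mul_zero, add_zero, zero_add,
    M.orthoFrame_gram ht hc hy]
  ext i j
  rcases i with ⟨⟩ | i <;> rcases j with ⟨⟩ | j
  · simp [Matrix.mul_apply, minkowskiM, minkowski]
    field_simp
  · simp [minkowskiM]
  · simp [minkowskiM]
  · simp [minkowskiM, Matrix.diagonal_apply, Matrix.one_apply, minkowski]

lemma spacetimeMetric_symm {t : ℝ} (ht : t ∈ I) (y : E3) :
    (M.spacetimeMetric c (t, y))ᵀ = M.spacetimeMetric c (t, y) := by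
  rw [spacetimeMetric, Matrix.fromBlocks_transpose, M.gram_symm ht]
  congr 1

lemma smoothMat_fromBlocks {U : Set Coord} {f : Coord → ℝ} {g : Coord → Matrix (Fin 3) (Fin 3) ℝ}
    (hf : ContDiffOn ℝ ∞ f U) (hg : ∀ i j, ContDiffOn ℝ ∞ (fun q => g q i j) U) :
    SmoothMat (fun q => Matrix.fromBlocks (Matrix.of fun _ _ : Unit => f q) 0 0 (g q)) U := by
  intro i j
  rcases i with ⟨⟩ | i <;> rcases j with ⟨⟩ | j
  · exact hf
  · exact contDiffOn_const
  · exact contDiffOn_const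
  · exact hg i j

/-- Restricted to interior times so that the domain is open. Statements at end times are recovered
by continuity. -/
lemma isFrame (hc : c ∈ atlas E3 S) : IsFrame (M.spacetimeMetric c) (M.frame c) (coordDom I c) := by
  obtain ⟨V, hV, hIV, hn, hg⟩ := M.exists_smooth_nhds hc
  have hsub : coordDom I c ⊆ V := fun p hp => hIV ⟨interior_subset hp.1, hp.2⟩
  have hcm : c ∈ IsManifold.maximalAtlas 𝓘(ℝ, E3) ∞ S := IsManifold.subset_maximalAtlas hc
  refine ⟨isOpen_coordDom, ?_, ?_, ?_, ?_⟩
  · exact smoothMat_fromBlocks ((hn.mono hsub).pow 2).neg fun i j => (hg i j).mono hsub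
  · refine smoothMat_fromBlocks ((hn.mono hsub).inv fun p hp => ?_) ?_
    · exact (M.lapse_pos p.1 (interior_subset hp.1) _).ne'
    · exact smooth_orthoFrame (fun i j => (hg i j).mono hsub)
        (fun p hp => M.gram_symm (interior_subset hp.1) p.2)
        fun p hp => M.gram_pos (interior_subset hp.1) hcm hp.2
  · exact fun p hp => M.spacetimeMetric_symm (interior_subset hp.1) p.2
  · exact fun p hp => M.frame_spacetime (interior_subset hp.1) hcm hp.2

/-- The domain in spacetime of a coordinate change, at interior times. -/
def changeDom (I : Set ℝ) (c c' : OpenPartialHomeomorph S E3) : Set Coord :=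
  interior I ×ˢ transDom c c'

lemma isOpen_changeDom : IsOpen (changeDom I c c') := isOpen_interior.prod isOpen_transDom

lemma mapsTo_spacetimeTrans :
    Set.MapsTo (spacetimeTrans c c') (changeDom I c c') (coordDom I c') :=
  fun _ hp => ⟨hp.1, trans_mem hp.2⟩

lemma smooth_spacetimeTrans (hc : c ∈ atlas E3 S) (hc' : c' ∈ atlas E3 S) :
    ContDiffOn ℝ ∞ (spacetimeTrans c c') (changeDom I c c') :=
  contDiffOn_fst.prodMk ((smooth_trans (IsManifold.subset_maximalAtlas hc)
    (IsManifold.subset_maximalAtlas hc')).comp contDiffOn_snd fun _ hp => hp.2)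

lemma jac_change (hc : c ∈ atlas E3 S) (hc' : c' ∈ atlas E3 S) {p : Coord}
    (hp : p.2 ∈ transDom c c') :
    jac (spacetimeTrans c c') p = Matrix.fromBlocks 1 0 0 (transJac c c' p.2) :=
  jac_spacetimeTrans (((smooth_trans (IsManifold.subset_maximalAtlas hc)
    (IsManifold.subset_maximalAtlas hc')).contDiffAt
      (isOpen_transDom.mem_nhds hp)).differentiableAt (by simp))

lemma lapseIn_change {p : Coord} (hp : p.2 ∈ transDom c c') :
    M.lapseIn c p = M.lapseIn c' (spacetimeTrans c c' p) := by
  simp only [lapseIn, spacetimeTrans, symm_trans hp]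

lemma spacetimeMetric_change (hc : c ∈ atlas E3 S) (hc' : c' ∈ atlas E3 S) {p : Coord}
    (hp : p.2 ∈ transDom c c') : M.spacetimeMetric c p = (jac (spacetimeTrans c c') p)ᵀ
      * M.spacetimeMetric c' (spacetimeTrans c c' p) * jac (spacetimeTrans c c') p := by
  rw [jac_change hc hc' hp, spacetimeMetric, spacetimeMetric, Matrix.fromBlocks_transpose,
    Matrix.fromBlocks_multiply, Matrix.fromBlocks_multiply, ← M.lapseIn_change hp,
    gram_trans (IsManifold.subset_maximalAtlas hc) (IsManifold.subset_maximalAtlas hc') _ hp]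
  simp [spacetimeTrans]

lemma riemannianMetric_change (hc : c ∈ atlas E3 S) (hc' : c' ∈ atlas E3 S) {p : Coord}
    (hp : p.2 ∈ transDom c c') : M.riemannianMetric c p = (jac (spacetimeTrans c c') p)ᵀ
      * M.riemannianMetric c' (spacetimeTrans c c' p) * jac (spacetimeTrans c c') p := by
  rw [jac_change hc hc' hp, riemannianMetric, riemannianMetric, Matrix.fromBlocks_transpose,
    Matrix.fromBlocks_multiply, Matrix.fromBlocks_multiply, ← M.lapseIn_change hp,
    gram_trans (IsManifold.subset_maximalAtlas hc) (IsManifold.subset_maximalAtlas hc') _ hp]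
  simp [spacetimeTrans]

/-- A singular Jacobian would make the pulled back metric degenerate. -/
lemma jac_change_det (M : FoliatedSpacetime S I) (hc : c ∈ atlas E3 S) (hc' : c' ∈ atlas E3 S) {p : Coord}
    (hp : p ∈ changeDom I c c') : (jac (spacetimeTrans c c') p).det ≠ 0 := by
  intro h0
  have h1 := ((M.isFrame hc).det_metric_neg (p := p) ⟨hp.1, hp.2.1⟩).ne
  rw [M.spacetimeMetric_change hc hc' hp.2, Matrix.det_mul, h0, mul_zero] at h1
  exact h1 rfl

lemma riem_change (hc : c ∈ atlas E3 S) (hc' : c' ∈ atlas E3 S) {p : Coord}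
    (hp : p ∈ changeDom I c c') : riem (M.spacetimeMetric c) p
      = contract (jac (spacetimeTrans c c') p)
        (riem (M.spacetimeMetric c') (spacetimeTrans c c' p)) := by
  have hf' := M.isFrame hc'
  funext a
  have ha : a = ![a 0, a 1, a 2, a 3] := by
    ext i
    fin_cases i <;> rfl
  rw [ha, contract_four]
  exact riemannDown_pull isOpen_changeDom hf'.isOpen (smooth_spacetimeTrans hc hc')
    mapsTo_spacetimeTrans hf'.smooth_metric hf'.symm (fun q hq => (hf'.det_metric_neg hq).ne)
    (fun z hz => M.jac_change_det hc hc' hz) (fun z hz => M.spacetimeMetric_change hc hc' hz.2)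
    hp _ _ _ _

lemma smooth_unitNormal (hc : c ∈ atlas E3 S) (l : Idx) :
    ContDiffOn ℝ ∞ (fun p => M.unitNormal c p l) (coordDom I c) :=
  ((M.isFrame hc).smooth_frame l tIdx).congr fun p _ => (M.frame_tIdx p l).symm

lemma lie_change (hc : c ∈ atlas E3 S) (hc' : c' ∈ atlas E3 S) {p : Coord}
    (hp : p ∈ changeDom I c c') : lie (M.unitNormal c) (M.spacetimeMetric c) p
      = contract (jac (spacetimeTrans c c') p)
        (lie (M.unitNormal c') (M.spacetimeMetric c') (spacetimeTrans c c' p)) := by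
  have hf' := M.isFrame hc'
  funext a
  have ha : a = ![a 0, a 1] := by
    ext i
    fin_cases i <;> rfl
  rw [ha, contract_two]
  refine lieDeriv_pull isOpen_changeDom hf'.isOpen (smooth_spacetimeTrans hc hc')
    mapsTo_spacetimeTrans hf'.smooth_metric hf'.symm (fun q hq => (hf'.det_metric_neg hq).ne)
    (fun z hz => M.jac_change_det hc hc' hz) (fun z hz => M.spacetimeMetric_change hc hc' hz.2)
    (M.smooth_unitNormal hc')
    (fun l => (M.smooth_unitNormal hc l).mono fun z hz => ⟨hz.1, hz.2.1⟩) ?_ hp _ _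
  intro z hz l
  rw [jac_change hc hc' hz.2]
  rcases l with ⟨⟩ | l
  · simp [unitNormal, ← M.lapseIn_change hz.2]
  · simp [unitNormal]

lemma norm_riem_change (hc : c ∈ atlas E3 S) (hc' : c' ∈ atlas E3 S) {p : Coord}
    (hp : p ∈ changeDom I c c') :
    tensorNorm (M.riemannianMetric c p) (riem (M.spacetimeMetric c) p)
      = tensorNorm (M.riemannianMetric c' (spacetimeTrans c c' p))
        (riem (M.spacetimeMetric c') (spacetimeTrans c c' p)) := by
  rw [M.riem_change hc hc' hp]
  exact tensorNorm_pull (M.riemannianMetric_change hc hc' hp.2)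
    (M.frame_riemannian (interior_subset hp.1) (IsManifold.subset_maximalAtlas hc) hp.2.1) _

lemma norm_lie_change (hc : c ∈ atlas E3 S) (hc' : c' ∈ atlas E3 S) {p : Coord}
    (hp : p ∈ changeDom I c c') :
    tensorNorm (M.riemannianMetric c p) (lie (M.unitNormal c) (M.spacetimeMetric c) p)
      = tensorNorm (M.riemannianMetric c' (spacetimeTrans c c' p))
        (lie (M.unitNormal c') (M.spacetimeMetric c') (spacetimeTrans c c' p)) := by
  rw [M.lie_change hc hc' hp]
  exact tensorNorm_pull (M.riemannianMetric_change hc hc' hp.2)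
    (M.frame_riemannian (interior_subset hp.1) (IsManifold.subset_maximalAtlas hc) hp.2.1) _

/-- The pairing of the spatial energy flux with a covector tangent to the leaves. -/
def flux (c : OpenPartialHomeomorph S E3) (p : Coord) (w : Fin 3 → ℝ) : ℝ :=
  momentumPairing (M.frame c p) (riem (M.spacetimeMetric c) p) (Sum.elim 0 w)

/-- The Jacobian carries the frame of one chart to an orthonormal frame in the other with the same
time column, and the pairing does not see the remaining rotation. This allows the fluxes of
different charts to be compared at one point. -/
lemma flux_change (hc : c ∈ atlas E3 S) (hc' : c' ∈ atlas E3 S) {p : Coord}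
    (hp : p ∈ changeDom I c c') (w : Fin 3 → ℝ) :
    M.flux c p (fun i => ∑ k, transJac c c' p.2 k i * w k)
      = M.flux c' (spacetimeTrans c c' p) w := by
  have hw : (Sum.elim 0 (fun i => ∑ k, transJac c c' p.2 k i * w k) : Idx → ℝ)
      = fun ρ => ∑ σ, jac (spacetimeTrans c c') p σ ρ * (Sum.elim 0 w : Idx → ℝ) σ := by
    rw [jac_change hc hc' hp.2]
    funext ρ
    rcases ρ with ⟨⟩ | i <;> simp
  have hI := interior_subset hp.1
  have hm : c ∈ IsManifold.maximalAtlas 𝓘(ℝ, E3) ∞ S := IsManifold.subset_maximalAtlas hc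
  have hm' : c' ∈ IsManifold.maximalAtlas 𝓘(ℝ, E3) ∞ S := IsManifold.subset_maximalAtlas hc'
  rw [flux, flux, hw, M.riem_change hc hc' hp, momentumPairing_pull]
  refine momentumPairing_congr (h := M.riemannianMetric c' (spacetimeTrans c c' p)) ?_
    (M.frame_riemannian hI hm' (trans_mem hp.2)) ?_ _ _
  · rw [Matrix.transpose_mul, ← M.frame_riemannian hI hm hp.2.1,
      M.riemannianMetric_change hc hc' hp.2]
    simp only [Matrix.mul_assoc]
  · intro κ
    rw [jac_change hc hc' hp.2, Matrix.mul_apply]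
    simp only [frame_tIdx]
    rcases κ with ⟨⟩ | k
    · simp [unitNormal, M.lapseIn_change hp.2, spacetimeTrans]
    · simp [unitNormal]

end FoliatedSpacetime

/-! ### The energy density and the energy flux in charts -/

/-! ### Chart independence, the energy law and flux bounds. -/

namespace FoliatedSpacetime

variable {S : Type*} [TopologicalSpace S] [ChartedSpace E3 S] {I : Set ℝ}
  (M : FoliatedSpacetime S I) {c c' : OpenPartialHomeomorph S E3}

/-- The energy density `|R|²` in a chart. -/
def energyIn (c : OpenPartialHomeomorph S E3) (p : Coord) : ℝ :=
  tensorNorm (M.riemannianMetric c p) (riem (M.spacetimeMetric c) p) ^ 2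

/-- The volume density of the leaves in a chart. -/
def volIn (c : OpenPartialHomeomorph S E3) (p : Coord) : ℝ :=
  Real.sqrt (gram (M.metric p.1) c p.2).det

/-- The components of the energy flux in a chart. -/
def fluxVec (c : OpenPartialHomeomorph S E3) (k : Fin 3) (p : Coord) : ℝ :=
  current (M.spacetimeMetric c) (M.frame c) (.inr k) p

lemma energyIn_nonneg (p : Coord) : 0 ≤ M.energyIn c p := sq_nonneg _

lemma volIn_nonneg (p : Coord) : 0 ≤ M.volIn c p := Real.sqrt_nonneg _

lemma det_fromBlocks_diag (a : ℝ) (g : Matrix (Fin 3) (Fin 3) ℝ) :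
    (Matrix.fromBlocks (Matrix.of fun _ _ : Unit => a) 0 0 g).det = a * g.det := by
  rw [Matrix.det_fromBlocks_zero₂₁]
  simp

variable [IsManifold 𝓘(ℝ, E3) ∞ S]

lemma continuousOn_energyIn (hc : c ∈ atlas E3 S) : ContinuousOn (M.energyIn c) (I ×ˢ c.target) := by
  obtain ⟨V, hV, hIV, hn, hg⟩ := M.exists_smooth_nhds hc
  have hcm : c ∈ IsManifold.maximalAtlas 𝓘(ℝ, E3) ∞ S := IsManifold.subset_maximalAtlas hc
  have hfc : ContinuousOn (fun p => M.lapseIn c p * (gram (M.metric p.1) c p.2).det) V :=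
    hn.continuousOn.mul (smoothOn_det hg).continuousOn
  -- Outside `I` the extended lapse and metrics may degenerate, so the neighbourhood is shrunk to
  -- where they do not.
  set V' : Set Coord := V ∩ (fun p => M.lapseIn c p * (gram (M.metric p.1) c p.2).det) ⁻¹' {0}ᶜ
  have hV' : IsOpen V' := hfc.isOpen_inter_preimage hV isOpen_compl_singleton
  have hne : ∀ p ∈ V', M.lapseIn c p ≠ 0 ∧ (gram (M.metric p.1) c p.2).det ≠ 0 := fun p hp =>
    mul_ne_zero_iff.1 hp.2
  have hsub : I ×ˢ c.target ⊆ V' := by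
    rintro ⟨t, y⟩ hp
    exact ⟨hIV hp, mul_ne_zero (M.lapse_pos t hp.1 _).ne' (M.gram_det_pos hp.1 hcm hp.2).ne'⟩
  have hG : SmoothMat (M.spacetimeMetric c) V' :=
    smoothMat_fromBlocks ((hn.mono Set.inter_subset_left).pow 2).neg fun i j =>
      (hg i j).mono Set.inter_subset_left
  have hh : SmoothMat (M.riemannianMetric c) V' :=
    smoothMat_fromBlocks ((hn.mono Set.inter_subset_left).pow 2) fun i j =>
      (hg i j).mono Set.inter_subset_left
  have hGd : ∀ p ∈ V', (M.spacetimeMetric c p).det ≠ 0 := fun p hp => by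
    rw [spacetimeMetric, det_fromBlocks_diag]
    exact mul_ne_zero (neg_ne_zero.2 (pow_ne_zero 2 (hne p hp).1)) (hne p hp).2
  have hhd : ∀ p ∈ V', (M.riemannianMetric c p).det ≠ 0 := fun p hp => by
    rw [riemannianMetric, det_fromBlocks_diag]
    exact mul_ne_zero (pow_ne_zero 2 (hne p hp).1) (hne p hp).2
  have hR : ∀ a, ContinuousOn (fun p => riem (M.spacetimeMetric c) p a) V' := fun a => by
    simp only [riem, riemannDown_eq]
    exact (hG.mul (smoothMat_curv hV' (smoothMat_conn hV' hG hGd) _ _) _ _).continuousOn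
  have hT : ContinuousOn (fun p => tensorInner (M.riemannianMetric c p)⁻¹
      (riem (M.spacetimeMetric c) p) (riem (M.spacetimeMetric c) p)) V' := by
    unfold tensorInner
    refine continuousOn_finsetSum _ fun a _ => continuousOn_finsetSum _ fun b _ => ?_
    exact ((continuousOn_finsetProd _ fun i _ => (smoothOn_inv hh hhd _ _).continuousOn).mul
      (hR a)).mul (hR b)
  exact ((Real.continuous_sqrt.comp_continuousOn hT).pow 2).mono hsub

lemma continuousOn_volIn (hc : c ∈ atlas E3 S) : ContinuousOn (M.volIn c) (I ×ˢ c.target) := by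
  obtain ⟨V, hV, hIV, hn, hg⟩ := M.exists_smooth_nhds hc
  exact Real.continuous_sqrt.comp_continuousOn ((smoothOn_det hg).continuousOn.mono hIV)

/-- The energy density does not depend on the chart. -/
lemma energyIn_eq (hI : I.OrdConnected) (hIn : (interior I).Nonempty) (hc : c ∈ atlas E3 S)
    (hc' : c' ∈ atlas E3 S) {x : S} (hx : x ∈ c.source) (hx' : x ∈ c'.source) {t : ℝ}
    (ht : t ∈ I) : M.energyIn c (t, c x) = M.energyIn c' (t, c' x) := by
  have hcont : ∀ {c : OpenPartialHomeomorph S E3}, c ∈ atlas E3 S → x ∈ c.source →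
      ContinuousOn (fun s => M.energyIn c (s, c x)) I := fun hc hx =>
    (M.continuousOn_energyIn hc).comp (Continuous.prodMk_left _).continuousOn
      fun s hs => ⟨hs, OpenPartialHomeomorph.map_source _ hx⟩
  have heq : Set.EqOn (fun s => M.energyIn c (s, c x)) (fun s => M.energyIn c' (s, c' x))
      (interior I) := by
    intro s hs
    have hp : (s, c x) ∈ changeDom I c c' :=
      ⟨hs, c.map_source hx, by simpa [c.left_inv hx] using hx'⟩
    have h := M.norm_riem_change hc hc' hp
    have h2 : spacetimeTrans c c' (s, c x) = (s, c' x) := by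
      simp [spacetimeTrans, trans, c.left_inv hx]
    rw [h2] at h
    simp only [energyIn, h]
  -- The tensor law applies at interior times only. An interval with nonempty interior lies in the
  -- closure of that interior, so both continuous sides agree at end times as well.
  have hcl : I ⊆ closure (interior I) := by
    rw [(hI.convex : Convex ℝ I).closure_interior_eq_closure_of_nonempty_interior hIn]
    exact subset_closure
  exact heq.of_subset_closure (hcont hc hx) (hcont hc' hx') interior_subset hcl ht

lemma curvatureNorm_sq (hI : I.OrdConnected) (hIn : (interior I).Nonempty) (hc : c ∈ atlas E3 S)
    {x : S} (hx : x ∈ c.source) {t : ℝ} (ht : t ∈ I) :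
    M.curvatureNorm t x ^ 2 = M.energyIn c (t, c x) :=
  M.energyIn_eq hI hIn (chart_mem_atlas E3 x) hc (mem_chart_source E3 x) hx ht

lemma deformationNorm_eq (hc : c ∈ atlas E3 S) {x : S} (hx : x ∈ c.source) {t : ℝ}
    (ht : t ∈ interior I) : M.deformationNorm t x = tensorNorm (M.riemannianMetric c (t, c x))
      (lie (M.unitNormal c) (M.spacetimeMetric c) (t, c x)) := by
  have hp : (t, chartAt E3 x x) ∈ changeDom I (chartAt E3 x) c :=
    ⟨ht, mem_chart_target E3 x, by simpa using hx⟩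
  have h := M.norm_lie_change (chart_mem_atlas E3 x) hc hp
  have h2 : spacetimeTrans (chartAt E3 x) c (t, chartAt E3 x x) = (t, c x) := by
    simp [spacetimeTrans, trans]
  rw [h2] at h
  exact h

lemma energyIn_eq_sqNorm (hc : c ∈ atlas E3 S) {p : Coord} (hp : p ∈ coordDom I c) :
    M.energyIn c p = sqNorm (frameRiem (M.spacetimeMetric c) (M.frame c) p) :=
  tensorNorm_riem_sq (M.frame_riemannian (interior_subset hp.1)
    (IsManifold.subset_maximalAtlas hc) hp.2)

lemma volDensity_eq {p : Coord} (hp : p ∈ coordDom I c) :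
    volDensity (M.spacetimeMetric c) p = M.lapseIn c p * M.volIn c p := by
  have hn : 0 < M.lapseIn c p := M.lapse_pos p.1 (interior_subset hp.1) _
  rw [volDensity, spacetimeMetric, det_fromBlocks_diag, volIn, neg_mul, neg_neg,
    Real.sqrt_mul (by positivity), Real.sqrt_sq hn.le]

lemma smooth_energyIn (hc : c ∈ atlas E3 S) : ContDiffOn ℝ ∞ (M.energyIn c) (coordDom I c) :=
  (M.isFrame hc).smooth_sqNorm.congr fun _ hp => M.energyIn_eq_sqNorm hc hp

lemma smooth_fluxVec (hc : c ∈ atlas E3 S) (k : Fin 3) :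
    ContDiffOn ℝ ∞ (M.fluxVec c k) (coordDom I c) := (M.isFrame hc).smooth_current _

lemma smooth_lapseIn (hc : c ∈ atlas E3 S) : ContDiffOn ℝ ∞ (M.lapseIn c) (coordDom I c) := by
  obtain ⟨V, hV, hIV, hn, hg⟩ := M.exists_smooth_nhds hc
  exact hn.mono fun p hp => hIV ⟨interior_subset hp.1, hp.2⟩

lemma smooth_volIn (hc : c ∈ atlas E3 S) : ContDiffOn ℝ ∞ (M.volIn c) (coordDom I c) := by
  obtain ⟨V, hV, hIV, hn, hg⟩ := M.exists_smooth_nhds hc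
  refine ContDiffOn.sqrt (smoothOn_det fun i j => (hg i j).mono fun p hp =>
    hIV ⟨interior_subset hp.1, hp.2⟩) fun p hp => ?_
  exact (M.gram_det_pos (interior_subset hp.1) (IsManifold.subset_maximalAtlas hc) hp.2).ne'

lemma flux_eq (p : Coord) (w : Fin 3 → ℝ) : M.flux c p w = ∑ k, w k * M.fluxVec c k p := by
  have h0 : ∀ k : Fin 3, M.frame c p (.inr k) tIdx = 0 := fun k => by simp [frame]
  have h1 : ∀ i : Fin 3, M.frame c p tIdx (.inr i) = 0 := fun i => by simp [frame]
  have hm : (fun a b c' d => contract (M.frame c p) (riem (M.spacetimeMetric c) p) ![a, b, c', d])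
      = frameRiem (M.spacetimeMetric c) (M.frame c) p := by
    funext a b c' d
    rw [frameRiem_eq_contract]
  simp only [flux, momentumPairing, hm, fluxVec, current, h0, mul_zero, zero_add, Finset.mul_sum]
  rw [Finset.sum_comm, Fintype.sum_sum_type]
  simp only [Sum.elim_inl, Pi.zero_apply, zero_mul, mul_zero, Finset.sum_const_zero, zero_add,
    Fintype.sum_sum_type, h0, Sum.elim_inr]
  exact Finset.sum_congr rfl fun k _ => Finset.sum_congr rfl fun i _ => by ring

/-- The energy identity in a chart, up to the deformation tensor. -/
lemma abs_energy_law_le (hvac : M.IsVacuum) (hc : c ∈ atlas E3 S) {p : Coord}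
    (hp : p ∈ coordDom I c) {D : ℝ} (hD : tensorNorm (M.riemannianMetric c p)
      (lie (M.unitNormal c) (M.spacetimeMetric c) p) ≤ D) :
    |-(1 / 4) * pd tIdx (fun q => M.volIn c q * M.energyIn c q) p
      + ∑ k : Fin 3, pd (.inr k) (fun q => M.lapseIn c q * M.volIn c q * M.fluxVec c k q) p|
      ≤ M.lapseIn c p * M.volIn c p * (9000 * D * M.energyIn c p) := by
  have hf := M.isFrame hc
  have hcm : c ∈ IsManifold.maximalAtlas 𝓘(ℝ, E3) ∞ S := IsManifold.subset_maximalAtlas hc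
  have hlp : ∀ q ∈ coordDom I c, M.lapseIn c q ≠ 0 := fun q hq =>
    (M.lapse_pos q.1 (interior_subset hq.1) _).ne'
  have h := hf.abs_div_current_le hp (B := D)
    (fun q hq μ ν => hvac c hc q.1 (interior_subset hq.1) q.2 hq.2 μ ν)
    (by simpa [frame] using hlp p hp) (fun q _ i => by simp [frame]) ?_
  · rw [M.volDensity_eq hp, ← M.energyIn_eq_sqNorm hc hp, Fintype.sum_sum_type] at h
    -- The spacetime density is `n` times the density of the leaf, and the unit normal has time
    -- component `n⁻¹`, so the lapse cancels in the time component of the current.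
    have h1 : pd (.inl ()) (fun q => volDensity (M.spacetimeMetric c) q
        * current (M.spacetimeMetric c) (M.frame c) (.inl ()) q) p
        = -(1 / 4) * pd tIdx (fun q => M.volIn c q * M.energyIn c q) p := by
      have hve : DifferentiableAt ℝ (fun q => M.volIn c q * M.energyIn c q) p :=
        (smoothOn_diffAt isOpen_coordDom hp (M.smooth_volIn hc)).mul
          (smoothOn_diffAt isOpen_coordDom hp (M.smooth_energyIn hc))
      have h2 := pd_mul (p := p) (.inl ()) (differentiableAt_const (-(1 / 4 : ℝ))) hve
      rw [pd_const, zero_mul, zero_add] at h2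
      rw [← h2]
      refine pd_congr_on _ isOpen_coordDom hp fun q hq => ?_
      have hl := hlp q hq
      have h3 : M.frame c q (.inl ()) tIdx = (M.lapseIn c q)⁻¹ := by simp [frame]
      have h4 : ∀ i : Fin 3, M.frame c q (.inl ()) (.inr i) = 0 := fun i => by simp [frame]
      simp only [current, h3, h4, mul_zero, Finset.sum_const_zero, add_zero]
      rw [M.volDensity_eq hq, ← M.energyIn_eq_sqNorm hc hq]
      field_simp
    have h2 : ∀ k : Fin 3, pd (.inr k) (fun q => volDensity (M.spacetimeMetric c) q
        * current (M.spacetimeMetric c) (M.frame c) (.inr k) q) p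
        = pd (.inr k) (fun q => M.lapseIn c q * M.volIn c q * M.fluxVec c k q) p := fun k =>
      pd_congr_on _ isOpen_coordDom hp fun q hq => by rw [M.volDensity_eq hq]; rfl
    simpa only [Finset.univ_unique, Finset.sum_singleton, PUnit.default_eq_unit, h1, h2] using h
  · intro a b
    have h1 := abs_contract_le (M.frame_riemannian (interior_subset hp.1) hcm hp.2)
      (lie (M.unitNormal c) (M.spacetimeMetric c) p) ![a, b]
    rw [contract_two] at h1
    have h2 : (fun q l => M.frame c q l tIdx) = M.unitNormal c := by
      funext q l
      exact M.frame_tIdx q l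
    rw [h2]
    exact h1.trans hD

/-- A covector which is small in the metric of the leaves has a small pairing with the flux. -/
lemma abs_flux_le (hc : c ∈ atlas E3 S) {p : Coord} (hp : p ∈ coordDom I c) {w : Fin 3 → ℝ} {δ : ℝ}
    (hw : ∀ v : Fin 3 → ℝ, |∑ k, w k * v k|
      ≤ δ * Real.sqrt (v ⬝ᵥ gram (M.metric p.1) c p.2 *ᵥ v)) :
    |M.flux c p w| ≤ 192 * δ * M.energyIn c p := by
  have hcm : c ∈ IsManifold.maximalAtlas 𝓘(ℝ, E3) ∞ S := IsManifold.subset_maximalAtlas hc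
  have hm : (fun a b c' d => contract (M.frame c p) (riem (M.spacetimeMetric c) p) ![a, b, c', d])
      = frameRiem (M.spacetimeMetric c) (M.frame c) p := by
    funext a b c' d
    rw [frameRiem_eq_contract]
  have h0 : ∀ k : Fin 3, M.frame c p (.inr k) tIdx = 0 := fun k => by simp [frame]
  simp only [flux, momentumPairing, hm]
  rw [Fintype.sum_sum_type]
  have ht : ∑ ρ, (Sum.elim 0 w : Idx → ℝ) ρ * M.frame c p ρ tIdx = 0 := by
    simp [Fintype.sum_sum_type, h0]
  simp only [Finset.univ_unique, Finset.sum_singleton, PUnit.default_eq_unit, ht, mul_zero, zero_add]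
  have hi : ∀ i : Fin 3, |∑ ρ, (Sum.elim 0 w : Idx → ℝ) ρ * M.frame c p ρ (.inr i)| ≤ δ := by
    intro i
    have h1 := hw fun k => orthoFrame (gram (M.metric p.1) c p.2) k i
    have h2 := congrFun (congrFun (M.orthoFrame_gram (interior_subset hp.1) hcm hp.2) i) i
    rw [Matrix.one_apply_eq, Matrix.mul_assoc] at h2
    have h3 : (fun k => orthoFrame (gram (M.metric p.1) c p.2) k i) ⬝ᵥ
        gram (M.metric p.1) c p.2 *ᵥ (fun k => orthoFrame (gram (M.metric p.1) c p.2) k i) = 1 := h2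
    rw [h3, Real.sqrt_one, mul_one] at h1
    simpa [Fintype.sum_sum_type, frame] using h1
  -- Three frame directions with momentum at most `64 |R|²` each account for `192 = 3 · 64`.
  have hb := abs_sum_three_le (f := fun i => momentum (frameRiem (M.spacetimeMetric c) (M.frame c) p)
    (.inr i) * ∑ ρ, (Sum.elim 0 w : Idx → ℝ) ρ * M.frame c p ρ (.inr i))
    (b := 64 * M.energyIn c p * δ) fun i => by
      rw [abs_mul, M.energyIn_eq_sqNorm hc hp]
      exact mul_le_mul (abs_momentum_le _) (hi i) (abs_nonneg _)
        (mul_nonneg (by norm_num) sqNorm_nonneg)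
  linarith

/-- The normal has only a time component and the metric is block diagonal, so the terms with
derivatives of the vector field drop out. -/
lemma lie_inr_inr {p : Coord} (i j : Fin 3) :
    lieDeriv (M.unitNormal c) (M.spacetimeMetric c) (.inr i) (.inr j) p
      = (M.lapseIn c p)⁻¹ * pd tIdx (fun q => gram (M.metric q.1) c q.2 i j) p := by
  simp [lieDeriv, Fintype.sum_sum_type, unitNormal, spacetimeMetric, pd_const]

/-- The rate of change of the metric of the leaves is controlled by the deformation tensor. -/
lemma abs_pd_gram_le (hc : c ∈ atlas E3 S) {p : Coord} (hp : p ∈ coordDom I c) {D : ℝ}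
    (hD : tensorNorm (M.riemannianMetric c p)
      (lie (M.unitNormal c) (M.spacetimeMetric c) p) ≤ D) (v : Fin 3 → ℝ) :
    |∑ i, ∑ j, v i * v j * pd tIdx (fun q => gram (M.metric q.1) c q.2 i j) p|
      ≤ 3 * M.lapseIn c p * D * (v ⬝ᵥ gram (M.metric p.1) c p.2 *ᵥ v) := by
  have hpI := interior_subset hp.1
  have hcm : c ∈ IsManifold.maximalAtlas 𝓘(ℝ, E3) ∞ S := IsManifold.subset_maximalAtlas hc
  have hn : 0 < M.lapseIn c p := M.lapse_pos p.1 hpI _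
  set g := gram (M.metric p.1) c p.2 with hg
  set F := orthoFrame g with hF
  have hFo : Fᵀ * g * F = 1 := M.orthoFrame_gram hpI hcm hp.2
  have hinv : F * (Fᵀ * g) = 1 := mul_eq_one_comm.1 hFo
  -- The coordinates of `v` in the orthonormal frame, in which the components of the deformation
  -- tensor are bounded by its norm.
  set a : Fin 3 → ℝ := (Fᵀ * g) *ᵥ v with ha
  have hv : v = F *ᵥ a := by rw [ha, Matrix.mulVec_mulVec, hinv, Matrix.one_mulVec]
  have hvv : v ⬝ᵥ g *ᵥ v = ∑ i, a i ^ 2 := by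
    have h1 : v ⬝ᵥ g *ᵥ v = a ⬝ᵥ a := by
      conv_lhs => rw [hv]
      rw [← Matrix.vecMul_transpose F a, ← Matrix.dotProduct_mulVec, Matrix.vecMul_transpose,
        Matrix.mulVec_mulVec, Matrix.mulVec_mulVec, hFo, Matrix.one_mulVec]
    rw [h1]
    simp [dotProduct, pow_two]
  set ℓ : Fin 3 → Fin 3 → ℝ := fun i j =>
    lieDeriv (M.unitNormal c) (M.spacetimeMetric c) (.inr i) (.inr j) p with hℓ
  have hq : ∀ i j, pd tIdx (fun q => gram (M.metric q.1) c q.2 i j) p = M.lapseIn c p * ℓ i j := by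
    intro i j
    rw [hℓ]
    simp only [M.lie_inr_inr]
    field_simp
  have hb : ∀ k l, |∑ i, ∑ j, F i k * F j l * ℓ i j| ≤ D := by
    intro k l
    have h1 := abs_contract_le (M.frame_riemannian hpI hcm hp.2)
      (lie (M.unitNormal c) (M.spacetimeMetric c) p) ![.inr k, .inr l]
    rw [contract_two] at h1
    refine le_trans (le_of_eq ?_) (h1.trans hD)
    simp [Fintype.sum_sum_type, frame, lie, hℓ, hF, hg]
  have hexp : ∑ i, ∑ j, v i * v j * (M.lapseIn c p * ℓ i j)
      = M.lapseIn c p * ∑ k, ∑ l, a k * a l * ∑ i, ∑ j, F i k * F j l * ℓ i j := by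
    have h1 : ∀ i, v i = ∑ k, F i k * a k := fun i => congrFun hv i
    simp only [h1, Fin.sum_univ_three]
    ring
  simp only [hq]
  rw [hexp, hvv, abs_mul, abs_of_pos hn]
  have hterm : ∀ k l, |a k * a l * ∑ i, ∑ j, F i k * F j l * ℓ i j|
      ≤ (a k ^ 2 + a l ^ 2) / 2 * D := by
    intro k l
    rw [abs_mul]
    refine mul_le_mul ?_ (hb k l) (abs_nonneg _) (by positivity)
    rw [abs_mul]
    nlinarith [sq_nonneg (|a k| - |a l|), sq_abs (a k), sq_abs (a l)]
  have hsum : |∑ k, ∑ l, a k * a l * ∑ i, ∑ j, F i k * F j l * ℓ i j|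
      ≤ ∑ k, ∑ l, (a k ^ 2 + a l ^ 2) / 2 * D :=
    (Finset.abs_sum_le_sum_abs _ _).trans (Finset.sum_le_sum fun k _ =>
      (Finset.abs_sum_le_sum_abs _ _).trans (Finset.sum_le_sum fun l _ => hterm k l))
  -- The factor `3` arises from `∑ₖₗ (aₖ² + aₗ²)/2 = 3 ∑ aₖ²`.
  refine (mul_le_mul_of_nonneg_left hsum hn.le).trans (le_of_eq ?_)
  simp only [Fin.sum_univ_three]
  ring

end FoliatedSpacetime

/-! ### The volume measure in charts -/

section Volume

variable {S : Type*} [TopologicalSpace S] [ChartedSpace E3 S]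
  {c c' : OpenPartialHomeomorph S E3}

/-- The inverse chart is continuous on its target only, so one passes through the subtype. -/
lemma measurableSet_target_inter_preimage [MeasurableSpace S] [BorelSpace S] {A : Set S}
    (hA : MeasurableSet A) : MeasurableSet (c.target ∩ c.symm ⁻¹' A) := by
  have h1 : Measurable (c.target.domRestrict c.symm) :=
    (continuousOn_iff_continuous_domRestrict.1 c.symm.continuousOn).measurable
  have h2 := MeasurableSet.subtype_image c.open_target.measurableSet (h1 hA)
  convert h2 using 1
  ext y
  simp [and_comm]

lemma aemeasurable_symm [MeasurableSpace S] [BorelSpace S] :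
    AEMeasurable c.symm (volume.restrict c.target) :=
  c.symm.continuousOn.aemeasurable c.open_target.measurableSet

/-- The volume measure of a chart. -/
def chartMeasure [MeasurableSpace S] (g : BilinField S) (c : OpenPartialHomeomorph S E3) :
    Measure S :=
  Measure.map c.symm ((volume.restrict c.target).withDensity
      fun y => ENNReal.ofReal (Real.sqrt (gram g c y).det))

lemma chartMeasure_apply [MeasurableSpace S] [BorelSpace S] (g : BilinField S) {A : Set S}
    (hA : MeasurableSet A) : chartMeasure g c A
      = ∫⁻ y in c.target ∩ c.symm ⁻¹' A, ENNReal.ofReal (Real.sqrt (gram g c y).det) := by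
  rw [chartMeasure, Measure.map_apply_of_aemeasurable
    (aemeasurable_symm.mono_ac (withDensity_absolutelyContinuous _ _)) hA, withDensity_apply',
    Measure.restrict_restrict' c.open_target.measurableSet, Set.inter_comm]

lemma det_fderiv_trans {y : E3} : (fderiv ℝ (trans c c') y).det = (transJac c c' y).det := by
  rw [ContinuousLinearMap.det, ← LinearMap.det_toMatrix (EuclideanSpace.basisFun (Fin 3) ℝ).toBasis]
  congr 1

variable [IsManifold 𝓘(ℝ, E3) ∞ S]

/-- Change of variables: `√det g` acquires the factor `|det J|` under the transformation law of the
metric, exactly the Jacobian factor. -/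
lemma chartMeasure_change [MeasurableSpace S] [BorelSpace S]
    (hc : c ∈ IsManifold.maximalAtlas 𝓘(ℝ, E3) ∞ S)
    (hc' : c' ∈ IsManifold.maximalAtlas 𝓘(ℝ, E3) ∞ S) (g : BilinField S) {A : Set S}
    (hA : MeasurableSet A) (hAc : A ⊆ c.source) (hAc' : A ⊆ c'.source) :
    chartMeasure g c A = chartMeasure g c' A := by
  have hsub : c.target ∩ c.symm ⁻¹' A ⊆ transDom c c' := fun y hy => ⟨hy.1, hAc' hy.2⟩
  have himg : trans c c' '' (c.target ∩ c.symm ⁻¹' A) = c'.target ∩ c'.symm ⁻¹' A := by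
    ext z
    constructor
    · rintro ⟨y, hy, rfl⟩
      refine ⟨trans_mem (hsub hy), ?_⟩
      rw [Set.mem_preimage, symm_trans (hsub hy)]
      exact hy.2
    · rintro ⟨hz, hzA⟩
      refine ⟨c (c'.symm z), ⟨c.map_source (hAc hzA), ?_⟩, ?_⟩
      · rw [Set.mem_preimage, c.left_inv (hAc hzA)]
        exact hzA
      · rw [trans, c.left_inv (hAc hzA), c'.right_inv hz]
  have hinj : Set.InjOn (trans c c') (c.target ∩ c.symm ⁻¹' A) := by
    intro y hy z hz h
    have h1 : c.symm y = c.symm z := by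
      rw [← symm_trans (hsub hy), ← symm_trans (hsub hz), h]
    exact c.symm.injOn hy.1 hz.1 h1
  rw [chartMeasure_apply g hA, chartMeasure_apply g hA, ← himg,
    lintegral_image_eq_lintegral_abs_det_fderiv_mul volume (measurableSet_target_inter_preimage hA)
      (fun y hy => ((((smooth_trans hc hc').contDiffAt
        (isOpen_transDom.mem_nhds (hsub hy))).differentiableAt
          (by simp)).hasFDerivAt).hasFDerivWithinAt) hinj]
  refine setLIntegral_congr_fun (measurableSet_target_inter_preimage hA) fun y hy => ?_
  rw [gram_trans hc hc' g (hsub hy), ← ENNReal.ofReal_mul (abs_nonneg _), det_fderiv_trans]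
  congr 1
  rw [Matrix.det_mul, Matrix.det_mul, Matrix.det_transpose, mul_right_comm, ← pow_two,
    Real.sqrt_mul (sq_nonneg _), Real.sqrt_sq_eq_abs]

/-- The volume measure of a chart lives on the domain of the chart. -/
lemma chartMeasure_inter [MeasurableSpace S] [BorelSpace S] (g : BilinField S) {A : Set S}
    (hA : MeasurableSet A) : chartMeasure g c (A ∩ c.source) = chartMeasure g c A := by
  rw [chartMeasure_apply g hA, chartMeasure_apply g (hA.inter c.open_source.measurableSet)]
  congr 2
  ext y
  simp only [Set.preimage_inter, Set.mem_inter_iff, Set.mem_preimage]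
  exact ⟨fun h => ⟨h.1, h.2.1⟩, fun h => ⟨h.1, h.2, c.map_target h.1⟩⟩

/-- On the domain of a chart the volume measure is that of the chart. -/
lemma riemVolume_restrict [MeasurableSpace S] [BorelSpace S] (g : BilinField S)
    (hc : c ∈ atlas E3 S) : (riemVolume g).restrict c.source = chartMeasure g c := by
  have hms : MeasurableSet c.source := c.open_source.measurableSet
  -- Split each chart measure along `c.source`. Inside it agrees with the measure of `c` on the
  -- overlap, and outside it is at most the supremum. The bound is uniform in the chart, hence
  -- passes to the supremum.
  have hle : riemVolume g ≤ chartMeasure g c + (riemVolume g).restrict c.sourceᶜ := by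
    refine iSup₂_le fun c' hc' => ?_
    have h0 : chartMeasure g c' ≤ riemVolume g :=
      le_iSup₂ (f := fun c (_ : c ∈ atlas E3 S) => chartMeasure g c) c' hc'
    refine Measure.le_iff.2 fun A hA => ?_
    change chartMeasure g c' A ≤ _
    rw [← measure_inter_add_sdiff A hms, Measure.add_apply,
      Measure.restrict_apply hA, ← Set.sdiff_eq]
    refine add_le_add ?_ (h0 _)
    rw [← chartMeasure_inter g (hA.inter hms)]
    rw [chartMeasure_change (IsManifold.subset_maximalAtlas hc') (IsManifold.subset_maximalAtlas hc)
      g ((hA.inter hms).inter c'.open_source.measurableSet) Set.inter_subset_right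
      fun x hx => hx.1.2]
    exact measure_mono fun x hx => hx.1.1
  refine le_antisymm ?_ ?_
  · refine Measure.le_iff.2 fun A hA => ?_
    rw [Measure.restrict_apply hA]
    refine (hle _).trans ?_
    rw [Measure.add_apply, Measure.restrict_apply (hA.inter hms), Set.inter_assoc,
      Set.inter_compl_self, Set.inter_empty, measure_empty, add_zero]
    exact measure_mono Set.inter_subset_left
  · refine Measure.le_iff.2 fun A hA => ?_
    rw [Measure.restrict_apply hA, ← chartMeasure_inter g hA]
    exact le_iSup₂ (f := fun c (_ : c ∈ atlas E3 S) => chartMeasure g c) c hc _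

/-- The extension by zero of a function given in a chart. -/
def liftChart (c : OpenPartialHomeomorph S E3) (u : E3 → ℝ) (x : S) : ℝ :=
  open scoped Classical in if x ∈ c.source then u (c x) else 0

omit [ChartedSpace E3 S] [IsManifold 𝓘(ℝ, E3) ∞ S] in
lemma liftChart_of_mem {u : E3 → ℝ} {x : S} (hx : x ∈ c.source) : liftChart c u x = u (c x) := by
  simp [liftChart, hx]

omit [ChartedSpace E3 S] [IsManifold 𝓘(ℝ, E3) ∞ S] in
lemma liftChart_of_notMem {u : E3 → ℝ} {x : S} (hx : x ∉ c.source) : liftChart c u x = 0 := by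
  simp [liftChart, hx]

/-- Integrals of functions supported in the domain of a chart, in coordinates. -/
lemma integral_liftChart [MeasurableSpace S] [BorelSpace S] {g : BilinField S}
    (hc : c ∈ atlas E3 S)
    (hg : ContinuousOn (fun y => Real.sqrt (gram g c y).det) c.target) {u : E3 → ℝ}
    (hu : ContinuousOn u c.target) {L : Set E3} (hL : IsCompact L) (hLc : L ⊆ c.target)
    (huL : ∀ y ∉ L, u y = 0) :
    Integrable (liftChart c u) (riemVolume g) ∧
    ∫ x, liftChart c u x ∂riemVolume g = ∫ y, u y * Real.sqrt (gram g c y).det := by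
  have hmt : MeasurableSet c.target := c.open_target.measurableSet
  have hms : MeasurableSet c.source := c.open_source.measurableSet
  have hfc : ContinuousOn (liftChart c u) c.source :=
    (hu.comp c.continuousOn c.mapsTo).congr fun x hx => liftChart_of_mem hx
  have hf : AEStronglyMeasurable (liftChart c u) (chartMeasure g c) := by
    rw [← riemVolume_restrict g hc]
    exact hfc.aestronglyMeasurable hms
  have hsymm : AEMeasurable c.symm ((volume.restrict c.target).withDensity
      fun y => ENNReal.ofReal (Real.sqrt (gram g c y).det)) :=
    aemeasurable_symm.mono_ac (withDensity_absolutelyContinuous _ _)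
  have hd : AEMeasurable (fun y => (Real.sqrt (gram g c y).det).toNNReal)
      (volume.restrict c.target) := (hg.aemeasurable hmt).real_toNNReal
  have hprod : ∀ y ∈ c.target, (Real.sqrt (gram g c y).det).toNNReal • liftChart c u (c.symm y)
      = u y * Real.sqrt (gram g c y).det := fun y hy => by
    rw [liftChart_of_mem (c.map_target hy), c.right_inv hy, NNReal.smul_def,
      Real.coe_toNNReal _ (Real.sqrt_nonneg _), smul_eq_mul, mul_comm]
  have hzero : ∀ x ∉ c.source, liftChart c u x = 0 := fun x hx => liftChart_of_notMem hx
  have hzero' : ∀ y ∉ c.target, u y * Real.sqrt (gram g c y).det = 0 := fun y hy => by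
    rw [huL y fun h => hy (hLc h), zero_mul]
  constructor
  · rw [← integrableOn_iff_integrable_of_support_subset (s := c.source)
      (fun x hx => by_contra fun h => hx (hzero x h)), IntegrableOn, riemVolume_restrict g hc,
      chartMeasure, integrable_map_measure hf hsymm]
    refine (integrable_withDensity_iff_integrable_smul₀ hd).2 ?_
    have h1 : IntegrableOn (fun y => u y * Real.sqrt (gram g c y).det) c.target := by
      have h2 : IntegrableOn (fun y => u y * Real.sqrt (gram g c y).det) L :=
        ((hu.mul hg).mono hLc).integrableOn_compact hL
      exact ((integrableOn_iff_integrable_of_support_subset fun y hy => by_contra fun h => hy (by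
        simp [huL y h])).1 h2).integrableOn
    exact (integrableOn_congr_fun (fun y hy => (hprod y hy).symm) hmt).1 h1
  · rw [← setIntegral_eq_integral_of_forall_compl_eq_zero hzero,
      ← setIntegral_eq_integral_of_forall_compl_eq_zero hzero', riemVolume_restrict g hc,
      chartMeasure, integral_map hsymm hf]
    have h := integral_withDensity_eq_integral_smul₀ (μ := volume.restrict c.target) hd
      (fun y => liftChart c u (c.symm y))
    exact h.trans (setIntegral_congr_fun hmt hprod)

end Volume

/-! ### Integrals over the leaves of functions with compact support in a chart -/

section ParametricIntegrals

variable {J : Set ℝ} {U L : Set E3} {f : Coord → ℝ}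

/-- A function vanishing off a fixed compact part of the chart range is smooth on all of space,
which permits differentiation and integration over `E3`. -/
lemma contDiffOn_of_zero_off (hJ : IsOpen J) (hU : IsOpen U) (hL : IsCompact L) (hLU : L ⊆ U)
    (hf : ContDiffOn ℝ ∞ f (J ×ˢ U)) (h0 : ∀ p : Coord, p.2 ∉ L → f p = 0) :
    ContDiffOn ℝ ∞ f (J ×ˢ Set.univ) := by
  intro p hp
  by_cases hpL : p.2 ∈ L
  · exact (hf.contDiffAt ((hJ.prod hU).mem_nhds ⟨hp.1, hLU hpL⟩)).contDiffWithinAt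
  · have hev : f =ᶠ[𝓝 p] fun _ => 0 :=
      Filter.eventually_of_mem ((hL.isClosed.isOpen_compl.preimage continuous_snd).mem_nhds hpL)
        fun q hq => h0 q hq
    exact (contDiffAt_const.congr_of_eventuallyEq hev).contDiffWithinAt

lemma continuousOn_of_zero_off {J : Set ℝ} (hU : IsOpen U) (hL : IsCompact L) (hLU : L ⊆ U)
    (hf : ContinuousOn f (J ×ˢ U)) (h0 : ∀ p : Coord, p.2 ∉ L → f p = 0) :
    ContinuousOn f (J ×ˢ Set.univ) := by
  intro p hp
  by_cases hpL : p.2 ∈ L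
  · refine (hf p ⟨hp.1, hLU hpL⟩).mono_of_mem_nhdsWithin ?_
    have h1 : J ×ˢ U = (J ×ˢ Set.univ) ∩ (Prod.snd ⁻¹' U : Set Coord) := by ext; simp
    rw [h1]
    exact inter_mem_nhdsWithin _ ((hU.preimage continuous_snd).mem_nhds (hLU hpL))
  · have hev : f =ᶠ[𝓝 p] fun _ => 0 :=
      Filter.eventually_of_mem ((hL.isClosed.isOpen_compl.preimage continuous_snd).mem_nhds hpL)
        fun q hq => h0 q hq
    exact (continuousAt_const.congr hev.symm).continuousWithinAt

lemma continuous_slice (hf : ContinuousOn f (J ×ˢ Set.univ)) {s : ℝ} (hs : s ∈ J) :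
    Continuous fun y => f (s, y) := by
  rw [← continuousOn_univ]
  exact hf.comp (by fun_prop) fun y _ => ⟨hs, Set.mem_univ _⟩

lemma integrable_slice (hL : IsCompact L) (hf : ContinuousOn f (J ×ˢ Set.univ))
    (h0 : ∀ p : Coord, p.2 ∉ L → f p = 0) {s : ℝ} (hs : s ∈ J) :
    Integrable fun y => f (s, y) :=
  (continuous_slice hf hs).integrable_of_hasCompactSupport
    (HasCompactSupport.intro hL fun y hy => h0 (s, y) hy)

lemma continuousOn_integral_slice (hL : IsCompact L) (hf : ContinuousOn f (J ×ˢ Set.univ))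
    (h0 : ∀ p : Coord, p.2 ∉ L → f p = 0) : ContinuousOn (fun s => ∫ y, f (s, y)) J :=
  continuousOn_integral_of_compact_support (f := fun s y => f (s, y)) hL hf
    fun s y _ hy => h0 (s, y) hy

lemma pd_zero_off (hL : IsCompact L) (h0 : ∀ p : Coord, p.2 ∉ L → f p = 0) (μ : Idx) (p : Coord)
    (hp : p.2 ∉ L) : pd μ f p = 0 := by
  have hev : f =ᶠ[𝓝 p] fun _ => 0 :=
    Filter.eventually_of_mem ((hL.isClosed.isOpen_compl.preimage continuous_snd).mem_nhds hp)
      fun q hq => h0 q hq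
  simp [pd, hev.fderiv_eq]

lemma hasDerivAt_time_slice {s : ℝ} {y : E3} (hf : DifferentiableAt ℝ f (s, y)) :
    HasDerivAt (fun s => f (s, y)) (pd tIdx f (s, y)) s := by
  have h1 : HasDerivAt (fun s : ℝ => ((s, y) : Coord)) (1, 0) s :=
    (hasDerivAt_id s).prodMk (hasDerivAt_const s y)
  exact hf.hasFDerivAt.comp_hasDerivAt s h1

lemma hasFDerivAt_space_slice {s : ℝ} {y : E3} (hf : DifferentiableAt ℝ f (s, y)) :
    HasFDerivAt (fun y => f (s, y)) ((fderiv ℝ f (s, y)).comp (.inr ℝ ℝ E3)) y :=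
  hf.hasFDerivAt.comp y (hasFDerivAt_prodMk_right s y)

lemma pd_space_slice {s : ℝ} {y : E3} (hf : DifferentiableAt ℝ f (s, y)) (k : Fin 3) :
    fderiv ℝ (fun y => f (s, y)) y (EuclideanSpace.single k 1) = pd (.inr k) f (s, y) := by
  rw [(hasFDerivAt_space_slice hf).fderiv]
  rfl

/-- Differentiation under the integral sign. -/
lemma hasDerivAt_integral_slice (hJ : IsOpen J) (hL : IsCompact L)
    (hf : ContDiffOn ℝ ∞ f (J ×ˢ Set.univ)) (h0 : ∀ p : Coord, p.2 ∉ L → f p = 0) {s : ℝ}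
    (hs : s ∈ J) : HasDerivAt (fun s => ∫ y, f (s, y)) (∫ y, pd tIdx f (s, y)) s := by
  have hJu : IsOpen (J ×ˢ (Set.univ : Set E3)) := hJ.prod isOpen_univ
  have hpd : ContinuousOn (pd tIdx f) (J ×ˢ Set.univ) := (smoothOn_pd hJu hf tIdx).continuousOn
  obtain ⟨ε, hε, hball⟩ := Metric.nhds_basis_closedBall.mem_iff.1 (hJ.mem_nhds hs)
  -- The dominating function is the maximum of the time derivative on this compact set, times the
  -- indicator of `L`.
  have hK : IsCompact (Metric.closedBall s ε ×ˢ L) := (isCompact_closedBall s ε).prod hL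
  obtain ⟨B, hB⟩ := hK.exists_bound_of_continuousOn
    (hpd.mono (Set.prod_mono hball (Set.subset_univ L)))
  refine (hasDerivAt_integral_of_dominated_loc_of_deriv_le (μ := volume)
    (F := fun s y => f (s, y)) (F' := fun s y => pd tIdx f (s, y))
    (bound := L.indicator fun _ => B) (Metric.closedBall_mem_nhds s hε)
    (Filter.eventually_of_mem (hJ.mem_nhds hs) fun x hx =>
      (continuous_slice hf.continuousOn hx).aestronglyMeasurable)
    (integrable_slice hL hf.continuousOn h0 hs)
    (continuous_slice hpd hs).aestronglyMeasurable
    (Filter.Eventually.of_forall fun y x hx => ?_)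
    ((integrable_indicator_iff hL.measurableSet).2 (integrableOn_const hL.measure_ne_top))
    (Filter.Eventually.of_forall fun y x hx => ?_)).2
  · by_cases hy : y ∈ L
    · rw [Set.indicator_of_mem hy]
      exact hB (x, y) ⟨hx, hy⟩
    · rw [Set.indicator_of_notMem hy, pd_zero_off hL h0 _ _ hy, norm_zero]
  · exact hasDerivAt_time_slice (smoothOn_diffAt hJu ⟨hball hx, Set.mem_univ _⟩ hf)

/-- The divergence theorem for functions with compact support. -/
lemma integral_pd_slice (hJ : IsOpen J) (hL : IsCompact L)
    (hf : ContDiffOn ℝ ∞ f (J ×ˢ Set.univ)) (h0 : ∀ p : Coord, p.2 ∉ L → f p = 0) {s : ℝ}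
    (hs : s ∈ J) (k : Fin 3) : ∫ y, pd (.inr k) f (s, y) = 0 := by
  have hJu : IsOpen (J ×ˢ (Set.univ : Set E3)) := hJ.prod isOpen_univ
  have hd : ∀ y, DifferentiableAt ℝ f (s, y) := fun y =>
    smoothOn_diffAt hJu ⟨hs, Set.mem_univ _⟩ hf
  have hi : Integrable fun y => pd (.inr k) f (s, y) :=
    integrable_slice hL (smoothOn_pd hJu hf _).continuousOn (pd_zero_off hL h0 _) hs
  -- Integration by parts against the constant `1`.
  have h := integral_mul_fderiv_eq_neg_fderiv_mul_of_integrable (μ := (volume : Measure E3))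
    (f := fun _ => (1 : ℝ)) (g := fun y => f (s, y)) (v := EuclideanSpace.single k 1)
    (by simp) (by simpa only [one_mul, pd_space_slice (hd _)] using hi)
    (by simpa only [one_mul] using integrable_slice hL hf.continuousOn h0 hs)
    (fun _ _ => differentiableAt_const _) fun y _ => (hasFDerivAt_space_slice (hd y)).differentiableAt
  simpa [pd_space_slice (hd _)] using h

end ParametricIntegrals

/-! ### The localized energy inequality -/

section Gradient

variable {S : Type*} [TopologicalSpace S] [ChartedSpace E3 S] {c c' : OpenPartialHomeomorph S E3}

/-- The differential of a function in a chart. -/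
def grad (c : OpenPartialHomeomorph S E3) (u : S → ℝ) (y : E3) (k : Fin 3) : ℝ :=
  fderiv ℝ (fun z => u (c.symm z)) y (EuclideanSpace.single k 1)

lemma grad_eq_zero {u : S → ℝ} {y : E3} {a : ℝ} (hy : y ∈ c.target)
    (hu : u =ᶠ[𝓝 (c.symm y)] fun _ => a) (k : Fin 3) : grad c u y k = 0 := by
  have h : (fun z => u (c.symm z)) =ᶠ[𝓝 y] fun _ => a :=
    (c.symm.continuousAt hy).eventually hu
  simp [grad, h.fderiv_eq]

variable [IsManifold 𝓘(ℝ, E3) ∞ S]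

lemma smooth_comp_symm (hc : c ∈ IsManifold.maximalAtlas 𝓘(ℝ, E3) ∞ S) {u : S → ℝ}
    (hu : ContMDiff 𝓘(ℝ, E3) 𝓘(ℝ) ∞ u) : ContDiffOn ℝ ∞ (fun z => u (c.symm z)) c.target := by
  rw [← contMDiffOn_iff_contDiffOn]
  exact hu.comp_contMDiffOn (contMDiffOn_symm_of_mem_maximalAtlas hc)

lemma diffAt_comp_symm (hc : c ∈ IsManifold.maximalAtlas 𝓘(ℝ, E3) ∞ S) {u : S → ℝ}
    (hu : ContMDiff 𝓘(ℝ, E3) 𝓘(ℝ) ∞ u) {y : E3} (hy : y ∈ c.target) :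
    DifferentiableAt ℝ (fun z => u (c.symm z)) y :=
  ((smooth_comp_symm hc hu).contDiffAt (c.open_target.mem_nhds hy)).differentiableAt (by simp)

lemma grad_change (hc : c ∈ IsManifold.maximalAtlas 𝓘(ℝ, E3) ∞ S)
    (hc' : c' ∈ IsManifold.maximalAtlas 𝓘(ℝ, E3) ∞ S) {u : S → ℝ}
    (hu : ContMDiff 𝓘(ℝ, E3) 𝓘(ℝ) ∞ u) {y : E3} (hy : y ∈ transDom c c') (i : Fin 3) :
    grad c u y i = ∑ k, transJac c c' y k i * grad c' u (trans c c' y) k := by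
  have hev : (fun z => u (c.symm z)) =ᶠ[𝓝 y] (fun z => u (c'.symm z)) ∘ trans c c' :=
    Filter.eventually_of_mem (isOpen_transDom.mem_nhds hy) fun z hz => by
      simp [symm_trans hz]
  have hd : DifferentiableAt ℝ (trans c c') y :=
    ((smooth_trans hc hc').contDiffAt (isOpen_transDom.mem_nhds hy)).differentiableAt (by simp)
  rw [grad, hev.fderiv_eq, fderiv_comp y (diffAt_comp_symm hc' hu (trans_mem hy)) hd,
    ContinuousLinearMap.comp_apply,
    ← sum_single (fderiv ℝ (trans c c') y (EuclideanSpace.single i 1)), map_sum]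
  simp only [map_smul, smul_eq_mul]
  rfl

lemma grad_sum {ι : Type*} (s : Finset ι) (hc : c ∈ IsManifold.maximalAtlas 𝓘(ℝ, E3) ∞ S)
    {u : ι → S → ℝ} (hu : ∀ a, ContMDiff 𝓘(ℝ, E3) 𝓘(ℝ) ∞ (u a)) {y : E3} (hy : y ∈ c.target)
    (k : Fin 3) : grad c (fun x => ∑ a ∈ s, u a x) y k = ∑ a ∈ s, grad c (u a) y k := by
  rw [grad, fderiv_fun_sum fun a _ => diffAt_comp_symm hc (hu a) hy]
  simp [grad]

end Gradient

/-- A time dependent smooth cutoff function on the leaves with support in a fixed compact set. -/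
structure IsCutoff {S : Type*} [TopologicalSpace S] [ChartedSpace E3 S] (H : ℝ → S → ℝ)
    (K : Set S) : Prop where
  smooth : ∀ c ∈ atlas E3 S, ContDiffOn ℝ ∞ (fun p : Coord => H p.1 (c.symm p.2))
    (Set.univ ×ˢ c.target)
  nonneg : ∀ t x, 0 ≤ H t x
  zero_off : ∀ t, ∀ x ∉ K, H t x = 0
  isCompact : IsCompact K

section Cutoff

variable {S : Type*} [TopologicalSpace S] [ChartedSpace E3 S] {c : OpenPartialHomeomorph S E3}
  {H : ℝ → S → ℝ} {K : Set S} {χ : S → ℝ}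

/-- The product of a cutoff function and a function supported in the domain of a chart. -/
def cutIn (c : OpenPartialHomeomorph S E3) (χ : S → ℝ) (H : ℝ → S → ℝ) (p : Coord) : ℝ :=
  open scoped Classical in
    if p.2 ∈ c.target then χ (c.symm p.2) * H p.1 (c.symm p.2) else 0

lemma cutIn_of_mem {p : Coord} (hp : p.2 ∈ c.target) :
    cutIn c χ H p = χ (c.symm p.2) * H p.1 (c.symm p.2) := by simp [cutIn, hp]

/-- A compact set in the range of a chart that contains the support of `cutIn`. -/
def cutSet (c : OpenPartialHomeomorph S E3) (χ : S → ℝ) (K : Set S) : Set E3 :=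
  c '' (K ∩ tsupport χ)

lemma isCompact_cutSet (hχ : tsupport χ ⊆ c.source) (hK : IsCompact K) :
    IsCompact (cutSet c χ K) :=
  (hK.inter_right (isClosed_tsupport χ)).image_of_continuousOn
    (c.continuousOn.mono fun _ hx => hχ hx.2)

lemma cutSet_subset (hχ : tsupport χ ⊆ c.source) : cutSet c χ K ⊆ c.target := by
  rintro _ ⟨x, hx, rfl⟩
  exact c.map_source (hχ hx.2)

lemma notMem_of_notMem_cutSet {y : E3} (hy : y ∈ c.target) (hyL : y ∉ cutSet c χ K) :
    c.symm y ∉ K ∨ c.symm y ∉ tsupport χ := by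
  by_contra! h
  exact hyL ⟨c.symm y, h, c.right_inv hy⟩

lemma cutIn_zero_off (hH : IsCutoff H K) (p : Coord) (hp : p.2 ∉ cutSet c χ K) :
    cutIn c χ H p = 0 := by
  by_cases hpt : p.2 ∈ c.target
  · rw [cutIn_of_mem hpt]
    rcases notMem_of_notMem_cutSet hpt hp with h | h
    · rw [hH.zero_off _ _ h, mul_zero]
    · rw [image_eq_zero_of_notMem_tsupport h, zero_mul]
  · simp [cutIn, hpt]

lemma smooth_cutIn [IsManifold 𝓘(ℝ, E3) ∞ S] (hc : c ∈ atlas E3 S) (hH : IsCutoff H K)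
    (hχ : ContMDiff 𝓘(ℝ, E3) 𝓘(ℝ) ∞ χ) :
    ContDiffOn ℝ ∞ (cutIn c χ H) (Set.univ ×ˢ c.target) :=
  (((smooth_comp_symm (IsManifold.subset_maximalAtlas hc) hχ).comp contDiffOn_snd
    fun _ hp => hp.2).mul (hH.smooth c hc)).congr fun _ hp => cutIn_of_mem hp.2

end Cutoff

/-! ### The localized energy law in one chart. -/

namespace FoliatedSpacetime

variable {S : Type*} [TopologicalSpace S] [ChartedSpace E3 S] {I : Set ℝ}
  (M : FoliatedSpacetime S I) {c c' : OpenPartialHomeomorph S E3}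
  {H : ℝ → S → ℝ} {K : Set S} {χ : S → ℝ} {N₀ D σ : ℝ}

/-- The energy density with cutoffs in a chart. -/
def cutEnergy (c : OpenPartialHomeomorph S E3) (χ : S → ℝ) (H : ℝ → S → ℝ) (p : Coord) : ℝ :=
  cutIn c χ H p * (M.volIn c p * M.energyIn c p)

/-- The flux through the level sets of a function supported in the domain of a chart. -/
def cutFlux (c : OpenPartialHomeomorph S E3) (χ : S → ℝ) (H : ℝ → S → ℝ) (p : Coord) : ℝ :=
  open scoped Classical in if p.2 ∈ c.target then
    M.lapseIn c p * H p.1 (c.symm p.2) * M.flux c p (grad c χ p.2) else 0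

lemma cutFlux_of_mem {p : Coord} (hp : p.2 ∈ c.target) : M.cutFlux c χ H p
    = M.lapseIn c p * H p.1 (c.symm p.2) * M.flux c p (grad c χ p.2) := by simp [cutFlux, hp]

variable [IsManifold 𝓘(ℝ, E3) ∞ S]

lemma flux_zero (p : Coord) {w : Fin 3 → ℝ} (hw : ∀ k, w k = 0) : M.flux c p w = 0 := by
  rw [M.flux_eq]
  exact Finset.sum_eq_zero fun k _ => by rw [hw k, zero_mul]

lemma cutFlux_zero_off (hH : IsCutoff H K) (p : Coord) (hp : p.2 ∉ cutSet c χ K) :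
    M.cutFlux c χ H p = 0 := by
  by_cases hpt : p.2 ∈ c.target
  · rw [M.cutFlux_of_mem hpt]
    rcases notMem_of_notMem_cutSet hpt hp with h | h
    · rw [hH.zero_off _ _ h, mul_zero, zero_mul]
    · rw [M.flux_zero p fun k => grad_eq_zero hpt (notMem_tsupport_iff_eventuallyEq.1 h) k, mul_zero]
  · simp [cutFlux, hpt]

lemma continuousOn_cutFlux (hc : c ∈ atlas E3 S) (hH : IsCutoff H K)
    (hχ : ContMDiff 𝓘(ℝ, E3) 𝓘(ℝ) ∞ χ) {s : ℝ} (hs : s ∈ interior I) :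
    ContinuousOn (fun y => M.cutFlux c χ H (s, y)) c.target := by
  have hmap : Set.MapsTo (fun y : E3 => ((s, y) : Coord)) c.target (coordDom I c) :=
    fun y hy => ⟨hs, hy⟩
  have hmap' : Set.MapsTo (fun y : E3 => ((s, y) : Coord)) c.target (Set.univ ×ˢ c.target) :=
    fun y hy => ⟨Set.mem_univ _, hy⟩
  have hcont : ContinuousOn (fun y : E3 => ((s, y) : Coord)) c.target := by fun_prop
  have h1 : ContinuousOn (fun y => M.lapseIn c (s, y) * H s (c.symm y)
      * ∑ k, grad c χ y k * M.fluxVec c k (s, y)) c.target := by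
    refine (((M.smooth_lapseIn hc).continuousOn.comp hcont hmap).mul
      ((hH.smooth c hc).continuousOn.comp hcont hmap')).mul
      (continuousOn_finsetSum _ fun k _ => ContinuousOn.mul ?_
        ((M.smooth_fluxVec hc k).continuousOn.comp hcont hmap))
    exact (((smooth_comp_symm (IsManifold.subset_maximalAtlas hc) hχ).continuousOn_fderiv_of_isOpen
      c.open_target (by simp)).clm_apply continuousOn_const)
  exact h1.congr fun y hy => by rw [M.cutFlux_of_mem hy, M.flux_eq]

lemma smooth_cutEnergy (hc : c ∈ atlas E3 S) (hH : IsCutoff H K)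
    (hχ : ContMDiff 𝓘(ℝ, E3) 𝓘(ℝ) ∞ χ) :
    ContDiffOn ℝ ∞ (M.cutEnergy c χ H) (coordDom I c) :=
  ((smooth_cutIn hc hH hχ).mono (Set.prod_mono (Set.subset_univ _) subset_rfl)).mul
    ((M.smooth_volIn hc).mul (M.smooth_energyIn hc))

lemma continuousOn_cutEnergy (hc : c ∈ atlas E3 S) (hH : IsCutoff H K)
    (hχ : ContMDiff 𝓘(ℝ, E3) 𝓘(ℝ) ∞ χ) :
    ContinuousOn (M.cutEnergy c χ H) (I ×ˢ c.target) :=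
  ((smooth_cutIn hc hH hχ).continuousOn.mono (Set.prod_mono (Set.subset_univ _) subset_rfl)).mul
    ((M.continuousOn_volIn hc).mul (M.continuousOn_energyIn hc))

lemma cutEnergy_zero_off (hH : IsCutoff H K) (p : Coord) (hp : p.2 ∉ cutSet c χ K) :
    M.cutEnergy c χ H p = 0 := by
  rw [cutEnergy, cutIn_zero_off hH p hp, zero_mul]

/-- The cutoff `H` decreases fast enough along the time direction `σ` to absorb the flux through
its level sets. -/
def Absorbs (H : ℝ → S → ℝ) (J : Set ℝ) (σ : ℝ) : Prop :=
  ∀ c ∈ atlas E3 S, ∀ p : Coord, p.1 ∈ J → p.2 ∈ c.target →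
    σ * (pd tIdx (fun q : Coord => H q.1 (c.symm q.2)) p * M.energyIn c p
      - 4 * (M.lapseIn c p * M.flux c p (grad c (H p.1) p.2))) ≤ 0

/-- The energy identity with cutoffs, before integration. -/
lemma cutEnergy_law_le (hvac : M.IsVacuum) (hc : c ∈ atlas E3 S) (hH : IsCutoff H K)
    (hχ : ContMDiff 𝓘(ℝ, E3) 𝓘(ℝ) ∞ χ) (hχ0 : ∀ x, 0 ≤ χ x) {J : Set ℝ}
    (habs : M.Absorbs H J σ) (hσ : |σ| = 1) {p : Coord}
    (hp : p ∈ coordDom I c) (hpJ : p.1 ∈ J) (hN : M.lapseIn c p ≤ N₀)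
    (hD0 : 0 ≤ D) (hD : M.deformationNorm p.1 (c.symm p.2) ≤ D) :
    σ * (pd tIdx (M.cutEnergy c χ H) p - 4 * ∑ k : Fin 3, pd (.inr k)
        (fun q => cutIn c χ H q * (M.lapseIn c q * M.volIn c q * M.fluxVec c k q)) p)
      ≤ 36000 * N₀ * D * M.cutEnergy c χ H p
        - 4 * σ * (M.cutFlux c χ H p * M.volIn c p) := by
  have hU := isOpen_coordDom (I := I) (c := c)
  have hcm : c ∈ IsManifold.maximalAtlas 𝓘(ℝ, E3) ∞ S := IsManifold.subset_maximalAtlas hc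
  have hpu : p ∈ (Set.univ : Set ℝ) ×ˢ c.target := ⟨Set.mem_univ _, hp.2⟩
  have hUu : IsOpen ((Set.univ : Set ℝ) ×ˢ c.target) := isOpen_univ.prod c.open_target
  have dcut := smoothOn_diffAt hUu hpu (smooth_cutIn hc hH hχ)
  have dH := smoothOn_diffAt hUu hpu (hH.smooth c hc)
  have dχ : DifferentiableAt ℝ (fun q : Coord => χ (c.symm q.2)) p :=
    (diffAt_comp_symm hcm hχ hp.2).comp p differentiableAt_snd
  have dvol := smoothOn_diffAt hU hp (M.smooth_volIn hc)
  have den := smoothOn_diffAt hU hp (M.smooth_energyIn hc)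
  have dn := smoothOn_diffAt hU hp (M.smooth_lapseIn hc)
  have dJ := fun k => smoothOn_diffAt hU hp (M.smooth_fluxVec hc k)
  -- The gradient of the product cutoff has two parts. The part with `χ dH` is absorbed by `∂_t H`,
  -- while the part with `H dχ` is kept as a flux that cancels when summed over a partition of
  -- unity.
  have hcut : ∀ μ, pd μ (cutIn c χ H) p = pd μ (fun q => χ (c.symm q.2)) p * H p.1 (c.symm p.2)
      + χ (c.symm p.2) * pd μ (fun q : Coord => H q.1 (c.symm q.2)) p := fun μ => by
    rw [← pd_mul μ dχ dH]
    exact pd_congr_on μ hUu hpu fun q hq => cutIn_of_mem hq.2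
  have hχt : pd tIdx (fun q : Coord => χ (c.symm q.2)) p = 0 := by
    have h := (hasDerivAt_time_slice (f := fun q : Coord => χ (c.symm q.2)) (s := p.1) (y := p.2)
      dχ).deriv
    simpa using h.symm
  have hχk : ∀ k, pd (.inr k) (fun q : Coord => χ (c.symm q.2)) p = grad c χ p.2 k := fun k =>
    (pd_space_slice (f := fun q : Coord => χ (c.symm q.2)) (s := p.1) (y := p.2) dχ k).symm
  have hHk : ∀ k, pd (.inr k) (fun q : Coord => H q.1 (c.symm q.2)) p = grad c (H p.1) p.2 k :=
    fun k => (pd_space_slice (f := fun q : Coord => H q.1 (c.symm q.2)) (s := p.1) (y := p.2)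
      dH k).symm
  have e1 : pd tIdx (M.cutEnergy c χ H) p = pd tIdx (cutIn c χ H) p * (M.volIn c p * M.energyIn c p)
      + cutIn c χ H p * pd tIdx (fun q => M.volIn c q * M.energyIn c q) p :=
    pd_mul tIdx dcut (dvol.fun_mul den)
  have e2 : ∀ k, pd (.inr k)
        (fun q => cutIn c χ H q * (M.lapseIn c q * M.volIn c q * M.fluxVec c k q)) p
      = pd (.inr k) (cutIn c χ H) p * (M.lapseIn c p * M.volIn c p * M.fluxVec c k p)
        + cutIn c χ H p * pd (.inr k) (fun q => M.lapseIn c q * M.volIn c q * M.fluxVec c k q) p :=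
    fun k => pd_mul _ dcut ((dn.fun_mul dvol).fun_mul (dJ k))
  have hlaw := M.abs_energy_law_le hvac hc hp (D := D) (by
    have h := M.deformationNorm_eq hc (c.map_target hp.2) hp.1
    rw [c.right_inv hp.2] at h
    exact h.symm.le.trans hD)
  have hn0 : 0 < M.lapseIn c p := M.lapse_pos p.1 (interior_subset hp.1) _
  have hvol := M.volIn_nonneg (c := c) p
  have hen := M.energyIn_nonneg (c := c) p
  have hcut0 : 0 ≤ cutIn c χ H p := by
    rw [cutIn_of_mem hp.2]
    exact mul_nonneg (hχ0 _) (hH.nonneg _ _)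
  have ha := habs c hc p hpJ hp.2
  rw [M.flux_eq] at ha
  rw [e1, M.cutFlux_of_mem hp.2, M.flux_eq, cutEnergy]
  simp only [e2, hcut, hχt, hχk, hHk, cutIn_of_mem hp.2, zero_mul, zero_add]
  rw [cutIn_of_mem hp.2] at hcut0
  set Z := χ (c.symm p.2) * H p.1 (c.symm p.2) with hZ
  set q0 := pd tIdx (fun q => M.volIn c q * M.energyIn c q) p
  set qk := fun k : Fin 3 => pd (.inr k) (fun q => M.lapseIn c q * M.volIn c q * M.fluxVec c k q) p
    with hqk
  -- Multiplying the energy law by `-4` normalizes the density to `|R|²`; thus `36000 = 4 · 9000`.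
  have hb : σ * (q0 - 4 * ∑ k, qk k) ≤ 36000 * N₀ * D * (M.volIn c p * M.energyIn c p) := by
    have h1 : |σ * (q0 - 4 * ∑ k, qk k)| = 4 * |-(1 / 4) * q0 + ∑ k, qk k| := by
      rw [abs_mul, hσ, one_mul, ← abs_neg, ← abs_of_pos (show (0 : ℝ) < 4 by norm_num), ← abs_mul,
        abs_of_pos (show (0 : ℝ) < 4 by norm_num)]
      congr 1
      ring
    have h2 : M.lapseIn c p * M.volIn c p * (9000 * D * M.energyIn c p)
        ≤ N₀ * M.volIn c p * (9000 * D * M.energyIn c p) := by gcongr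
    have h3 := le_abs_self (σ * (q0 - 4 * ∑ k, qk k))
    rw [h1] at h3
    linarith
  have hb' := mul_le_mul_of_nonneg_left hb hcut0
  have ha' := mul_le_mul_of_nonneg_left ha (mul_nonneg (hχ0 (c.symm p.2)) hvol)
  simp only [Fin.sum_univ_three] at hb' ha' ⊢
  simp only [hqk] at hb'
  linear_combination hb' + ha'

end FoliatedSpacetime

/-! ### Integration of the energy identity over the leaves -/

/-- Grönwall's inequality for a differential inequality in the interior of an interval. -/
lemma le_exp_mul_of_deriv_le {f f' : ℝ → ℝ} {κ a b : ℝ} (hab : a ≤ b)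
    (hf : ContinuousOn f (Set.Icc a b)) (hd : ∀ s ∈ Set.Ioo a b, HasDerivAt f (f' s) s)
    (hle : ∀ s ∈ Set.Ioo a b, f' s ≤ κ * f s) : f b ≤ Real.exp (κ * (b - a)) * f a := by
  have hanti : AntitoneOn (fun s => Real.exp (-(κ * s)) * f s) (Set.Icc a b) := by
    refine antitoneOn_of_hasDerivWithinAt_nonpos (convex_Icc a b)
      ((Continuous.continuousOn (by fun_prop)).mul hf)
      (f' := fun s => Real.exp (-(κ * s)) * -κ * f s + Real.exp (-(κ * s)) * f' s) ?_ ?_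
    · intro s hs
      rw [interior_Icc] at hs
      have h1 : HasDerivAt (fun s => Real.exp (-(κ * s))) (Real.exp (-(κ * s)) * -κ) s := by
        simpa using ((hasDerivAt_id s).const_mul κ).neg.exp
      exact (h1.mul (hd s hs)).hasDerivWithinAt
    · intro s hs
      rw [interior_Icc] at hs
      have := mul_le_mul_of_nonneg_left (hle s hs) (Real.exp_pos (-(κ * s))).le
      linarith
  have h := hanti (Set.left_mem_Icc.2 hab) (Set.right_mem_Icc.2 hab) hab
  have h2 := mul_le_mul_of_nonneg_left h (Real.exp_pos (κ * b)).le
  simp only at h2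
  rw [← mul_assoc, ← mul_assoc, ← Real.exp_add, ← Real.exp_add] at h2
  simpa [mul_add, sub_eq_add_neg] using h2

/-- The forward inequality with time reversed. -/
lemma le_exp_mul_of_le_deriv {f f' : ℝ → ℝ} {κ a b : ℝ} (hab : a ≤ b)
    (hf : ContinuousOn f (Set.Icc a b)) (hd : ∀ s ∈ Set.Ioo a b, HasDerivAt f (f' s) s)
    (hle : ∀ s ∈ Set.Ioo a b, -(κ * f s) ≤ f' s) : f a ≤ Real.exp (κ * (b - a)) * f b := by
  have h := le_exp_mul_of_deriv_le (f := fun s => f (-s)) (f' := fun s => -f' (-s)) (κ := κ)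
    (a := -b) (b := -a) (neg_le_neg hab)
    (hf.comp continuousOn_neg fun s hs => ⟨by linarith [hs.2], by linarith [hs.1]⟩)
    (fun s hs => by
      have h1 := (hd (-s) ⟨by linarith [hs.2], by linarith [hs.1]⟩).scomp s (hasDerivAt_neg s)
      simpa [Function.comp_def] using h1)
    fun s hs => by linarith [hle (-s) ⟨by linarith [hs.2], by linarith [hs.1]⟩]
  simpa [sub_eq_add_neg, add_comm] using h

/-! ### Integration over the leaves with a partition of unity. -/

namespace FoliatedSpacetime

variable {S : Type*} [TopologicalSpace S] [ChartedSpace E3 S] [IsManifold 𝓘(ℝ, E3) ∞ S]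
  {I : Set ℝ} (M : FoliatedSpacetime S I) {c : OpenPartialHomeomorph S E3}
  {H : ℝ → S → ℝ} {K : Set S} {χ : S → ℝ} {N₀ D σ : ℝ} {J : Set ℝ}

/-- The cutoff makes the spatial divergence compactly supported in the chart, so it integrates to
zero. -/
lemma integral_cutEnergy_deriv (hvac : M.IsVacuum) (hc : c ∈ atlas E3 S) (hH : IsCutoff H K)
    (hχ : ContMDiff 𝓘(ℝ, E3) 𝓘(ℝ) ∞ χ) (hχ0 : ∀ x, 0 ≤ χ x) (hχc : tsupport χ ⊆ c.source)
    (habs : M.Absorbs H J σ) (hσ : |σ| = 1) {s : ℝ} (hs : s ∈ interior I) (hsJ : s ∈ J)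
    (hN : ∀ x, M.lapse s x ≤ N₀) (hD0 : 0 ≤ D) (hD : ∀ x, M.deformationNorm s x ≤ D) :
    HasDerivAt (fun s => ∫ y, M.cutEnergy c χ H (s, y))
      (∫ y, pd tIdx (M.cutEnergy c χ H) (s, y)) s ∧
    σ * ∫ y, pd tIdx (M.cutEnergy c χ H) (s, y)
      ≤ 36000 * N₀ * D * (∫ y, M.cutEnergy c χ H (s, y))
        - 4 * σ * ∫ y, M.cutFlux c χ H (s, y) * M.volIn c (s, y) := by
  have hJu : IsOpen (interior I ×ˢ (Set.univ : Set E3)) := isOpen_interior.prod isOpen_univ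
  set L := cutSet c χ K with hL
  have hLc : IsCompact L := isCompact_cutSet hχc hH.isCompact
  have hLt : L ⊆ c.target := cutSet_subset hχc
  have hA0 := fun p => M.cutEnergy_zero_off (c := c) (χ := χ) hH p
  have hA : ContDiffOn ℝ ∞ (M.cutEnergy c χ H) (interior I ×ˢ Set.univ) :=
    contDiffOn_of_zero_off isOpen_interior c.open_target hLc hLt (M.smooth_cutEnergy hc hH hχ) hA0
  set B : Fin 3 → Coord → ℝ := fun k q =>
    cutIn c χ H q * (M.lapseIn c q * M.volIn c q * M.fluxVec c k q) with hBdef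
  have hB0 : ∀ k, ∀ p : Coord, p.2 ∉ L → B k p = 0 := fun k p hp => by
    simp only [hBdef, cutIn_zero_off hH p hp, zero_mul]
  have hB : ∀ k, ContDiffOn ℝ ∞ (B k) (interior I ×ˢ Set.univ) := fun k =>
    contDiffOn_of_zero_off isOpen_interior c.open_target hLc hLt
      (((smooth_cutIn hc hH hχ).mono (Set.prod_mono (Set.subset_univ _) subset_rfl)).mul
        (((M.smooth_lapseIn hc).mul (M.smooth_volIn hc)).mul (M.smooth_fluxVec hc k))) (hB0 k)
  refine ⟨hasDerivAt_integral_slice isOpen_interior hLc hA hA0 hs, ?_⟩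
  have iA := integrable_slice hLc hA.continuousOn hA0 hs
  have iA' : Integrable fun y => pd tIdx (M.cutEnergy c χ H) (s, y) :=
    integrable_slice hLc (smoothOn_pd hJu hA tIdx).continuousOn (pd_zero_off hLc hA0 _) hs
  have iB : ∀ k, Integrable fun y => pd (.inr k) (B k) (s, y) := fun k =>
    integrable_slice hLc (smoothOn_pd hJu (hB k) _).continuousOn (pd_zero_off hLc (hB0 k) _) hs
  have iC : Integrable fun y => M.cutFlux c χ H (s, y) * M.volIn c (s, y) := by
    have hcont : ContinuousOn (fun y => M.cutFlux c χ H (s, y) * M.volIn c (s, y)) L :=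
      ((M.continuousOn_cutFlux hc hH hχ hs).mul ((M.continuousOn_volIn hc).comp (by fun_prop)
        fun y hy => ⟨interior_subset hs, hy⟩)).mono hLt
    exact (integrableOn_iff_integrable_of_support_subset fun y hy => by_contra fun h => hy (by
      simp [M.cutFlux_zero_off hH (s, y) h])).1 (hcont.integrableOn_compact hLc)
  have hpt : ∀ y, σ * (pd tIdx (M.cutEnergy c χ H) (s, y) - 4 * ∑ k : Fin 3, pd (.inr k) (B k) (s, y))
      ≤ 36000 * N₀ * D * M.cutEnergy c χ H (s, y)
        - 4 * σ * (M.cutFlux c χ H (s, y) * M.volIn c (s, y)) := by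
    intro y
    by_cases hy : y ∈ c.target
    · exact M.cutEnergy_law_le hvac hc hH hχ hχ0 habs hσ (p := (s, y)) ⟨hs, hy⟩ hsJ (hN _) hD0 (hD _)
    · have hyL : y ∉ L := fun h => hy (hLt h)
      rw [pd_zero_off hLc hA0 _ _ hyL, hA0 _ hyL, M.cutFlux_zero_off hH _ hyL]
      simp [pd_zero_off hLc (hB0 _) _ (s, y) hyL]
  have iS : Integrable fun y => ∑ k : Fin 3, pd (.inr k) (B k) (s, y) :=
    integrable_finsetSum _ fun k _ => iB k
  have hmono := integral_mono ((iA'.sub (iS.const_mul 4)).const_mul σ)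
    ((iA.const_mul (36000 * N₀ * D)).sub (iC.const_mul (4 * σ))) hpt
  simp only [Pi.sub_apply] at hmono
  rw [integral_const_mul, integral_sub iA' (iS.const_mul 4), integral_const_mul,
    integral_finsetSum _ fun k _ => iB k,
    Finset.sum_eq_zero fun k _ => integral_pd_slice isOpen_interior hLc (hB k) (hB0 k) hs k,
    integral_sub (iA.const_mul _) (iC.const_mul _), integral_const_mul, integral_const_mul] at hmono
  simpa using hmono

lemma continuousOn_sqrt_det (hc : c ∈ atlas E3 S) {s : ℝ} (hs : s ∈ I) :
    ContinuousOn (fun y => Real.sqrt (gram (M.metric s) c y).det) c.target :=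
  (M.continuousOn_volIn hc).comp (f := fun y : E3 => ((s, y) : Coord)) (by fun_prop)
    fun _ hy => ⟨hs, hy⟩

lemma continuousOn_cutIn_mul_energyIn (hc : c ∈ atlas E3 S) (hH : IsCutoff H K)
    (hχ : ContMDiff 𝓘(ℝ, E3) 𝓘(ℝ) ∞ χ) {s : ℝ} (hs : s ∈ I) :
    ContinuousOn (fun y => cutIn c χ H (s, y) * M.energyIn c (s, y)) c.target :=
  ((smooth_cutIn hc hH hχ).continuousOn.comp (f := fun y : E3 => ((s, y) : Coord)) (by fun_prop)
    fun _ hy => ⟨Set.mem_univ _, hy⟩).mul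
    ((M.continuousOn_energyIn hc).comp (f := fun y : E3 => ((s, y) : Coord)) (by fun_prop)
      fun _ hy => ⟨hs, hy⟩)

/-- A finite family of smooth functions, supported in the domains of charts, that add up to `1`
where a cutoff function does not vanish. -/
structure _root_.VacuumFoliation.IsPartition {ι : Type*} [Fintype ι]
    (c : ι → OpenPartialHomeomorph S E3) (χ : ι → S → ℝ) (H : ℝ → S → ℝ) : Prop where
  mem_atlas : ∀ a, c a ∈ atlas E3 S
  smooth : ∀ a, ContMDiff 𝓘(ℝ, E3) 𝓘(ℝ) ∞ (χ a)
  nonneg : ∀ a x, 0 ≤ χ a x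
  tsupport_subset : ∀ a, tsupport (χ a) ⊆ (c a).source
  sum_eq : ∀ t x, H t x ≠ 0 → (fun x => ∑ a, χ a x) =ᶠ[𝓝 x] fun _ => 1

variable {ι : Type*} [Fintype ι] {cc : ι → OpenPartialHomeomorph S E3} {χχ : ι → S → ℝ}

/-- Invariance of the flux moves all terms at `x` into one chart. There they pair a single vector
with the gradient of `∑ χ_a`, which is locally constant where `H` does not vanish. -/
lemma sum_liftChart_cutFlux (hP : IsPartition cc χχ H) {s : ℝ} (hs : s ∈ interior I) (x : S) :
    ∑ a, liftChart (cc a) (fun y => M.cutFlux (cc a) (χχ a) H (s, y)) x = 0 := by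
  by_cases hx : H s x = 0
  · refine Finset.sum_eq_zero fun a _ => ?_
    by_cases hxa : x ∈ (cc a).source
    · rw [liftChart_of_mem hxa, M.cutFlux_of_mem ((cc a).map_source hxa)]
      simp [(cc a).left_inv hxa, hx]
    · exact liftChart_of_notMem hxa
  · set c := chartAt E3 x with hc
    have hca : c ∈ atlas E3 S := chart_mem_atlas E3 x
    have hxc : x ∈ c.source := mem_chart_source E3 x
    have hcm : c ∈ IsManifold.maximalAtlas 𝓘(ℝ, E3) ∞ S := IsManifold.subset_maximalAtlas hca
    have hterm : ∀ a, liftChart (cc a) (fun y => M.cutFlux (cc a) (χχ a) H (s, y)) x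
        = M.lapse s x * H s x * ∑ k, grad c (χχ a) (c x) k * M.fluxVec c k (s, c x) := by
      intro a
      by_cases hxa : x ∈ (cc a).source
      · have hdom : cc a x ∈ transDom (cc a) c :=
          ⟨(cc a).map_source hxa, by simpa [(cc a).left_inv hxa] using hxc⟩
        have htr : trans (cc a) c (cc a x) = c x := by simp [trans, (cc a).left_inv hxa]
        rw [liftChart_of_mem hxa, M.cutFlux_of_mem ((cc a).map_source hxa)]
        have h1 : grad (cc a) (χχ a) (cc a x) = fun i => ∑ k, transJac (cc a) c (cc a x) k i
            * grad c (χχ a) (c x) k := by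
          funext i
          rw [grad_change (IsManifold.subset_maximalAtlas (hP.mem_atlas a)) hcm (hP.smooth a) hdom,
            htr]
        have h2 := M.flux_change (hP.mem_atlas a) hca (p := (s, cc a x)) ⟨hs, hdom⟩
          (grad c (χχ a) (c x))
        simp only at h2
        simp only [h1]
        rw [h2, spacetimeTrans, M.flux_eq]
        simp only [htr, lapseIn, (cc a).left_inv hxa]
      · have hz : ∀ k, grad c (χχ a) (c x) k = 0 := fun k => by
          refine grad_eq_zero (a := 0) (c.map_source hxc) ?_ k
          rw [c.left_inv hxc]
          exact notMem_tsupport_iff_eventuallyEq.1 fun h => hxa (hP.tsupport_subset a h)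
        rw [liftChart_of_notMem hxa]
        simp [hz]
    simp only [hterm]
    rw [← Finset.mul_sum, Finset.sum_comm]
    have hz : ∀ k, ∑ a, grad c (χχ a) (c x) k = 0 := fun k => by
      rw [← grad_sum Finset.univ hcm hP.smooth (c.map_source hxc)]
      refine grad_eq_zero (a := 1) (c.map_source hxc) ?_ k
      rw [c.left_inv hxc]
      exact hP.sum_eq s x hx
    simp [← Finset.sum_mul, hz]

lemma sum_liftChart_cutEnergy (hI : I.OrdConnected) (hIn : (interior I).Nonempty)
    (hP : IsPartition cc χχ H) {s : ℝ} (hs : s ∈ I) (x : S) :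
    ∑ a, liftChart (cc a) (fun y => cutIn (cc a) (χχ a) H (s, y) * M.energyIn (cc a) (s, y)) x
      = H s x * M.curvatureNorm s x ^ 2 := by
  have hterm : ∀ a, liftChart (cc a)
      (fun y => cutIn (cc a) (χχ a) H (s, y) * M.energyIn (cc a) (s, y)) x
        = χχ a x * (H s x * M.curvatureNorm s x ^ 2) := by
    intro a
    by_cases hxa : x ∈ (cc a).source
    · rw [liftChart_of_mem hxa, cutIn_of_mem ((cc a).map_source hxa),
        M.curvatureNorm_sq hI hIn (hP.mem_atlas a) hxa hs]
      simp only [(cc a).left_inv hxa, mul_assoc]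
    · rw [liftChart_of_notMem hxa, image_eq_zero_of_notMem_tsupport fun h =>
        hxa (hP.tsupport_subset a h), zero_mul]
  simp only [hterm]
  rw [← Finset.sum_mul]
  by_cases hx : H s x = 0
  · simp [hx]
  · rw [(hP.sum_eq s x hx).eq_of_nhds, one_mul]

variable [MeasurableSpace S] [BorelSpace S]

lemma integral_cutEnergy_eq (hI : I.OrdConnected) (hIn : (interior I).Nonempty)
    (hH : IsCutoff H K) (hP : IsPartition cc χχ H) {s : ℝ} (hs : s ∈ I) :
    Integrable (fun x => H s x * M.curvatureNorm s x ^ 2) (riemVolume (M.metric s)) ∧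
    ∫ x, H s x * M.curvatureNorm s x ^ 2 ∂riemVolume (M.metric s)
      = ∑ a, ∫ y, M.cutEnergy (cc a) (χχ a) H (s, y) := by
  have hint := fun a => integral_liftChart (g := M.metric s) (hP.mem_atlas a)
    (M.continuousOn_sqrt_det (hP.mem_atlas a) hs)
    (M.continuousOn_cutIn_mul_energyIn (hP.mem_atlas a) hH (hP.smooth a) hs)
    (isCompact_cutSet (hP.tsupport_subset a) hH.isCompact) (cutSet_subset (hP.tsupport_subset a))
    fun y hy => by rw [cutIn_zero_off hH (s, y) hy, zero_mul]
  have heq : (fun x => H s x * M.curvatureNorm s x ^ 2) = fun x => ∑ a, liftChart (cc a)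
      (fun y => cutIn (cc a) (χχ a) H (s, y) * M.energyIn (cc a) (s, y)) x :=
    funext fun x => (M.sum_liftChart_cutEnergy hI hIn hP hs x).symm
  rw [heq]
  refine ⟨integrable_finsetSum _ fun a _ => (hint a).1, ?_⟩
  rw [integral_finsetSum _ fun a _ => (hint a).1]
  refine Finset.sum_congr rfl fun a _ => (hint a).2.trans (integral_congr_ae
    (Filter.Eventually.of_forall fun y => ?_))
  simp only [cutEnergy, volIn]
  ring

lemma sum_integral_cutFlux (hH : IsCutoff H K) (hP : IsPartition cc χχ H) {s : ℝ}
    (hs : s ∈ interior I) :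
    ∑ a, ∫ y, M.cutFlux (cc a) (χχ a) H (s, y) * M.volIn (cc a) (s, y) = 0 := by
  have hint := fun a => integral_liftChart (g := M.metric s) (hP.mem_atlas a)
    (M.continuousOn_sqrt_det (hP.mem_atlas a) (interior_subset hs))
    (M.continuousOn_cutFlux (hP.mem_atlas a) hH (hP.smooth a) hs)
    (isCompact_cutSet (hP.tsupport_subset a) hH.isCompact) (cutSet_subset (hP.tsupport_subset a))
    fun y hy => M.cutFlux_zero_off hH (s, y) hy
  have h1 : ∑ a, ∫ y, M.cutFlux (cc a) (χχ a) H (s, y) * M.volIn (cc a) (s, y)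
      = ∑ a, ∫ x, liftChart (cc a) (fun y => M.cutFlux (cc a) (χχ a) H (s, y)) x
          ∂riemVolume (M.metric s) := Finset.sum_congr rfl fun a _ => (hint a).2.symm
  rw [h1, ← integral_finsetSum _ fun a _ => (hint a).1]
  simp [M.sum_liftChart_cutFlux hP hs]

/-- The localized energy inequality, forward in time for `σ = 1` and backward in time for
`σ = -1`. -/
lemma cutoff_energy_le (hI : I.OrdConnected) (hvac : M.IsVacuum) (hH : IsCutoff H K)
    (hP : IsPartition cc χχ H) {a b : ℝ} (hab : a < b) (ha : a ∈ I) (hb : b ∈ I)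
    (hN : ∀ s ∈ Set.Ioo a b, ∀ x, M.lapse s x ≤ N₀) (hD0 : 0 ≤ D)
    (hD : ∀ s ∈ Set.Ioo a b, ∀ x, M.deformationNorm s x ≤ D) :
    (M.Absorbs H (Set.Ioo a b) 1 →
      ∫ x, H b x * M.curvatureNorm b x ^ 2 ∂riemVolume (M.metric b)
        ≤ Real.exp (36000 * N₀ * D * (b - a))
          * ∫ x, H a x * M.curvatureNorm a x ^ 2 ∂riemVolume (M.metric a)) ∧
    (M.Absorbs H (Set.Ioo a b) (-1) →
      ∫ x, H a x * M.curvatureNorm a x ^ 2 ∂riemVolume (M.metric a)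
        ≤ Real.exp (36000 * N₀ * D * (b - a))
          * ∫ x, H b x * M.curvatureNorm b x ^ 2 ∂riemVolume (M.metric b)) := by
  have hIcc : Set.Icc a b ⊆ I := hI.out ha hb
  have hIoo : Set.Ioo a b ⊆ interior I :=
    interior_maximal (Set.Ioo_subset_Icc_self.trans hIcc) isOpen_Ioo
  have hIn : (interior I).Nonempty := (Set.nonempty_Ioo.2 hab).mono hIoo
  rw [(M.integral_cutEnergy_eq hI hIn hH hP ha).2, (M.integral_cutEnergy_eq hI hIn hH hP hb).2]
  have hcont : ContinuousOn (fun s => ∑ i, ∫ y, M.cutEnergy (cc i) (χχ i) H (s, y))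
      (Set.Icc a b) := by
    refine continuousOn_finsetSum _ fun i _ => ?_
    have hLc := isCompact_cutSet (hP.tsupport_subset i) hH.isCompact
    exact (continuousOn_integral_slice hLc (continuousOn_of_zero_off (cc i).open_target hLc
      (cutSet_subset (hP.tsupport_subset i))
      (M.continuousOn_cutEnergy (hP.mem_atlas i) hH (hP.smooth i))
      fun p hp => M.cutEnergy_zero_off hH p hp) fun p hp => M.cutEnergy_zero_off hH p hp).mono hIcc
  -- Summing the chart inequalities over the partition removes the flux terms and leaves a closed
  -- differential inequality for the total energy.
  have hder : ∀ {σ : ℝ}, M.Absorbs H (Set.Ioo a b) σ → |σ| = 1 → ∀ s ∈ Set.Ioo a b,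
      HasDerivAt (fun s => ∑ i, ∫ y, M.cutEnergy (cc i) (χχ i) H (s, y))
        (∑ i, ∫ y, pd tIdx (M.cutEnergy (cc i) (χχ i) H) (s, y)) s ∧
      σ * ∑ i, ∫ y, pd tIdx (M.cutEnergy (cc i) (χχ i) H) (s, y)
        ≤ 36000 * N₀ * D * ∑ i, ∫ y, M.cutEnergy (cc i) (χχ i) H (s, y) := by
    intro σ habs hσ s hs
    have h1 := fun i => M.integral_cutEnergy_deriv hvac (hP.mem_atlas i) hH (hP.smooth i)
      (hP.nonneg i) (hP.tsupport_subset i) habs hσ (hIoo hs) hs (hN s hs) hD0 (hD s hs)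
    refine ⟨HasDerivAt.fun_sum fun i _ => (h1 i).1, ?_⟩
    have h2 := Finset.sum_le_sum fun i (_ : i ∈ Finset.univ) => (h1 i).2
    rw [Finset.sum_sub_distrib, ← Finset.mul_sum, ← Finset.mul_sum, ← Finset.mul_sum,
      M.sum_integral_cutFlux hH hP (hIoo hs), mul_zero, sub_zero] at h2
    exact h2
  constructor
  · intro habs
    refine le_exp_mul_of_deriv_le hab.le hcont (fun s hs => (hder habs (by simp) s hs).1)
      fun s hs => ?_
    have h := (hder habs (by simp) s hs).2
    rwa [one_mul] at h
  · intro habs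
    refine le_exp_mul_of_le_deriv hab.le hcont (fun s hs => (hder habs (by simp) s hs).1)
      fun s hs => ?_
    have h := (hder habs (by simp) s hs).2
    linarith

end FoliatedSpacetime

/-! ### Cutoffs adapted to the finite speed of propagation -/

section Cutoff

variable {S : Type*} [TopologicalSpace S] [ChartedSpace E3 S] {φ : S → ℝ} {θ : ℝ → ℝ}

/-- A smooth cutoff function whose level sets move along the profile `θ`. -/
def movingCutoff (φ : S → ℝ) (θ : ℝ → ℝ) (t : ℝ) (x : S) : ℝ :=
  Real.smoothTransition (2 * (φ x - θ t))

lemma movingCutoff_eq_zero (hθ : ∀ t, 0 ≤ θ t) (t : ℝ) {x : S} (hx : φ x = 0) :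
    movingCutoff φ θ t x = 0 :=
  Real.smoothTransition.zero_of_nonpos (by linarith [hθ t])

lemma movingCutoff_eq_one {t : ℝ} (hθ : θ t ≤ 1 / 2) {x : S} (hx : φ x = 1) :
    movingCutoff φ θ t x = 1 :=
  Real.smoothTransition.one_of_one_le (by linarith)

variable [IsManifold 𝓘(ℝ, E3) ∞ S]

/-- Nonnegativity of `θ` keeps the support inside that of `φ` at every time. -/
lemma isCutoff_movingCutoff (hφ : ContMDiff 𝓘(ℝ, E3) 𝓘(ℝ) ∞ φ) (hc : HasCompactSupport φ)
    (hθs : ContDiff ℝ ∞ θ) (hθ : ∀ t, 0 ≤ θ t) : IsCutoff (movingCutoff φ θ) (tsupport φ) where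
  smooth c hca := by
    have h1 : ContDiffOn ℝ ∞ (fun p : Coord => φ (c.symm p.2)) (Set.univ ×ˢ c.target) :=
      (smooth_comp_symm (IsManifold.subset_maximalAtlas hca) hφ).comp contDiffOn_snd
        fun _ hp => hp.2
    exact Real.smoothTransition.contDiff.comp_contDiffOn
      (contDiffOn_const.mul (h1.sub (hθs.comp contDiff_fst).contDiffOn))
  nonneg _ _ := Real.smoothTransition.nonneg _
  zero_off t x hx := movingCutoff_eq_zero hθ t (image_eq_zero_of_notMem_tsupport hx)
  isCompact := hc

/-- Finitely many charts cover the support of `φ`. Where the cutoff is nonzero so is `φ`, and this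
open condition makes the sum equal to `1` in a whole neighbourhood, as needed to differentiate it.
-/
lemma exists_isPartition [T2Space S] [SecondCountableTopology S]
    (hφ : ContMDiff 𝓘(ℝ, E3) 𝓘(ℝ) ∞ φ) (hc : HasCompactSupport φ) (hθ : ∀ t, 0 ≤ θ t) :
    ∃ (t : Finset S) (χ : t → S → ℝ),
      IsPartition (fun a : t => chartAt E3 (a : S)) χ (movingCutoff φ θ) := by
  have : LocallyCompactSpace S := ChartedSpace.locallyCompactSpace E3 S
  obtain ⟨t, -, ht⟩ := IsCompact.elim_nhds_subcover (s := tsupport φ) hc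
    (fun x => (chartAt E3 x).source)
    fun x _ => (chartAt E3 x).open_source.mem_nhds (mem_chart_source E3 x)
  obtain ⟨f, hf⟩ := SmoothPartitionOfUnity.exists_isSubordinate 𝓘(ℝ, E3) (isClosed_tsupport φ)
    (fun a : t => (chartAt E3 (a : S)).source) (fun a => (chartAt E3 (a : S)).open_source)
    fun x hx => by
      obtain ⟨y, hy, hxy⟩ := Set.mem_iUnion₂.1 (ht hx)
      exact Set.mem_iUnion.2 ⟨⟨y, hy⟩, hxy⟩
  refine ⟨t, fun a => f a, fun a => chart_mem_atlas E3 _, fun a => (f a).contMDiff,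
    fun a x => f.nonneg a x, fun a => hf a, fun s x hx => ?_⟩
  have hx' : φ x ≠ 0 := fun h => hx (movingCutoff_eq_zero hθ s h)
  refine Filter.eventually_of_mem ((isOpen_ne_fun hφ.continuous continuous_const).mem_nhds hx')
    fun z hz => ?_
  have h1 := f.sum_eq_one (subset_tsupport φ hz)
  rwa [finsum_eq_sum_of_fintype] at h1

end Cutoff

/-! ### Absorption of the flux and the energy inequality for compactly supported cutoffs. -/

namespace FoliatedSpacetime

variable {S : Type*} [TopologicalSpace S] [ChartedSpace E3 S] [IsManifold 𝓘(ℝ, E3) ∞ S]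
  {I : Set ℝ} (M : FoliatedSpacetime S I) {c : OpenPartialHomeomorph S E3}
  {φ : S → ℝ} {N₀ D δ σ a b : ℝ}

/-- Both `∂_t H` and `dH` carry the nonnegative factor `2η'`. Time contributes `-θ' |R|²`, space at
most `4 · N₀ · 192 δ |R|²`; hence the required speed `768 N₀ δ` of the profile. -/
lemma absorbs_movingCutoff (hφ : ContMDiff 𝓘(ℝ, E3) 𝓘(ℝ) ∞ φ) {θ : ℝ → ℝ} (hθ : ContDiff ℝ ∞ θ)
    (hσ : |σ| = 1) {J : Set ℝ} (hJ : J ⊆ interior I) (hN : ∀ s ∈ J, ∀ x, M.lapse s x ≤ N₀)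
    (hδ : ∀ s ∈ J, ∀ c ∈ atlas E3 S, ∀ y ∈ c.target, ∀ v : Fin 3 → ℝ, |∑ k, grad c φ y k * v k|
      ≤ δ * Real.sqrt (v ⬝ᵥ gram (M.metric s) c y *ᵥ v))
    (hθ' : ∀ s ∈ J, 768 * N₀ * δ ≤ σ * deriv θ s) :
    M.Absorbs (movingCutoff φ θ) J σ := by
  intro c hc p hpJ hpt
  have hp : p ∈ coordDom I c := ⟨hJ hpJ, hpt⟩
  have hcm : c ∈ IsManifold.maximalAtlas 𝓘(ℝ, E3) ∞ S := IsManifold.subset_maximalAtlas hc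
  set z := 2 * (φ (c.symm p.2) - θ p.1) with hz
  set e := deriv Real.smoothTransition z with he
  have he0 : 0 ≤ e := Real.smoothTransition.monotone.deriv_nonneg
  have hη : HasDerivAt Real.smoothTransition e z :=
    (((Real.smoothTransition.contDiff (n := 1)).differentiable (by simp)) z).hasDerivAt
  have hφd := diffAt_comp_symm hcm hφ hpt
  have ht : pd tIdx (fun q : Coord => movingCutoff φ θ q.1 (c.symm q.2)) p
      = e * (2 * -deriv θ p.1) := by
    have h1 : DifferentiableAt ℝ (fun q : Coord => movingCutoff φ θ q.1 (c.symm q.2)) p := by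
      have h2 : DifferentiableAt ℝ (fun q : Coord => 2 * (φ (c.symm q.2) - θ q.1)) p :=
        ((hφd.comp p differentiableAt_snd).sub
          (((hθ.differentiable (by simp)) p.1).comp p differentiableAt_fst)).const_mul 2
      exact hη.differentiableAt.comp p h2
    have h2 := (hasDerivAt_time_slice (s := p.1) (y := p.2) h1).unique
      (hη.comp p.1 ((((hθ.differentiable (by simp)) p.1).hasDerivAt.const_sub
        (φ (c.symm p.2))).const_mul 2))
    exact h2
  have hk : ∀ k, grad c (movingCutoff φ θ p.1) p.2 k = e * 2 * grad c φ p.2 k := by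
    intro k
    have h1 : HasFDerivAt (fun y => movingCutoff φ θ p.1 (c.symm y))
        (e • ((2 : ℝ) • fderiv ℝ (fun y => φ (c.symm y)) p.2)) p.2 :=
      hη.comp_hasFDerivAt p.2 ((hφd.hasFDerivAt.sub_const (θ p.1)).const_mul 2)
    rw [grad, h1.fderiv]
    simp [grad, mul_assoc]
  have hf : M.flux c p (grad c (movingCutoff φ θ p.1) p.2) = e * 2 * M.flux c p (grad c φ p.2) := by
    rw [M.flux_eq, M.flux_eq, Finset.mul_sum]
    exact Finset.sum_congr rfl fun k _ => by rw [hk]; ring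
  have hb := M.abs_flux_le hc hp (hδ p.1 hpJ c hc p.2 hpt)
  have hen := M.energyIn_nonneg (c := c) p
  have hn0 : 0 < M.lapseIn c p := M.lapse_pos p.1 (interior_subset hp.1) _
  have hnN : M.lapseIn c p ≤ N₀ := hN p.1 hpJ _
  have h1 : -(σ * (4 * (M.lapseIn c p * M.flux c p (grad c φ p.2))))
      ≤ 768 * N₀ * δ * M.energyIn c p := by
    refine (neg_le_abs _).trans ?_
    rw [abs_mul, hσ, one_mul, abs_mul, abs_mul, abs_of_pos hn0, abs_of_pos (by norm_num : (0:ℝ) < 4)]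
    have h2 : M.lapseIn c p * |M.flux c p (grad c φ p.2)|
        ≤ N₀ * (192 * δ * M.energyIn c p) := mul_le_mul hnN hb (abs_nonneg _) (hn0.le.trans hnN)
    linarith
  have h2 := mul_le_mul_of_nonneg_right (hθ' p.1 hpJ) hen
  rw [ht, hf]
  have h3 : 0 ≤ e * 2 * (σ * deriv θ p.1 * M.energyIn c p
      + σ * (4 * (M.lapseIn c p * M.flux c p (grad c φ p.2)))) :=
    mul_nonneg (by positivity) (by linarith)
  linarith

variable [T2Space S] [SecondCountableTopology S] [MeasurableSpace S] [BorelSpace S]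

/-- The square of the `L²` norm of the curvature. -/
def energy (t : ℝ) (A : Set S) : ℝ≥0∞ :=
  ∫⁻ x in A, ENNReal.ofReal (M.curvatureNorm t x) ^ 2 ∂riemVolume (M.metric t)

lemma curvatureNorm_nonneg (t : ℝ) (x : S) : 0 ≤ M.curvatureNorm t x := Real.sqrt_nonneg _

/-- A cutoff between `0` and `1` that equals `1` on `A` bounds the energy in `A` from above and is
bounded by the total energy. The right-hand side may be infinite. -/
lemma energy_le_of_integral_le {H : ℝ → S → ℝ} {C s t : ℝ} {A : Set S} (hA : MeasurableSet A)
    (hH0 : ∀ t x, 0 ≤ H t x) (hH1 : ∀ t x, H t x ≤ 1) (hHA : ∀ x ∈ A, H t x = 1) (hC : 0 ≤ C)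
    (hs : Integrable (fun x => H s x * M.curvatureNorm s x ^ 2) (riemVolume (M.metric s)))
    (ht : Integrable (fun x => H t x * M.curvatureNorm t x ^ 2) (riemVolume (M.metric t)))
    (h : ∫ x, H t x * M.curvatureNorm t x ^ 2 ∂riemVolume (M.metric t)
      ≤ C * ∫ x, H s x * M.curvatureNorm s x ^ 2 ∂riemVolume (M.metric s)) :
    M.energy t A ≤ ENNReal.ofReal C * M.energy s Set.univ := by
  have hl : ∀ {t : ℝ}, Integrable (fun x => H t x * M.curvatureNorm t x ^ 2) (riemVolume (M.metric t))
      → ENNReal.ofReal (∫ x, H t x * M.curvatureNorm t x ^ 2 ∂riemVolume (M.metric t))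
        = ∫⁻ x, ENNReal.ofReal (H t x * M.curvatureNorm t x ^ 2) ∂riemVolume (M.metric t) :=
    fun {t} hi => ofReal_integral_eq_lintegral_ofReal hi
      (Filter.Eventually.of_forall fun x => mul_nonneg (hH0 t x) (sq_nonneg _))
  calc M.energy t A = ∫⁻ x in A, ENNReal.ofReal (H t x * M.curvatureNorm t x ^ 2)
        ∂riemVolume (M.metric t) := setLIntegral_congr_fun hA fun x hx => by
          rw [hHA x hx, one_mul, ENNReal.ofReal_pow (M.curvatureNorm_nonneg t x)]
    _ ≤ ∫⁻ x, ENNReal.ofReal (H t x * M.curvatureNorm t x ^ 2) ∂riemVolume (M.metric t) :=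
        setLIntegral_le_lintegral _ _
    _ ≤ ENNReal.ofReal (C * ∫ x, H s x * M.curvatureNorm s x ^ 2 ∂riemVolume (M.metric s)) := by
        rw [← hl ht]
        exact ENNReal.ofReal_le_ofReal h
    _ = ENNReal.ofReal C
        * ∫⁻ x, ENNReal.ofReal (H s x * M.curvatureNorm s x ^ 2) ∂riemVolume (M.metric s) := by
        rw [ENNReal.ofReal_mul hC, hl hs]
    _ ≤ ENNReal.ofReal C * M.energy s Set.univ := by
        rw [energy, Measure.restrict_univ]
        gcongr with x
        rw [← ENNReal.ofReal_pow (M.curvatureNorm_nonneg s x)]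
        exact ENNReal.ofReal_le_ofReal (mul_le_of_le_one_left (sq_nonneg _) (hH1 s x))

/-- The energy inequality on the set where a function with compact support and small gradient
equals `1`. -/
lemma energy_le_of_small_gradient (hI : I.OrdConnected) (hvac : M.IsVacuum)
    (hφ : ContMDiff 𝓘(ℝ, E3) 𝓘(ℝ) ∞ φ) (hc : HasCompactSupport φ)
    (hab : a < b) (ha : a ∈ I) (hb : b ∈ I) (hN0 : 0 ≤ N₀)
    (hN : ∀ s ∈ Set.Ioo a b, ∀ x, M.lapse s x ≤ N₀) (hD0 : 0 ≤ D)
    (hD : ∀ s ∈ Set.Ioo a b, ∀ x, M.deformationNorm s x ≤ D) (hδ0 : 0 ≤ δ)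
    (hδ : ∀ s ∈ Set.Ioo a b, ∀ c ∈ atlas E3 S, ∀ y ∈ c.target, ∀ v : Fin 3 → ℝ,
      |∑ k, grad c φ y k * v k| ≤ δ * Real.sqrt (v ⬝ᵥ gram (M.metric s) c y *ᵥ v))
    (hsmall : 768 * N₀ * δ * (b - a) ≤ 1 / 6) :
    M.energy b {x | φ x = 1}
        ≤ ENNReal.ofReal (Real.exp (36000 * N₀ * D * (b - a))) * M.energy a Set.univ ∧
      M.energy a {x | φ x = 1}
        ≤ ENNReal.ofReal (Real.exp (36000 * N₀ * D * (b - a))) * M.energy b Set.univ := by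
  have hba : 0 < b - a := sub_pos.2 hab
  have hIoo : Set.Ioo a b ⊆ interior I :=
    interior_maximal (Set.Ioo_subset_Icc_self.trans (hI.out ha hb)) isOpen_Ioo
  have hIn : (interior I).Nonempty := (Set.nonempty_Ioo.2 hab).mono hIoo
  have hA : MeasurableSet {x | φ x = 1} :=
    (isClosed_eq hφ.continuous continuous_const).measurableSet
  set ℓ := 768 * N₀ * δ with hℓ
  have hℓ0 : 0 ≤ ℓ := by positivity
  have hprof : ∀ (σ r : ℝ), |σ| = 1 → (∀ s ∈ Set.Ioo a b, 0 ≤ σ * s + r) → ∀ (t : ℝ),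
      (σ * t + r) / (b - a) ≤ 1 → ∃ θ : ℝ → ℝ, ContDiff ℝ ∞ θ ∧ (∀ t, 0 ≤ θ t) ∧
        (∀ s ∈ Set.Ioo a b, ℓ ≤ σ * deriv θ s) ∧ θ t ≤ 1 / 2 := by
    intro σ r hσ hs t ht
    -- An exponential profile is smooth and positive for all times, unlike a linear one. On `(a, b)`
    -- the exponent is nonnegative, so the speed is at least `ℓ`. At the chosen time it is at most
    -- `1`, so the value is at most `e/6 ≤ 1/2`.
    refine ⟨fun t => ℓ * (b - a) * Real.exp ((σ * t + r) / (b - a)), by fun_prop,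
      fun t => by positivity, fun s hs' => ?_, ?_⟩
    · have h1 : HasDerivAt (fun t => ℓ * (b - a) * Real.exp ((σ * t + r) / (b - a)))
          (ℓ * (b - a) * (Real.exp ((σ * s + r) / (b - a)) * (σ * 1 / (b - a)))) s :=
        (((((hasDerivAt_id s).const_mul σ).add_const r).div_const (b - a)).exp).const_mul _
      rw [h1.deriv]
      have h2 : σ * σ = 1 := by rw [← abs_mul_abs_self, hσ, one_mul]
      have h3 : σ * (ℓ * (b - a) * (Real.exp ((σ * s + r) / (b - a)) * (σ * 1 / (b - a))))
          = (σ * σ) * (ℓ * Real.exp ((σ * s + r) / (b - a))) := by field_simp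
      rw [h3, h2, one_mul]
      exact le_mul_of_one_le_right hℓ0 (Real.one_le_exp (div_nonneg (hs s hs') hba.le))
    · have h1 : Real.exp ((σ * t + r) / (b - a)) ≤ 3 :=
        (Real.exp_le_exp.2 ht).trans (by linarith [Real.exp_one_lt_d9])
      have h2 : ℓ * (b - a) * Real.exp ((σ * t + r) / (b - a)) ≤ 1 / 6 * 3 := by gcongr
      linarith
  constructor
  · obtain ⟨θ, hθs, hθ0, hθ', hθb⟩ := hprof 1 (-a) (by simp) (fun s hs => by linarith [hs.1]) b
      (by rw [div_le_one hba]; linarith)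
    have hH := isCutoff_movingCutoff hφ hc hθs hθ0
    obtain ⟨t, χ, hP⟩ := exists_isPartition hφ hc hθ0
    exact M.energy_le_of_integral_le hA hH.nonneg (fun _ _ => Real.smoothTransition.le_one _)
      (fun x hx => movingCutoff_eq_one hθb hx) (Real.exp_pos _).le
      (M.integral_cutEnergy_eq hI hIn hH hP ha).1 (M.integral_cutEnergy_eq hI hIn hH hP hb).1
      ((M.cutoff_energy_le hI hvac hH hP hab ha hb hN hD0 hD).1
        (M.absorbs_movingCutoff hφ hθs (by simp) hIoo hN hδ hθ'))
  · obtain ⟨θ, hθs, hθ0, hθ', hθa⟩ := hprof (-1) b (by simp) (fun s hs => by linarith [hs.2]) a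
      (by rw [div_le_one hba]; linarith)
    have hH := isCutoff_movingCutoff hφ hc hθs hθ0
    obtain ⟨t, χ, hP⟩ := exists_isPartition hφ hc hθ0
    exact M.energy_le_of_integral_le hA hH.nonneg (fun _ _ => Real.smoothTransition.le_one _)
      (fun x hx => movingCutoff_eq_one hθa hx) (Real.exp_pos _).le
      (M.integral_cutEnergy_eq hI hIn hH hP hb).1 (M.integral_cutEnergy_eq hI hIn hH hP ha).1
      ((M.cutoff_energy_le hI hvac hH hP hab ha hb hN hD0 hD).2
        (M.absorbs_movingCutoff hφ hθs (by simp) hIoo hN hδ hθ'))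

end FoliatedSpacetime

/-! ### Asymptotically flat ends -/

section Ends

lemma abs_quad_le {A : Matrix (Fin 3) (Fin 3) ℝ} {ε : ℝ} (hA : ∀ i j, |A i j| ≤ ε) (v : E3) :
    |(v : Fin 3 → ℝ) ⬝ᵥ A *ᵥ (v : Fin 3 → ℝ)| ≤ 3 * ε * ‖v‖ ^ 2 := by
  have hε : 0 ≤ ε := (abs_nonneg _).trans (hA 0 0)
  have h1 : (v : Fin 3 → ℝ) ⬝ᵥ A *ᵥ (v : Fin 3 → ℝ) = ∑ i, ∑ j, A i j * (v i * v j) := by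
    simp only [dotProduct, Matrix.mulVec, Finset.mul_sum]
    exact Finset.sum_congr rfl fun i _ => Finset.sum_congr rfl fun j _ => by ring
  have h2 : ∀ i j, |A i j * (v i * v j)| ≤ ε * ((v i ^ 2 + v j ^ 2) / 2) := by
    intro i j
    rw [abs_mul]
    refine mul_le_mul (hA i j) ?_ (abs_nonneg _) hε
    rw [abs_mul]
    nlinarith [sq_nonneg (|v i| - |v j|), sq_abs (v i), sq_abs (v j)]
  rw [h1, EuclideanSpace.real_norm_sq_eq]
  refine (Finset.abs_sum_le_sum_abs _ _).trans ((Finset.sum_le_sum fun i _ =>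
    (Finset.abs_sum_le_sum_abs _ _).trans (Finset.sum_le_sum fun j _ => h2 i j)).trans
      (le_of_eq ?_))
  simp only [Fin.sum_univ_three]
  ring

variable {S : Type*} [TopologicalSpace S] [ChartedSpace E3 S]
  {c ψ : OpenPartialHomeomorph S E3} {g : BilinField S}

/-- The metric `g` dominates half the Euclidean metric of the coordinates `ψ` where `|y| > ρ`. -/
def IsLargeEnd (g : BilinField S) (ψ : OpenPartialHomeomorph S E3) (ρ : ℝ) : Prop :=
  ∀ y : E3, ρ < ‖y‖ → y ∈ ψ.target ∧
    ∀ v : E3, ‖v‖ ^ 2 ≤ 2 * ((v : Fin 3 → ℝ) ⬝ᵥ gram g ψ y *ᵥ (v : Fin 3 → ℝ))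

lemma exists_isLargeEnd {r₀ τ : ℝ} (hτ : 0 < τ) (ht : ψ.target = {y | r₀ < ‖y‖})
    (h : ∀ (i l : Fin 3),
      (fun y => iteratedFDeriv ℝ 0
          (fun z => gram g ψ z i l - (1 : Matrix (Fin 3) (Fin 3) ℝ) i l) y)
        =O[Bornology.cobounded E3] fun y => ‖y‖ ^ (-τ - ((0 : ℕ) : ℝ))) :
    ∃ ρ : ℝ, ∀ ρ' ≥ ρ, IsLargeEnd g ψ ρ' := by
  have hlim : ∀ i l, Filter.Tendsto
      (fun y => |gram g ψ y i l - (1 : Matrix (Fin 3) (Fin 3) ℝ) i l|)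
      (Bornology.cobounded E3) (𝓝 0) := by
    intro i l
    have h1 : Filter.Tendsto (fun y : E3 => ‖y‖ ^ (-τ - ((0 : ℕ) : ℝ))) (Bornology.cobounded E3)
        (𝓝 0) := by
      simpa [Function.comp_def] using (tendsto_rpow_neg_atTop hτ).comp (tendsto_norm_cobounded_atTop (E := E3))
    have h2 := ((h i l).trans_tendsto h1).norm
    simpa [norm_iteratedFDeriv_zero] using h2
  -- With entries of `g - δ` below `1/6` the quadratic forms differ by at most `3 · (1/6) |v|² =
  -- |v|²/2`.
  have hev : ∀ᶠ y in Bornology.cobounded E3, ∀ i l,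
      |gram g ψ y i l - (1 : Matrix (Fin 3) (Fin 3) ℝ) i l| < 1 / 6 := by
    simp only [Filter.eventually_all]
    exact fun i l => (hlim i l).eventually (gt_mem_nhds (by norm_num))
  obtain ⟨ρ, -, hρ⟩ := (Filter.hasBasis_cobounded_norm (E := E3)).eventually_iff.1 hev
  refine ⟨max ρ r₀, fun ρ' hρ' y hy => ⟨?_, fun v => ?_⟩⟩
  · rw [ht]
    exact ((le_max_right _ _).trans hρ').trans_lt hy
  · have h1 := hρ (x := y) (((le_max_left _ _).trans hρ').trans hy.le)
    have h2 := abs_quad_le (A := gram g ψ y - 1) (fun i j => (h1 i j).le) v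
    rw [Matrix.sub_mulVec, dotProduct_sub, Matrix.one_mulVec] at h2
    have h3 : (v : Fin 3 → ℝ) ⬝ᵥ (v : Fin 3 → ℝ) = ‖v‖ ^ 2 := by
      rw [EuclideanSpace.real_norm_sq_eq]
      simp [dotProduct, pow_two]
    rw [h3] at h2
    linarith [(abs_le.1 h2).1]

variable [IsManifold 𝓘(ℝ, E3) ∞ S]

lemma gram_quad_trans (hc : c ∈ IsManifold.maximalAtlas 𝓘(ℝ, E3) ∞ S)
    (hψ : ψ ∈ IsManifold.maximalAtlas 𝓘(ℝ, E3) ∞ S) {y : E3} (hy : y ∈ transDom c ψ) (v : E3) :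
    (v : Fin 3 → ℝ) ⬝ᵥ gram g c y *ᵥ (v : Fin 3 → ℝ)
      = (fderiv ℝ (trans c ψ) y v : Fin 3 → ℝ) ⬝ᵥ gram g ψ (trans c ψ y) *ᵥ
        (fderiv ℝ (trans c ψ) y v : Fin 3 → ℝ) := by
  rw [gram_quad, gram_quad, symm_trans hy, symmDeriv_trans hc hψ hy]
  rfl

/-- A straight line, short for the metric, that starts far out in a large end stays in that end. -/
lemma mem_source_of_short (hc : c ∈ IsManifold.maximalAtlas 𝓘(ℝ, E3) ∞ S)
    (hψ : ψ ∈ IsManifold.maximalAtlas 𝓘(ℝ, E3) ∞ S) [T2Space S] {ρ ℓ : ℝ} (hend : IsLargeEnd g ψ ρ)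
    {z w : E3} (hline : ∀ s ∈ Set.Icc (0 : ℝ) 1, z + s • w ∈ c.target)
    (hz : c.symm z ∈ ψ.source) (hfar : ρ + ℓ < ‖trans c ψ z‖) (hℓ : 0 < ℓ)
    (hshort : ∀ s ∈ Set.Icc (0 : ℝ) 1,
      2 * ((w : Fin 3 → ℝ) ⬝ᵥ gram g c (z + s • w) *ᵥ (w : Fin 3 → ℝ)) < ℓ ^ 2) :
    c.symm (z + w) ∈ ψ.source := by
  set γ : ℝ → E3 := fun s => z + s • w with hγ
  have hγc : Continuous γ := by fun_prop
  have hγS : ContinuousOn (fun s => c.symm (γ s)) (Set.Icc 0 1) :=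
    c.symm.continuousOn.comp hγc.continuousOn hline
  set y₀ := trans c ψ z with hy₀
  have hball : ∀ y ∈ Metric.closedBall y₀ ℓ, ρ < ‖y‖ := by
    intro y hy
    have h1 : ‖y₀‖ - ‖y‖ ≤ ‖y₀ - y‖ := norm_sub_norm_le _ _
    rw [Metric.mem_closedBall, dist_comm, dist_eq_norm] at hy
    linarith
  have hball' : Metric.closedBall y₀ ℓ ⊆ ψ.target := fun y hy => (hend y (hball y hy)).1
  -- Continuity method: the set of times at which the line is still in the end and has moved at most
  -- `ℓ a` there is closed and can be continued to the right.
  set s : Set ℝ := {a | c.symm (γ a) ∈ ψ.source ∧ ‖trans c ψ (γ a) - y₀‖ ≤ ℓ * a} with hs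
  have hclosed : IsClosed (s ∩ Set.Icc 0 1) := by
    -- The closed ball about the initial point lies in the coordinate range, so its image is
    -- compact, hence closed in a Hausdorff space. The line cannot leave the end without leaving
    -- this image.
    have hDc : IsClosed (ψ.symm '' Metric.closedBall y₀ ℓ) :=
      ((isCompact_closedBall y₀ ℓ).image_of_continuousOn (ψ.symm.continuousOn.mono hball')).isClosed
    have hT := hγS.preimage_isClosed_of_isClosed isClosed_Icc hDc
    have hTs : ∀ a ∈ Set.Icc (0 : ℝ) 1 ∩ (fun s => c.symm (γ s)) ⁻¹' (ψ.symm '' Metric.closedBall y₀ ℓ),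
        c.symm (γ a) ∈ ψ.source := by
      rintro a ⟨-, y, hy, hya⟩
      have h2 : c.symm (γ a) = ψ.symm y := hya.symm
      rw [h2]
      exact ψ.map_target (hball' hy)
    have hf : ContinuousOn (fun a => ‖trans c ψ (γ a) - y₀‖ - ℓ * a)
        (Set.Icc (0 : ℝ) 1 ∩ (fun s => c.symm (γ s)) ⁻¹' (ψ.symm '' Metric.closedBall y₀ ℓ)) := by
      have h1 : ContinuousOn (fun a => trans c ψ (γ a)) (Set.Icc (0 : ℝ) 1 ∩
          (fun s => c.symm (γ s)) ⁻¹' (ψ.symm '' Metric.closedBall y₀ ℓ)) :=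
        ψ.continuousOn.comp (hγS.mono Set.inter_subset_left) hTs
      exact (h1.sub continuousOn_const).norm.sub (by fun_prop)
    convert hf.preimage_isClosed_of_isClosed hT (isClosed_Iic (a := (0 : ℝ))) using 1
    ext a
    simp only [hs, Set.mem_inter_iff, Set.mem_ofPred_eq, Set.mem_preimage, Set.mem_Iic, sub_nonpos]
    constructor
    · rintro ⟨⟨h1, h2⟩, h3⟩
      refine ⟨⟨h3, trans c ψ (γ a), ?_, ?_⟩, h2⟩
      · rw [Metric.mem_closedBall, dist_eq_norm]
        nlinarith [h3.2]
      · exact ψ.left_inv h1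
    · rintro ⟨⟨h3, h1⟩, h2⟩
      exact ⟨⟨hTs a ⟨h3, h1⟩, h2⟩, h3⟩
  have hsub : Set.Icc (0 : ℝ) 1 ⊆ s := by
    refine hclosed.Icc_subset_of_forall_exists_gt ⟨by simpa [hγ] using hz, by simp [hγ, hy₀]⟩ ?_
    rintro a ⟨⟨ha1, ha2⟩, ha⟩ b hb
    have haI : a ∈ Set.Icc (0 : ℝ) 1 := ⟨ha.1, ha.2.le⟩
    have hdom : γ a ∈ transDom c ψ := ⟨hline a haI, ha1⟩
    have hd : DifferentiableAt ℝ (trans c ψ) (γ a) :=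
      ((smooth_trans hc hψ).contDiffAt (isOpen_transDom.mem_nhds hdom)).differentiableAt (by simp)
    have hγd : HasDerivAt γ w a := by
      simpa [hγ] using! ((hasDerivAt_id a).smul_const w).const_add z
    have hder := hd.hasFDerivAt.comp_hasDerivAt a hγd
    have hmem : trans c ψ (γ a) ∈ Metric.closedBall y₀ ℓ := by
      rw [Metric.mem_closedBall, dist_eq_norm]
      nlinarith [ha.2]
    -- The Euclidean speed in the end is below `ℓ`, strictly, because the metric dominates half the
    -- Euclidean one. The strict inequality is what permits continuation.
    have hnorm : ‖fderiv ℝ (trans c ψ) (γ a) w‖ < ℓ := by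
      have h1 := (hend _ (hball _ hmem)).2 (fderiv ℝ (trans c ψ) (γ a) w)
      rw [← gram_quad_trans hc hψ hdom] at h1
      exact lt_of_pow_lt_pow_left₀ 2 hℓ.le (h1.trans_lt (hshort a haI))
    have h1 := (hder.hasDerivWithinAt (s := Set.Ioi a)).limsup_norm_slope_le hnorm
    have h2 : ∀ᶠ x in 𝓝[>] a, γ x ∈ transDom c ψ :=
      (hγc.continuousAt.eventually (isOpen_transDom.mem_nhds hdom)).filter_mono nhdsWithin_le_nhds
    obtain ⟨x, ⟨hx1, hx2⟩, hx3⟩ := ((h1.and h2).and (Ioc_mem_nhdsGT hb)).exists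
    refine ⟨x, ⟨hx2.2, ?_⟩, hx3⟩
    have hxa : 0 < x - a := sub_pos.2 hx3.1
    rw [Real.norm_eq_abs, abs_of_pos hxa, inv_mul_lt_iff₀ hxa] at hx1
    simp only [Function.comp_apply] at hx1
    have h3 := norm_sub_le_norm_sub_add_norm_sub (trans c ψ (γ x)) (trans c ψ (γ a)) y₀
    change ‖trans c ψ (γ x) - y₀‖ ≤ _
    linarith
  have h1 := (hsub (Set.right_mem_Icc.2 zero_le_one)).1
  simpa [hγ] using h1

/-- The outer part of a large end is closed: the points far out do not accumulate outside. -/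
lemma isClosed_outer [T2Space S] (hψ : ψ ∈ IsManifold.maximalAtlas 𝓘(ℝ, E3) ∞ S) {ρ R : ℝ}
    (hend : IsLargeEnd g ψ ρ) (hR : ρ < R)
    (hg : ∀ c ∈ atlas E3 S, ∀ i j, ContinuousOn (fun y => gram g c y i j) c.target) :
    IsClosed {x | x ∈ ψ.source ∧ R ≤ ‖ψ x‖} := by
  refine isClosed_of_closure_subset fun x₀ hx₀ => ?_
  -- A limit point is joined to a nearby point of the outer region by a coordinate segment of small
  -- length in `g`, which cannot leave the end.
  have hsrc : x₀ ∈ ψ.source := by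
    set c := chartAt E3 x₀ with hc
    have hca : c ∈ atlas E3 S := chart_mem_atlas E3 x₀
    have hcm : c ∈ IsManifold.maximalAtlas 𝓘(ℝ, E3) ∞ S := IsManifold.subset_maximalAtlas hca
    have hxc : x₀ ∈ c.source := mem_chart_source E3 x₀
    obtain ⟨ε, hε, hball⟩ := Metric.nhds_basis_closedBall.mem_iff.1
      (c.open_target.mem_nhds (c.map_source hxc))
    have hbd : ∀ i j, ∃ B, ∀ y ∈ Metric.closedBall (c x₀) ε, ‖gram g c y i j‖ ≤ B := fun i j =>
      (isCompact_closedBall _ _).exists_bound_of_continuousOn ((hg c hca i j).mono hball)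
    choose B hB using hbd
    set b := ∑ i, ∑ j, |B i j| with hb
    have hb' : ∀ y ∈ Metric.closedBall (c x₀) ε, ∀ i j, |gram g c y i j| ≤ b := by
      intro y hy i j
      refine ((hB i j y hy).trans (le_abs_self _)).trans ?_
      refine (Finset.single_le_sum (f := fun j => |B i j|) (fun _ _ => abs_nonneg _)
        (Finset.mem_univ j)).trans ?_
      exact Finset.single_le_sum (f := fun i => ∑ j, |B i j|)
        (fun _ _ => Finset.sum_nonneg fun _ _ => abs_nonneg _) (Finset.mem_univ i)
    have hb0 : 0 ≤ b := Finset.sum_nonneg fun _ _ => Finset.sum_nonneg fun _ _ => abs_nonneg _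
    -- Points with `‖ψ x‖ ≥ R` then satisfy `ρ + ℓ < ‖ψ x‖`.
    set ℓ := (R - ρ) / 2 with hℓ
    have hℓ0 : 0 < ℓ := by rw [hℓ]; linarith
    have hsmall : ∀ᶠ x in 𝓝 x₀, x ∈ c.source ∧ ‖c x - c x₀‖ ≤ ε ∧
        2 * (3 * b * ‖c x₀ - c x‖ ^ 2) < ℓ ^ 2 := by
      have h1 : ContinuousAt c x₀ := c.continuousAt hxc
      have h2 : Filter.Tendsto (fun x => ‖c x - c x₀‖) (𝓝 x₀) (𝓝 0) := by
        simpa using (h1.sub (continuousAt_const (y := c x₀))).norm.tendsto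
      have h3 : Filter.Tendsto (fun x => 2 * (3 * b * ‖c x₀ - c x‖ ^ 2)) (𝓝 x₀) (𝓝 0) := by
        have h4 := ((h2.pow 2).const_mul (3 * b)).const_mul 2
        simpa [norm_sub_rev] using h4
      exact (c.open_source.eventually_mem hxc).and ((h2.eventually (ge_mem_nhds hε)).and
        (h3.eventually (gt_mem_nhds (by positivity))))
    obtain ⟨x, ⟨hx4, hx5⟩, hx1, hx2, hx3⟩ :=
      ((mem_closure_iff_frequently.1 hx₀).and_eventually hsmall).exists
    have hseg : ∀ s ∈ Set.Icc (0 : ℝ) 1,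
        c x + s • (c x₀ - c x) ∈ Metric.closedBall (c x₀) ε := by
      intro s hs
      rw [Metric.mem_closedBall, dist_eq_norm]
      have h1 : c x + s • (c x₀ - c x) - c x₀ = (1 - s) • (c x - c x₀) := by
        module
      rw [h1, norm_smul, Real.norm_eq_abs, abs_of_nonneg (by linarith [hs.2])]
      nlinarith [hs.1, norm_nonneg (c x - c x₀)]
    have htr : trans c ψ (c x) = ψ x := by simp [trans, c.left_inv hx1]
    have h := mem_source_of_short (g := g) hcm hψ hend (ℓ := ℓ) (z := c x) (w := c x₀ - c x)
      (fun s hs => hball (hseg s hs)) (by rwa [c.left_inv hx1]) (by rw [htr, hℓ]; linarith) hℓ0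
      fun s hs => by
        have h1 := (le_abs_self _).trans (abs_quad_le (hb' _ (hseg s hs)) (c x₀ - c x))
        linarith
    rwa [add_sub_cancel, c.left_inv hxc] at h
  refine ⟨hsrc, ?_⟩
  have hcont : ContinuousAt (fun x => ‖ψ x‖) x₀ := (ψ.continuousAt hsrc).norm
  by_contra! hlt
  have h1 : ∀ᶠ x in 𝓝 x₀, ‖ψ x‖ < R := hcont.eventually (gt_mem_nhds hlt)
  obtain ⟨x, hx, hx'⟩ := ((mem_closure_iff_frequently.1 hx₀).and_eventually h1).exists
  exact absurd hx.2 (not_le.2 hx')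

end Ends

/-! ### Cutoffs in asymptotically flat leaves -/

section Ends

variable {S : Type*} [TopologicalSpace S] [ChartedSpace E3 S]
  {c ψ : OpenPartialHomeomorph S E3} {g : BilinField S} {R : ℝ}

/-- A smooth function on the model space that is `1` in the unit ball and `0` outside the ball of
radius `2`. -/
def unitBump : ContDiffBump (0 : E3) := ⟨1, 2, one_pos, one_lt_two⟩

lemma unitBump_eq_one {y : E3} (hy : ‖y‖ ≤ 1) : unitBump y = 1 :=
  unitBump.one_of_mem_closedBall (by simpa [unitBump] using hy)

lemma unitBump_eq_zero {y : E3} (hy : 2 ≤ ‖y‖) : unitBump y = 0 :=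
  unitBump.zero_of_le_dist (by simpa [unitBump] using hy)

lemma exists_bound_fderiv_unitBump : ∃ B : ℝ, 0 ≤ B ∧ ∀ y, ‖fderiv ℝ unitBump y‖ ≤ B := by
  have h1 : Continuous (fderiv ℝ (unitBump : E3 → ℝ)) :=
    (unitBump.contDiff (n := 1)).continuous_fderiv (by simp)
  obtain ⟨B, hB⟩ := (unitBump.hasCompactSupport.fderiv ℝ).exists_bound_of_continuous h1
  exact ⟨B, (norm_nonneg _).trans (hB 0), hB⟩

/-- The cutoff function that removes the part `|y| ≥ 2R` of the end with coordinates `ψ`. -/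
def endCutoff (ψ : OpenPartialHomeomorph S E3) (R : ℝ) (x : S) : ℝ :=
  open scoped Classical in if x ∈ ψ.source then unitBump (R⁻¹ • ψ x) else 1

lemma endCutoff_of_mem {x : S} (hx : x ∈ ψ.source) : endCutoff ψ R x = unitBump (R⁻¹ • ψ x) := by
  simp [endCutoff, hx]

lemma endCutoff_eq_one (hR : 0 < R) {x : S} (hx : x ∈ ψ.source → ‖ψ x‖ ≤ R) :
    endCutoff ψ R x = 1 := by
  by_cases h : x ∈ ψ.source
  · rw [endCutoff_of_mem h]
    refine unitBump_eq_one ?_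
    rw [norm_smul, norm_inv, Real.norm_eq_abs, abs_of_pos hR, inv_mul_le_one₀ hR]
    exact hx h
  · simp [endCutoff, h]

lemma endCutoff_eq_zero (hR : 0 < R) {x : S} (hx : x ∈ ψ.source) (h : 2 * R ≤ ‖ψ x‖) :
    endCutoff ψ R x = 0 := by
  rw [endCutoff_of_mem hx]
  refine unitBump_eq_zero ?_
  rw [norm_smul, norm_inv, Real.norm_eq_abs, abs_of_pos hR, le_inv_mul_iff₀ hR]
  linarith

lemma endCutoff_eventuallyEq_one (hR : 0 < R)
    (hcl : IsClosed {x | x ∈ ψ.source ∧ R ≤ ‖ψ x‖}) {x : S}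
    (hx : ¬ (x ∈ ψ.source ∧ R ≤ ‖ψ x‖)) : endCutoff ψ R =ᶠ[𝓝 x] fun _ => 1 :=
  Filter.eventually_of_mem (hcl.isOpen_compl.mem_nhds hx) fun z hz =>
    endCutoff_eq_one hR fun hzs => by
      by_contra! h
      exact hz ⟨hzs, h.le⟩

variable [IsManifold 𝓘(ℝ, E3) ∞ S]

/-- Off the coordinate domain the function is `1` near every point, because the outer region is
closed in the whole leaf and not merely in the end. -/
lemma contMDiff_endCutoff (hψ : ψ ∈ IsManifold.maximalAtlas 𝓘(ℝ, E3) ∞ S) (hR : 0 < R)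
    (hcl : IsClosed {x | x ∈ ψ.source ∧ R ≤ ‖ψ x‖}) :
    ContMDiff 𝓘(ℝ, E3) 𝓘(ℝ) ∞ (endCutoff ψ R) := by
  intro x
  by_cases hx : x ∈ ψ.source
  · have h1 : ContMDiffAt 𝓘(ℝ, E3) 𝓘(ℝ, E3) ∞ ψ x :=
      (contMDiffOn_of_mem_maximalAtlas hψ).contMDiffAt (ψ.open_source.mem_nhds hx)
    have h2 : ContDiff ℝ ∞ fun y : E3 => unitBump (R⁻¹ • y) :=
      unitBump.contDiff.comp (contDiff_const_smul _)
    exact (h2.contMDiff.contMDiffAt.comp x h1).congr_of_eventuallyEq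
      (Filter.eventually_of_mem (ψ.open_source.mem_nhds hx) fun z hz => endCutoff_of_mem hz)
  · exact contMDiffAt_const.congr_of_eventuallyEq
      (endCutoff_eventuallyEq_one hR hcl fun h => hx h.1)

lemma grad_apply (c : OpenPartialHomeomorph S E3) (u : S → ℝ) (y : E3) (v : Fin 3 → ℝ) :
    ∑ k, grad c u y k * v k = fderiv ℝ (fun z => u (c.symm z)) y (WithLp.toLp 2 v) := by
  conv_rhs => rw [← sum_single (WithLp.toLp 2 v), map_sum]
  simp [grad, mul_comm]

/-- Scaling gives the factor `R⁻¹`. The gradient lives where `‖y‖ ≥ R > ρ`, and there Euclidean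
length is at most `√2` times the length in `g`. -/
lemma abs_grad_endCutoff_le (hc : c ∈ IsManifold.maximalAtlas 𝓘(ℝ, E3) ∞ S)
    (hψ : ψ ∈ IsManifold.maximalAtlas 𝓘(ℝ, E3) ∞ S) {ρ B : ℝ} (hend : IsLargeEnd g ψ ρ)
    (hρR : ρ < R) (hR : 0 < R) (hB : ∀ y, ‖fderiv ℝ unitBump y‖ ≤ B)
    (hcl : IsClosed {x | x ∈ ψ.source ∧ R ≤ ‖ψ x‖}) {y : E3} (hy : y ∈ c.target)
    (v : Fin 3 → ℝ) : |∑ k, grad c (endCutoff ψ R) y k * v k|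
      ≤ R⁻¹ * B * Real.sqrt (2 * (v ⬝ᵥ gram g c y *ᵥ v)) := by
  have hB0 : 0 ≤ B := (norm_nonneg _).trans (hB 0)
  by_cases hx : c.symm y ∈ ψ.source ∧ R ≤ ‖ψ (c.symm y)‖
  · have hdom : y ∈ transDom c ψ := ⟨hy, hx.1⟩
    have hd : DifferentiableAt ℝ (trans c ψ) y :=
      ((smooth_trans hc hψ).contDiffAt (isOpen_transDom.mem_nhds hdom)).differentiableAt (by simp)
    have hev : (fun z => endCutoff ψ R (c.symm z)) =ᶠ[𝓝 y] fun z => unitBump (R⁻¹ • trans c ψ z) :=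
      Filter.eventually_of_mem (isOpen_transDom.mem_nhds hdom) fun z hz => endCutoff_of_mem hz.2
    have hb : HasFDerivAt unitBump (fderiv ℝ unitBump (R⁻¹ • trans c ψ y)) (R⁻¹ • trans c ψ y) :=
      (((unitBump.contDiff (n := 1)).differentiable (by simp)) _).hasFDerivAt
    have hder := hb.comp y (hd.hasFDerivAt.const_smul R⁻¹)
    rw [grad_apply, hev.fderiv_eq]
    have h1 : fderiv ℝ (fun z => unitBump (R⁻¹ • trans c ψ z)) y = _ := hder.fderiv
    rw [h1, ContinuousLinearMap.comp_apply, smul_apply, map_smul, smul_eq_mul,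
      abs_mul, abs_of_pos (inv_pos.2 hR), mul_assoc]
    refine mul_le_mul_of_nonneg_left ?_ (inv_pos.2 hR).le
    refine (ContinuousLinearMap.le_opNorm _ _).trans (mul_le_mul (hB _) ?_ (norm_nonneg _) hB0)
    have h2 := (hend (trans c ψ y) (hρR.trans_le hx.2)).2
      (fderiv ℝ (trans c ψ) y (WithLp.toLp 2 v))
    rw [← gram_quad_trans hc hψ hdom] at h2
    exact Real.le_sqrt_of_sq_le h2
  · have h1 : ∀ k, grad c (endCutoff ψ R) y k = 0 := fun k =>
      grad_eq_zero hy (endCutoff_eventuallyEq_one hR hcl hx) k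
    simp only [h1, zero_mul, Finset.sum_const_zero, abs_zero]
    have := inv_pos.2 hR
    positivity

variable {N : ℕ} {Ψ : Fin N → OpenPartialHomeomorph S E3}

/-- The cutoff function that removes the parts `|y| ≥ 2R` of several ends. -/
def endsCutoff (Ψ : Fin N → OpenPartialHomeomorph S E3) (R : ℝ) (x : S) : ℝ :=
  ∏ j, endCutoff (Ψ j) R x

lemma contMDiff_endsCutoff (hΨ : ∀ j, Ψ j ∈ IsManifold.maximalAtlas 𝓘(ℝ, E3) ∞ S) (hR : 0 < R)
    (hcl : ∀ j, IsClosed {x | x ∈ (Ψ j).source ∧ R ≤ ‖Ψ j x‖}) :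
    ContMDiff 𝓘(ℝ, E3) 𝓘(ℝ) ∞ (endsCutoff Ψ R) :=
  contMDiff_finsetProd fun j _ => contMDiff_endCutoff (hΨ j) hR (hcl j)

lemma endsCutoff_eq_one (hR : 0 < R) {x : S} (hx : ∀ j, x ∈ (Ψ j).source → ‖Ψ j x‖ ≤ R) :
    endsCutoff Ψ R x = 1 := Finset.prod_eq_one fun j _ => endCutoff_eq_one hR (hx j)

/-- The support lies in the compact core together with the annuli `r ≤ ‖y‖ ≤ 2R`. Since `r₀ < r`,
these closed annuli lie inside the coordinate ranges and are compact. -/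
lemma hasCompactSupport_endsCutoff [T2Space S] {r₀ r : ℝ} (hr : r₀ < r)
    (ht : ∀ j, (Ψ j).target = {y | r₀ < ‖y‖}) (hR : 0 < R)
    (hK : IsCompact (⋃ j, {x | x ∈ (Ψ j).source ∧ r < ‖Ψ j x‖})ᶜ) :
    HasCompactSupport (endsCutoff Ψ R) := by
  have hann : IsCompact (Metric.closedBall (0 : E3) (2 * R) ∩ {y | r ≤ ‖y‖}) :=
    (isCompact_closedBall _ _).inter_right (isClosed_le continuous_const continuous_norm)
  have hK' : IsCompact ((⋃ j, {x | x ∈ (Ψ j).source ∧ r < ‖Ψ j x‖})ᶜ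
      ∪ ⋃ j, (Ψ j).symm '' (Metric.closedBall (0 : E3) (2 * R) ∩ {y | r ≤ ‖y‖})) :=
    hK.union (isCompact_iUnion fun j => hann.image_of_continuousOn
      ((Ψ j).symm.continuousOn.mono fun y hy => by
        change y ∈ (Ψ j).target
        rw [ht j]
        exact hr.trans_le hy.2))
  refine HasCompactSupport.intro hK' fun x hx => ?_
  rw [Set.mem_union, not_or] at hx
  obtain ⟨j, hj, hjr⟩ := Set.mem_iUnion.1 (not_not.1 hx.1)
  refine Finset.prod_eq_zero (Finset.mem_univ j) (endCutoff_eq_zero hR hj ?_)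
  by_contra! h
  exact hx.2 (Set.mem_iUnion.2 ⟨j, Ψ j x, ⟨by simpa using h.le, hjr.le⟩, (Ψ j).left_inv hj⟩)

/-- The ends are disjoint, so near any point of an end only its own factor can differ from `1`. -/
lemma abs_grad_endsCutoff_le (hc : c ∈ IsManifold.maximalAtlas 𝓘(ℝ, E3) ∞ S)
    (hΨ : ∀ j, Ψ j ∈ IsManifold.maximalAtlas 𝓘(ℝ, E3) ∞ S)
    (hdisj : Pairwise fun j j' => Disjoint (Ψ j).source (Ψ j').source)
    {ρ B : ℝ} (hend : ∀ j, IsLargeEnd g (Ψ j) ρ)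
    (hρR : ρ < R) (hR : 0 < R) (hB : ∀ y, ‖fderiv ℝ unitBump y‖ ≤ B)
    (hcl : ∀ j, IsClosed {x | x ∈ (Ψ j).source ∧ R ≤ ‖Ψ j x‖}) {y : E3} (hy : y ∈ c.target)
    (v : Fin 3 → ℝ) : |∑ k, grad c (endsCutoff Ψ R) y k * v k|
      ≤ R⁻¹ * B * Real.sqrt (2 * (v ⬝ᵥ gram g c y *ᵥ v)) := by
  by_cases hx : ∃ j, c.symm y ∈ (Ψ j).source
  · obtain ⟨j, hj⟩ := hx
    have hev : (fun z => endsCutoff Ψ R (c.symm z)) =ᶠ[𝓝 y] fun z => endCutoff (Ψ j) R (c.symm z) := by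
      refine Filter.eventually_of_mem ((isOpen_transDom (c := c) (c' := Ψ j)).mem_nhds ⟨hy, hj⟩)
        fun z hz => Finset.prod_eq_single_of_mem j (Finset.mem_univ j) fun i _ hij =>
          endCutoff_eq_one hR fun h => ?_
      exact absurd hz.2 (Set.disjoint_left.1 (hdisj hij) h)
    have h1 : grad c (endsCutoff Ψ R) y = grad c (endCutoff (Ψ j) R) y := by
      funext k
      rw [grad, hev.fderiv_eq, grad]
    rw [h1]
    exact abs_grad_endCutoff_le hc (hΨ j) (hend j) hρR hR hB (hcl j) hy v
  · push Not at hx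
    have h1 : ∀ k, grad c (endsCutoff Ψ R) y k = 0 := by
      refine fun k => grad_eq_zero (a := 1) hy ?_ k
      have h2 : ∀ᶠ z in 𝓝 (c.symm y), ∀ j, endCutoff (Ψ j) R z = 1 :=
        Filter.eventually_all.2 fun j =>
          endCutoff_eventuallyEq_one hR (hcl j) fun h => hx j h.1
      exact h2.mono fun z hz => Finset.prod_eq_one fun j _ => hz j
    simp only [h1, zero_mul, Finset.sum_const_zero, abs_zero]
    have := inv_pos.2 hR
    have hB0 : 0 ≤ B := (norm_nonneg _).trans (hB 0)
    positivity

end Ends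

/-! ### Comparison of the metrics of the leaves and removal of the cutoffs. -/

namespace FoliatedSpacetime

variable {S : Type*} [TopologicalSpace S] [ChartedSpace E3 S] [IsManifold 𝓘(ℝ, E3) ∞ S]
  {I : Set ℝ} (M : FoliatedSpacetime S I) {c : OpenPartialHomeomorph S E3} {N₀ D a b : ℝ}

/-- The metrics of the leaves are comparable. -/
lemma quad_metric_le (hI : I.OrdConnected) (ha : a ∈ I) (hb : b ∈ I)
    (hN : ∀ s ∈ Set.Ioo a b, ∀ x, M.lapse s x ≤ N₀) (hN0 : 0 ≤ N₀) (hD0 : 0 ≤ D)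
    (hD : ∀ s ∈ Set.Ioo a b, ∀ x, M.deformationNorm s x ≤ D) {s : ℝ} (hs : s ∈ Set.Ioo a b)
    (hc : c ∈ atlas E3 S) {y : E3} (hy : y ∈ c.target) (v : Fin 3 → ℝ) :
    v ⬝ᵥ gram (M.metric a) c y *ᵥ v
      ≤ Real.exp (3 * N₀ * D * (b - a)) * (v ⬝ᵥ gram (M.metric s) c y *ᵥ v) := by
  have hcm : c ∈ IsManifold.maximalAtlas 𝓘(ℝ, E3) ∞ S := IsManifold.subset_maximalAtlas hc
  have hIcc : Set.Icc a b ⊆ I := hI.out ha hb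
  have hIoo : Set.Ioo a b ⊆ interior I :=
    interior_maximal (Set.Ioo_subset_Icc_self.trans hIcc) isOpen_Ioo
  have hexp : ∀ t, v ⬝ᵥ gram (M.metric t) c y *ᵥ v
      = ∑ i, ∑ j, v i * v j * gram (M.metric t) c y i j := by
    intro t
    simp only [dotProduct, Matrix.mulVec, Finset.mul_sum]
    exact Finset.sum_congr rfl fun i _ => Finset.sum_congr rfl fun j _ => by ring
  have hpos : ∀ t ∈ I, 0 ≤ v ⬝ᵥ gram (M.metric t) c y *ᵥ v := by
    intro t ht
    by_cases hv : v = 0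
    · simp [hv]
    · exact (M.gram_pos ht hcm hy v hv).le
  obtain ⟨V, hV, hIV, -, hg⟩ := M.exists_smooth_nhds hc
  have hcont : ContinuousOn (fun t => v ⬝ᵥ gram (M.metric t) c y *ᵥ v) I := by
    simp only [hexp]
    refine continuousOn_finsetSum _ fun i _ => continuousOn_finsetSum _ fun j _ =>
      continuousOn_const.mul ?_
    exact (hg i j).continuousOn.comp (f := fun t : ℝ => ((t, y) : Coord)) (by fun_prop)
      fun t ht => hIV ⟨ht, hy⟩
  have hsb : Set.Icc a s ⊆ I := (Set.Icc_subset_Icc_right hs.2.le).trans hIcc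
  have h := le_exp_mul_of_le_deriv (κ := 3 * N₀ * D) hs.1.le (hcont.mono hsb)
    (f' := fun t => ∑ i, ∑ j, v i * v j
      * pd tIdx (fun q : Coord => gram (M.metric q.1) c q.2 i j) (t, y)) ?_ ?_
  · refine h.trans (mul_le_mul_of_nonneg_right (Real.exp_le_exp.2 ?_)
      (hpos s (hIcc ⟨hs.1.le, hs.2.le⟩)))
    have := hs.2.le
    gcongr
  · intro t ht
    simp only [hexp]
    refine HasDerivAt.fun_sum fun i _ => HasDerivAt.fun_sum fun j _ => ?_
    exact (hasDerivAt_time_slice (smoothOn_diffAt hV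
      (hIV ⟨hsb ⟨ht.1.le, ht.2.le⟩, hy⟩) (hg i j))).const_mul (v i * v j)
  · intro t ht
    have ht' : t ∈ Set.Ioo a b := ⟨ht.1, ht.2.trans hs.2⟩
    have h1 := M.abs_pd_gram_le hc (p := (t, y)) ⟨hIoo ht', hy⟩ (D := D) (by
      have h := M.deformationNorm_eq hc (c.map_target hy) (hIoo ht')
      rw [c.right_inv hy] at h
      exact h.symm.le.trans (hD t ht' _)) v
    have h2 := hpos t (interior_subset (hIoo ht'))
    have h3 : 3 * M.lapseIn c (t, y) * D * (v ⬝ᵥ gram (M.metric t) c y *ᵥ v)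
        ≤ 3 * N₀ * D * (v ⬝ᵥ gram (M.metric t) c y *ᵥ v) := by
      have := hN t ht' (c.symm y)
      have h4 : M.lapseIn c (t, y) ≤ N₀ := this
      gcongr
    exact (neg_le_neg h3).trans (neg_le_of_abs_le h1)

variable [T2Space S] [SecondCountableTopology S] [MeasurableSpace S] [BorelSpace S]

/-- Monotone convergence along an exhaustion. -/
lemma energy_le_of_forall_subset {t : ℝ} {C : ℝ≥0∞} {A : ℕ → Set S} (hA : Monotone A)
    (hU : ⋃ n, A n = Set.univ) (n₀ : ℕ) (h : ∀ n ≥ n₀, M.energy t (A n) ≤ C) :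
    M.energy t Set.univ ≤ C := by
  rw [energy, ← hU, setLIntegral_iUnion_of_directed _ (directed_of_isDirected_le hA)]
  exact iSup_le fun n => (lintegral_mono_set (hA (le_max_left n n₀))).trans
    (h _ (le_max_right n n₀))

/-- The constant function `1` has compact support and zero gradient. -/
lemma energy_le_of_compact [CompactSpace S] (hI : I.OrdConnected) (hvac : M.IsVacuum)
    (hab : a < b) (ha : a ∈ I) (hb : b ∈ I) (hN0 : 0 ≤ N₀)
    (hN : ∀ s ∈ Set.Ioo a b, ∀ x, M.lapse s x ≤ N₀) (hD0 : 0 ≤ D)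
    (hD : ∀ s ∈ Set.Ioo a b, ∀ x, M.deformationNorm s x ≤ D) :
    M.energy b Set.univ
        ≤ ENNReal.ofReal (Real.exp (36000 * N₀ * D * (b - a))) * M.energy a Set.univ ∧
      M.energy a Set.univ
        ≤ ENNReal.ofReal (Real.exp (36000 * N₀ * D * (b - a))) * M.energy b Set.univ := by
  have h := M.energy_le_of_small_gradient (φ := fun _ => 1) (δ := 0) hI hvac contMDiff_const
    (HasCompactSupport.of_compactSpace _) hab ha hb hN0 hN hD0 hD le_rfl
    (fun s _ c _ y _ v => by simp [grad]) (by norm_num)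
  simpa using h

/-- The ends of the leaf at time `a` provide cutoffs for the whole slab. Their gradients, measured
at any time in between, are `O(1/n)`, and the constant does not depend on `n`. -/
lemma energy_le_of_flat (haf : IsAsymptoticallyFlat (M.metric a)) (hI : I.OrdConnected)
    (hvac : M.IsVacuum) (hab : a < b) (ha : a ∈ I) (hb : b ∈ I) (hN0 : 0 ≤ N₀)
    (hN : ∀ s ∈ Set.Ioo a b, ∀ x, M.lapse s x ≤ N₀) (hD0 : 0 ≤ D)
    (hD : ∀ s ∈ Set.Ioo a b, ∀ x, M.deformationNorm s x ≤ D) :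
    M.energy b Set.univ
        ≤ ENNReal.ofReal (Real.exp (36000 * N₀ * D * (b - a))) * M.energy a Set.univ ∧
      M.energy a Set.univ
        ≤ ENNReal.ofReal (Real.exp (36000 * N₀ * D * (b - a))) * M.energy b Set.univ := by
  obtain ⟨N, Ψ, r₀, r, τ, -, -, hr, hτ, hΨ, ht, hdisj, hK, hO⟩ := haf
  have hlarge : ∀ j, ∃ ρ : ℝ, ∀ ρ' ≥ ρ, IsLargeEnd (M.metric a) (Ψ j) ρ' := fun j =>
    exists_isLargeEnd hτ (ht j) fun i l => hO j i l 0 (by norm_num)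
  choose ρ' hρ' using hlarge
  obtain ⟨ρ, hρ⟩ := (Finset.univ.image ρ').bddAbove
  have hend : ∀ j, IsLargeEnd (M.metric a) (Ψ j) ρ := fun j =>
    hρ' j ρ (hρ (Finset.mem_coe.2 (Finset.mem_image_of_mem _ (Finset.mem_univ j))))
  obtain ⟨B, hB0, hB⟩ := exists_bound_fderiv_unitBump
  -- The `2` compares Euclidean length with `g_a` far out in the ends, and the exponential compares
  -- `g_a` with `g_s`.
  set q := Real.sqrt (2 * Real.exp (3 * N₀ * D * (b - a))) with hq
  -- Large enough for the radius to exceed `ρ` and for the smallness condition with bound `1/6`.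
  obtain ⟨n₀, hn₀⟩ := exists_nat_gt (max (max ρ 0) (6 * (768 * N₀ * (B * q) * (b - a))))
  set A : ℕ → Set S := fun n => {x | ∀ j, x ∈ (Ψ j).source → ‖Ψ j x‖ ≤ n} with hA
  have hAm : Monotone A := fun m n hmn x hx j hj => (hx j hj).trans (by exact_mod_cast hmn)
  have hAU : ⋃ n, A n = Set.univ := by
    refine Set.eq_univ_of_forall fun x => ?_
    obtain ⟨C, hC⟩ := (Finset.univ.image fun j => ‖Ψ j x‖).bddAbove
    obtain ⟨n, hn⟩ := exists_nat_ge C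
    exact Set.mem_iUnion.2 ⟨n, fun j _ =>
      (hC (Finset.mem_coe.2 (Finset.mem_image_of_mem _ (Finset.mem_univ j)))).trans hn⟩
  have hcontg : ∀ c ∈ atlas E3 S, ∀ i j,
      ContinuousOn (fun y => gram (M.metric a) c y i j) c.target := by
    intro c hc i j
    obtain ⟨V, hV, hIV, -, hg⟩ := M.exists_smooth_nhds hc
    exact (hg i j).continuousOn.comp (f := fun y : E3 => ((a, y) : Coord)) (by fun_prop)
      fun y hy => hIV ⟨ha, hy⟩
  have key : ∀ n ≥ n₀, M.energy b (A n)
        ≤ ENNReal.ofReal (Real.exp (36000 * N₀ * D * (b - a))) * M.energy a Set.univ ∧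
      M.energy a (A n)
        ≤ ENNReal.ofReal (Real.exp (36000 * N₀ * D * (b - a))) * M.energy b Set.univ := by
    intro n hn
    have hnn : max (max ρ 0) (6 * (768 * N₀ * (B * q) * (b - a))) < (n : ℝ) :=
      hn₀.trans_le (by exact_mod_cast hn)
    obtain ⟨h1, hn2⟩ := max_lt_iff.1 hnn
    obtain ⟨hρn, hn0⟩ := max_lt_iff.1 h1
    have hcl : ∀ j, IsClosed {x | x ∈ (Ψ j).source ∧ (n : ℝ) ≤ ‖Ψ j x‖} := fun j =>
      isClosed_outer (hΨ j) (hend j) hρn hcontg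
    have h := M.energy_le_of_small_gradient (φ := endsCutoff Ψ n) (δ := (n : ℝ)⁻¹ * B * q) hI hvac
      (contMDiff_endsCutoff hΨ hn0 hcl) (hasCompactSupport_endsCutoff hr ht hn0 hK) hab ha hb hN0
      hN hD0 hD (by positivity) ?_ ?_
    · have hsub : A n ⊆ {x | endsCutoff Ψ n x = 1} := fun x hx => endsCutoff_eq_one hn0 hx
      exact ⟨(lintegral_mono_set hsub).trans h.1, (lintegral_mono_set hsub).trans h.2⟩
    · intro s hs c hc y hy v
      refine (abs_grad_endsCutoff_le (g := M.metric a) (IsManifold.subset_maximalAtlas hc) hΨ hdisj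
        hend hρn hn0 hB hcl hy v).trans ?_
      rw [mul_assoc (_ * B), hq, ← Real.sqrt_mul (by positivity)]
      refine mul_le_mul_of_nonneg_left (Real.sqrt_le_sqrt ?_) (by positivity)
      rw [mul_assoc]
      exact mul_le_mul_of_nonneg_left (M.quad_metric_le hI ha hb hN hN0 hD0 hD hs hc hy v)
        (by norm_num)
    · have h2 : 768 * N₀ * ((n : ℝ)⁻¹ * B * q) * (b - a)
          = (n : ℝ)⁻¹ * (768 * N₀ * (B * q) * (b - a)) := by ring
      rw [h2, inv_mul_le_iff₀ hn0]
      linarith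
  exact ⟨M.energy_le_of_forall_subset hAm hAU n₀ fun n hn => (key n hn).1,
    M.energy_le_of_forall_subset hAm hAU n₀ fun n hn => (key n hn).2⟩

lemma curvatureL2_eq (t : ℝ) : M.curvatureL2 t = M.energy t Set.univ ^ (1 / 2 : ℝ) := by
  rw [curvatureL2, energy, Measure.restrict_univ]

lemma curvatureL2_le {s t Q C : ℝ} (hC : 0 ≤ C) (hQ : Q ≤ C ^ 2)
    (h : M.energy t Set.univ ≤ ENNReal.ofReal Q * M.energy s Set.univ) :
    M.curvatureL2 t ≤ ENNReal.ofReal C * M.curvatureL2 s := by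
  rw [M.curvatureL2_eq, M.curvatureL2_eq]
  have h1 : ENNReal.ofReal C = ENNReal.ofReal (C ^ 2) ^ (1 / 2 : ℝ) := by
    rw [ENNReal.ofReal_rpow_of_nonneg (sq_nonneg C) (by norm_num), ← Real.sqrt_eq_rpow,
      Real.sqrt_sq hC]
  rw [h1, ← ENNReal.mul_rpow_of_nonneg _ _ (by norm_num)]
  refine ENNReal.rpow_le_rpow (h.trans ?_) (by norm_num)
  gcongr

/-- Since `a < b`, the interval has positive length, so the product bound forces the supremum to be
finite; this is where the convention `∞ · 0 = 0` does no harm. -/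
lemma exists_deformation_bound {K₀ : ℝ} (hI : I.OrdConnected) (hab : a < b) (ha : a ∈ I)
    (hb : b ∈ I) (hK₀ : 0 ≤ K₀)
    (h : volume I * (⨆ t ∈ I, M.deformationSup t) ≤ ENNReal.ofReal K₀) :
    ∃ D : ℝ, 0 ≤ D ∧ (∀ s ∈ I, ∀ x, M.deformationNorm s x ≤ D) ∧ D * (b - a) ≤ K₀ := by
  have hba : 0 < b - a := sub_pos.2 hab
  have hvol : ENNReal.ofReal (b - a) ≤ volume I := by
    rw [← Real.volume_Icc]
    exact measure_mono (hI.out ha hb)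
  have h1 : ENNReal.ofReal (b - a) * (⨆ t ∈ I, M.deformationSup t) ≤ ENNReal.ofReal K₀ :=
    (mul_le_mul_left hvol _).trans h
  have hfin : (⨆ t ∈ I, M.deformationSup t) ≠ ⊤ := by
    intro h2
    rw [h2, ENNReal.mul_top (by simpa using hba)] at h1
    exact ENNReal.ofReal_ne_top (top_le_iff.1 h1)
  refine ⟨(⨆ t ∈ I, M.deformationSup t).toReal, ENNReal.toReal_nonneg, fun s hs x => ?_, ?_⟩
  · refine (ENNReal.ofReal_le_iff_le_toReal hfin).1 ?_
    exact (le_iSup (fun x => ENNReal.ofReal (M.deformationNorm s x)) x).trans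
      (le_iSup₂ (f := fun t (_ : t ∈ I) => M.deformationSup t) s hs)
  · rw [← ENNReal.ofReal_toReal hfin, ← ENNReal.ofReal_mul hba.le,
      ENNReal.ofReal_le_ofReal_iff hK₀] at h1
    linarith

end FoliatedSpacetime

end VacuumFoliation

end

theorem proposition5p2 (N₀ K₀ : ℝ) (hN₀ : 0 < N₀) (hK₀ : 0 < K₀) :
    ∃ C : ℝ, 0 < C ∧
      ∀ (S : Type*) [TopologicalSpace S] [T2Space S] [SecondCountableTopology S]
        [ChartedSpace VacuumFoliation.E3 S] [IsManifold 𝓘(ℝ, VacuumFoliation.E3) ∞ S]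
        [MeasurableSpace S] [BorelSpace S]
        (I : Set ℝ) (M : VacuumFoliation.FoliatedSpacetime S I),
        I.OrdConnected →
        M.IsVacuum →
        (CompactSpace S ∨ ∀ t ∈ I, VacuumFoliation.IsAsymptoticallyFlat (M.metric t)) →
        (∀ t ∈ I, ∀ x, N₀⁻¹ ≤ M.lapse t x ∧ M.lapse t x ≤ N₀) →
        volume I * (⨆ t ∈ I, M.deformationSup t) ≤ ENNReal.ofReal K₀ →
        ∀ t₀ ∈ I, ∀ t ∈ I, M.curvatureL2 t ≤ ENNReal.ofReal C * M.curvatureL2 t₀ := by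
  -- Half the exponent `36000 N₀ K₀` of the energy estimate, since the norm is the square root of
  -- the energy.
  refine ⟨Real.exp (18000 * N₀ * K₀), Real.exp_pos _, ?_⟩
  intro S _ _ _ _ _ _ _ I M hI hvac hcase hlapse hdef t₀ ht₀ t ht
  have hmain : ∀ a ∈ I, ∀ b ∈ I, a < b → ∃ Q : ℝ, Q ≤ Real.exp (18000 * N₀ * K₀) ^ 2 ∧
      M.energy b Set.univ ≤ ENNReal.ofReal Q * M.energy a Set.univ ∧
      M.energy a Set.univ ≤ ENNReal.ofReal Q * M.energy b Set.univ := by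
    intro a ha b hb hab
    obtain ⟨D, hD0, hD, hDK⟩ := M.exists_deformation_bound hI hab ha hb hK₀.le hdef
    have hIoo : Set.Ioo a b ⊆ I := Set.Ioo_subset_Icc_self.trans (hI.out ha hb)
    refine ⟨Real.exp (36000 * N₀ * D * (b - a)), ?_, ?_⟩
    · rw [← Real.exp_nat_mul]
      refine Real.exp_le_exp.2 ?_
      have h := mul_le_mul_of_nonneg_left hDK hN₀.le
      push_cast
      linarith
    · rcases hcase with hS | haf
      · exact M.energy_le_of_compact hI hvac hab ha hb hN₀.le
          (fun s hs x => (hlapse s (hIoo hs) x).2) hD0 fun s hs => hD s (hIoo hs)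
      · exact M.energy_le_of_flat (haf a ha) hI hvac hab ha hb hN₀.le
          (fun s hs x => (hlapse s (hIoo hs) x).2) hD0 fun s hs => hD s (hIoo hs)
  rcases lt_trichotomy t₀ t with h | h | h
  · obtain ⟨Q, hQ, h1, -⟩ := hmain t₀ ht₀ t ht h
    exact M.curvatureL2_le (Real.exp_pos _).le hQ h1
  -- Equal times need only `C ≥ 1`. This also covers an interval reduced to a point, on which the
  -- deformation is not controlled.
  · subst h
    refine le_mul_of_one_le_left' ?_
    rw [ENNReal.one_le_ofReal]
    exact Real.one_le_exp (by positivity)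
  · obtain ⟨Q, hQ, -, h2⟩ := hmain t ht t₀ ht₀ h
    exact M.curvatureL2_le (Real.exp_pos _).le hQ h2
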